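/- Let $M$ be a connected smooth manifold of dimension $m\ge 4$, and let $g_0$ be a smooth symmetric $(0,2)$-tensor field on $M$. Let $\Sigma\subset M$ be the set of points where $g_0$ degenerates. Assume that $g_0$ is a \emph{transverse Riemann--Lorentz metric}: $\Sigma\neq\emptyset$; at each $p\in\Sigma$ one has $d_p(\det(g_{ab}))\neq 0$ in local coordinates; and at each point of $M\setminus\Sigma$ the metric $g_0$ is either positive definite or Lorentzian (nondegenerate of index $1$). Let $\mathcal C=\{e^{2\varphi}g_0:\varphi\in C^\infty(M)\}$ be its conformal class (all metrics in $\mathcal C$ have the same degeneracy set $\Sigma$). Assume that some $g\in\mathcal C$ is a \emph{transverse warped product}: $M$ is (diffeomorphic to) $I\times S$, where $I\subset\mathbb R$ is an open interval with $0\in I$ and $S$ is a smooth $(m-1)$-manifold, and under this identification $$g=f(t)^2\,g_S-t\,dt^2,$$ where $t$ is the coordinate of $I$, $f\in C^\infty(I)$, $f>0$, and $g_S$ is a Riemannian metric on $S$. Assume also that the Weyl tensor vanishes on $M\setminus\Sigma$, i.e. $W=K-h\bullet g_0=0$ there, where $K$ is the covariant curvature of $g_0$, $h=\frac1{m-2}\bigl(\mathrm{Ric}-\frac{\mathrm{Sc}}{2(m-1)}g_0\bigr)$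 is its Schouten tensor and $\bullet$ is the Kulkarni--Nomizu product (this condition depends only on $\mathcal C$). Then around every $p\in\Sigma$ there are a coordinate system $(U,x)$ of $M$, a metric $\bar g\in\mathcal C$ and a function $\tau\in C^\infty(U)$ such that on $U$ $$\bar g=\sum_{i=1}^{m-1}(dx^i)^2+\tau\,(dx^m)^2,$$ and $\tau=0$ is a local equation for $\Sigma$, i.e. $\Sigma\cap U=\{q\in U:\tau(q)=0\}$ and $d\tau\neq0$ at every point of $\Sigma\cap U$. -/

import Mathlib

open scoped Manifold ContDiff Bundle

noncomputable section

/-! ### Coordinate formulas for a (pseudo-Riemannian) metric on an open subset of `ℝ^m`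

A metric in coordinates is a matrix-valued function `G`, with `G y i j = g_{ij}(y)`. All formulas
below are used only at points `y` near which `G` is smooth and invertible. -/

namespace Coord

variable {m : ℕ}

/-- The partial derivative `∂_i F` at `y`. -/
def partialDeriv (i : Fin m) (F : EuclideanSpace ℝ (Fin m) → ℝ) (y : EuclideanSpace ℝ (Fin m)) :
    ℝ :=
  fderiv ℝ F y (EuclideanSpace.single i 1)

/-- Christoffel symbols `Γ^k_{ij} = ½ g^{kl} (∂_i g_{jl} + ∂_j g_{il} - ∂_l g_{ij})`. -/
def christoffel (G : EuclideanSpace ℝ (Fin m) → Matrix (Fin m) (Fin m) ℝ) (k i j : Fin m)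
    (y : EuclideanSpace ℝ (Fin m)) : ℝ :=
  (1 / 2) * ∑ l, (G y)⁻¹ k l *
    (partialDeriv i (fun z => G z j l) y + partialDeriv j (fun z => G z i l) y
      - partialDeriv l (fun z => G z i j) y)

/-- `R^i_{jkl} = ∂_k Γ^i_{lj} - ∂_l Γ^i_{kj} + Γ^i_{ka} Γ^a_{lj} - Γ^i_{la} Γ^a_{kj}`. -/
def riemannUp (G : EuclideanSpace ℝ (Fin m) → Matrix (Fin m) (Fin m) ℝ) (i j k l : Fin m)
    (y : EuclideanSpace ℝ (Fin m)) : ℝ :=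
  partialDeriv k (christoffel G i l j) y - partialDeriv l (christoffel G i k j) y
    + ∑ a, (christoffel G i k a y * christoffel G a l j y
      - christoffel G i l a y * christoffel G a k j y)

/-- The covariant curvature `K_{ijkl} = g_{ia} R^a_{jkl}`, with the sign convention for which
`K = (C / 2) g • g` when the sectional curvature is the constant `C`. -/
def curvature (G : EuclideanSpace ℝ (Fin m) → Matrix (Fin m) (Fin m) ℝ) (i j k l : Fin m)
    (y : EuclideanSpace ℝ (Fin m)) : ℝ :=
  ∑ a, G y i a * riemannUp G a j k l y

/-- The Ricci tensor `Ric_{jl} = R^k_{jkl}`. -/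
def ricci (G : EuclideanSpace ℝ (Fin m) → Matrix (Fin m) (Fin m) ℝ) (j l : Fin m)
    (y : EuclideanSpace ℝ (Fin m)) : ℝ :=
  ∑ k, riemannUp G k j k l y

/-- The scalar curvature `Sc = g^{jl} Ric_{jl}`. -/
def scalarCurv (G : EuclideanSpace ℝ (Fin m) → Matrix (Fin m) (Fin m) ℝ)
    (y : EuclideanSpace ℝ (Fin m)) : ℝ :=
  ∑ j, ∑ l, (G y)⁻¹ j l * ricci G j l y

/-- The Schouten tensor `h = (1 / (m - 2)) (Ric - (Sc / (2 (m - 1))) g)`. -/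
def schouten (G : EuclideanSpace ℝ (Fin m) → Matrix (Fin m) (Fin m) ℝ) (i j : Fin m)
    (y : EuclideanSpace ℝ (Fin m)) : ℝ :=
  (1 / ((m : ℝ) - 2)) * (ricci G i j y - scalarCurv G y / (2 * ((m : ℝ) - 1)) * G y i j)

/-- The Kulkarni–Nomizu product of two symmetric bilinear forms, in components. -/
def kulkarniNomizu (θ η : Fin m → Fin m → ℝ) (i j k l : Fin m) : ℝ :=
  (θ i k * η j l - η i l * θ j k) + (η i k * θ j l - θ i l * η j k)

/-- The Weyl tensor `W = K - h • g`, in components. -/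
def weyl (G : EuclideanSpace ℝ (Fin m) → Matrix (Fin m) (Fin m) ℝ) (i j k l : Fin m)
    (y : EuclideanSpace ℝ (Fin m)) : ℝ :=
  curvature G i j k l y
    - kulkarniNomizu (fun a b => schouten G a b y) (fun a b => G y a b) i j k l

end Coord

/-! ### Type-changing metrics on manifolds -/

/-- A smooth symmetric covariant tensor field of order `2` on an `m`-dimensional smooth manifold.
It is allowed to degenerate. -/
structure SymTwoTensor (m : ℕ) (M : Type*) [TopologicalSpace M]
    [ChartedSpace (EuclideanSpace ℝ (Fin m)) M] [IsManifold (𝓡 m) ∞ M] where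
  /-- the bilinear form on each tangent space -/
  form : ∀ p : M, TangentSpace (𝓡 m) p →L[ℝ] TangentSpace (𝓡 m) p →L[ℝ] ℝ
  symm : ∀ (p : M) (v w : TangentSpace (𝓡 m) p), form p v w = form p w v
  contMDiff : ContMDiff (𝓡 m)
    ((𝓡 m).prod 𝓘(ℝ, EuclideanSpace ℝ (Fin m) →L[ℝ] EuclideanSpace ℝ (Fin m) →L[ℝ] ℝ)) ∞
    (fun p ↦ Bundle.TotalSpace.mk'
      (EuclideanSpace ℝ (Fin m) →L[ℝ] EuclideanSpace ℝ (Fin m) →L[ℝ] ℝ)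
      (E := fun p : M ↦ TangentSpace (𝓡 m) p →L[ℝ] TangentSpace (𝓡 m) p →L[ℝ] ℝ) p (form p))

namespace SymTwoTensor

variable {m : ℕ} {M : Type*} [TopologicalSpace M]
  [ChartedSpace (EuclideanSpace ℝ (Fin m)) M] [IsManifold (𝓡 m) ∞ M]

/-- The set `Σ` of points where `g` degenerates. -/
def singularSet (g : SymTwoTensor m M) : Set M :=
  {p | ∃ v : TangentSpace (𝓡 m) p, v ≠ 0 ∧ ∀ w : TangentSpace (𝓡 m) p, g.form p v w = 0}

/-- The coordinate vector field `∂/∂x^i` of the coordinate system `x`, at the point with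
coordinates `y`. -/
def coordVec (x : OpenPartialHomeomorph M (EuclideanSpace ℝ (Fin m)))
    (y : EuclideanSpace ℝ (Fin m)) (i : Fin m) : TangentSpace (𝓡 m) (x.symm y) :=
  mfderiv (𝓡 m) (𝓡 m) x.symm y (EuclideanSpace.single i (1 : ℝ) : EuclideanSpace ℝ (Fin m))

/-- The components `g_{ij} = g(∂/∂x^i, ∂/∂x^j)` in the coordinate system `x`, as functions of the
coordinates. -/
def inCoord (g : SymTwoTensor m M) (x : OpenPartialHomeomorph M (EuclideanSpace ℝ (Fin m)))
    (y : EuclideanSpace ℝ (Fin m)) : Matrix (Fin m) (Fin m) ℝ :=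
  Matrix.of fun i j => g.form (x.symm y) (coordVec x y i) (coordVec x y j)

/-- `g` is positive definite at `p`. -/
def IsRiemannianAt (g : SymTwoTensor m M) (p : M) : Prop :=
  ∀ v : TangentSpace (𝓡 m) p, v ≠ 0 → 0 < g.form p v v

/-- `g` is nondegenerate of index one at `p`: there is a basis `b` of the tangent space with
`g(b_i, b_j) = ± δ_{ij}` and exactly one minus sign. -/
def IsLorentzianAt (g : SymTwoTensor m M) (p : M) : Prop :=
  ∃ (b : Module.Basis (Fin m) ℝ (TangentSpace (𝓡 m) p)) (i₀ : Fin m), ∀ i j,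
    g.form p (b i) (b j) = if i = j then (if i = i₀ then -1 else 1) else 0

/-- `(M, g)` is a transverse Riemann–Lorentz manifold. -/
structure IsTransverseRiemannLorentz (g : SymTwoTensor m M) : Prop where
  /-- `g` degenerates somewhere -/
  nonempty : g.singularSet.Nonempty
  /-- at every singular point, `d(det(g_{ij})) ≠ 0` in every coordinate system -/
  transverse : ∀ x ∈ IsManifold.maximalAtlas (𝓡 m) ∞ M, ∀ p ∈ x.source, p ∈ g.singularSet →
    fderiv ℝ (fun y => (g.inCoord x y).det) (x p) ≠ 0
  /-- away from the singular points, `g` is Riemannian or Lorentzian -/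
  riemann_or_lorentz : ∀ p, p ∉ g.singularSet → g.IsRiemannianAt p ∨ g.IsLorentzianAt p

/-- The conformal class `{e^{2φ} g : φ ∈ C^∞(M)}`. -/
def conformalClass (g : SymTwoTensor m M) : Set (SymTwoTensor m M) :=
  {g' | ∃ φ : M → ℝ, ContMDiff (𝓡 m) 𝓘(ℝ, ℝ) ∞ φ ∧
    ∀ (p : M) (v w : TangentSpace (𝓡 m) p), g'.form p v w = Real.exp (2 * φ p) * g.form p v w}

/-- The Weyl tensor of `g`, which is defined on the complement of the singular set, is zero:
all its components in all coordinate systems vanish. -/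
def WeylVanishes (g : SymTwoTensor m M) : Prop :=
  ∀ x ∈ IsManifold.maximalAtlas (𝓡 m) ∞ M, ∀ p ∈ x.source, p ∉ g.singularSet →
    ∀ i j k l, Coord.weyl (g.inCoord x) i j k l (x p) = 0

/-- The value `du(v)` of the differential of a real function `u` at a tangent vector `v` at `p`. -/
def differentialAt (u : M → ℝ) (p : M) (v : TangentSpace (𝓡 m) p) : ℝ :=
  mfderiv (𝓡 m) 𝓘(ℝ, ℝ) u p v

/-- `g` is the transverse warped product metric `f(t)² g_S - t dt²` on `M = J × S`. Here `Φ` is the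
identification of `M` with `J × S`, where `J ⊆ ℝ` is an open interval containing `0`; the
function `t` and the projection `π` to `S` are the components of `Φ`. -/
structure IsTransverseWarpedProduct {n : ℕ} {S : Type*} [TopologicalSpace S]
    [ChartedSpace (EuclideanSpace ℝ (Fin n)) S] [IsManifold (𝓡 n) ∞ S]
    (g : SymTwoTensor m M) (J : TopologicalSpace.Opens ℝ)
    (Φ : M ≃ₘ^∞⟮𝓡 m, 𝓘(ℝ, ℝ).prod (𝓡 n)⟯ (J × S)) (f : ℝ → ℝ)
    (gS : Bundle.ContMDiffRiemannianMetric (𝓡 n) ∞ (EuclideanSpace ℝ (Fin n))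
      (fun s : S ↦ TangentSpace (𝓡 n) s)) : Prop where
  ordConnected : (J : Set ℝ).OrdConnected
  zero_mem : (0 : ℝ) ∈ J
  contDiffOn : ContDiffOn ℝ ∞ f J
  pos : ∀ t ∈ J, 0 < f t
  form_eq : ∀ (p : M) (v w : TangentSpace (𝓡 m) p),
    g.form p v w =
      f ((Φ p).1 : ℝ) ^ 2 *
        gS.inner (Φ p).2 (mfderiv (𝓡 m) (𝓡 n) (fun q : M => (Φ q).2) p v)
          (mfderiv (𝓡 m) (𝓡 n) (fun q : M => (Φ q).2) p w)
      - ((Φ p).1 : ℝ) *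
        (differentialAt (fun q : M => ((Φ q).1 : ℝ)) p v *
          differentialAt (fun q : M => ((Φ q).1 : ℝ)) p w)

/-- On the open set `U`, the smooth function `τ` is such that `τ = 0` is an equation for `Σ`. -/
structure IsEquationOn (g : SymTwoTensor m M) (τ : M → ℝ) (U : Set M) : Prop where
  contMDiffOn : ContMDiffOn (𝓡 m) 𝓘(ℝ, ℝ) ∞ τ U
  eq_zero_iff : ∀ q ∈ U, τ q = 0 ↔ q ∈ g.singularSet
  mfderiv_ne_zero : ∀ q ∈ U, q ∈ g.singularSet → mfderiv (𝓡 m) 𝓘(ℝ, ℝ) τ q ≠ 0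

/-- The value `dx^i(v)` for the coordinate system `x`, at a tangent vector `v` at `q`. -/
def coordDiff (x : OpenPartialHomeomorph M (EuclideanSpace ℝ (Fin m))) (i : Fin m) (q : M)
    (v : TangentSpace (𝓡 m) q) : ℝ :=
  differentialAt (fun q' : M => x q' i) q v

/-- In the coordinate system `x` of an `(n + 1)`-dimensional manifold, on its whole domain,
`g = ∑_{i ≤ n} (dx^i)² + τ (dx^{n+1})²`. -/
def HasNormalForm {n : ℕ} {N : Type*} [TopologicalSpace N]
    [ChartedSpace (EuclideanSpace ℝ (Fin (n + 1))) N] [IsManifold (𝓡 (n + 1)) ∞ N]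
    (g : SymTwoTensor (n + 1) N)
    (x : OpenPartialHomeomorph N (EuclideanSpace ℝ (Fin (n + 1)))) (τ : N → ℝ) : Prop :=
  ∀ q ∈ x.source, ∀ v w : TangentSpace (𝓡 (n + 1)) q,
    g.form q v w =
      ∑ i : Fin n, coordDiff x i.castSucc q v * coordDiff x i.castSucc q w
        + τ q * (coordDiff x (Fin.last n) q v * coordDiff x (Fin.last n) q w)

end SymTwoTensor

end

/-! Off `Σ` the warped product equals `f² (g_S + α dt²)` with `α = -t / f²`, so it is conformal to a
product. Vanishing of the Weyl tensor says in particular that the curvature of `g₀` is `θ • g₀` for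
some bilinear form `θ`, and this weaker property is conformally invariant: a conformal change
rescales the curvature and adds a term `c • g` (`curvature_smul`). Hence the product has curvature
`θ • (g_S + α dt²)`. Its components `K(∂_i, ∂_t, ∂_k, ∂_t)` vanish, which forces `θ` to be a
multiple of `g_S` along the fibre, so `g_S` has constant sectional curvature at each point
(`exists_curvature_eq_of_productMetric`). A single value `t ≠ 0` suffices for this, so the
degeneracy at `t = 0` does no harm. As `dim S ≥ 3`, Schur's lemma (`exists_const_curvature`) makes
the curvature locally constant.

A Riemannian metric `H` of constant curvature `C` is conformally flat for the following reason. The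
equation `Hess u = -C u H`, written as a first-order linear system for `u` and its gradient `V`, is
flat because of the curvature condition, so it has local solutions with arbitrary initial values
(`exists_parallel`). For two solutions, `C u u' + H(V, V')` is constant. The solutions `u₀` and
`u_a` with initial values `(1, 0)` and `(0, e_a)`, where the `e_a` are orthonormal, play the part of
the ambient coordinates on a sphere; the functions `θ_a = 2 u_a / (1 + u₀)` are stereographic
coordinates, and the conserved products give `H = ((1 + u₀) / 2)² ∑ (dθ_a)²`
(`exists_stereographic`).

Thus `g_S = w² ∑ (dθ_a)²` near a given point of `S`. The factor `f² w²` is smooth and positive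
across `Σ`, and dividing the warped product by it gives `∑ (dθ_a)² + τ dt²` with `τ = -t / (f² w²)`.
The `θ_a` and `t` are coordinates, and `τ` is `t` times a nowhere zero function, hence an equation
for `Σ = {t = 0}`. The conformal factor is defined near the given point only and is extended to `M`
by a bump function. -/

noncomputable section

/-! ### Flat linear systems of partial differential equations -/

section FlatSystem

set_option synthInstance.maxHeartbeats 400000
set_option maxHeartbeats 1000000

open Filter Topology

variable {E F W : Type*} [NormedAddCommGroup E] [NormedSpace ℝ E]
  [NormedAddCommGroup F] [NormedSpace ℝ F] [NormedAddCommGroup W] [NormedSpace ℝ W]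

/-- Pointwise application of a continuous family of continuous linear maps to a vector. -/
def ContinuousMap.applyCLM {K : Type*} [TopologicalSpace K] [CompactSpace K]
    (Φ : C(K, E →L[ℝ] W)) : E →L[ℝ] C(K, W) :=
  LinearMap.mkContinuous
    { toFun := fun h => ⟨fun σ => Φ σ h, by fun_prop⟩
      map_add' := fun x y => by ext; simp
      map_smul' := fun c x => by ext; simp } ‖Φ‖ (fun h => by
        rw [ContinuousMap.norm_le _ (by positivity)]
        intro σ
        exact (Φ σ).le_of_opNorm_le (Φ.norm_coe_le_norm σ) h)

@[simp] theorem ContinuousMap.applyCLM_apply {K : Type*} [TopologicalSpace K] [CompactSpace K]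
    (Φ : C(K, E →L[ℝ] W)) (h : E) (σ : K) : Φ.applyCLM h σ = Φ σ h := rfl

/-- A family of maps on a compact space with a jointly continuous derivative in the parameter is
differentiable in the parameter for the supremum norm. -/
theorem ContinuousMap.hasFDerivAt_of_pointwise {K : Type*} [TopologicalSpace K] [CompactSpace K]
    (B : E → C(K, W)) (Φ : C(E, C(K, E →L[ℝ] W)))
    (h : ∀ v σ, HasFDerivAt (fun v => B v σ) (Φ v σ) v) (v₀ : E) :
    HasFDerivAt B (Φ v₀).applyCLM v₀ := by
  rw [hasFDerivAt_iff_isLittleO, Asymptotics.isLittleO_iff]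
  intro c hc
  have h1 : ∀ᶠ v in 𝓝 v₀, dist (Φ v) (Φ v₀) < c :=
    Metric.tendsto_nhds.1 (Φ.continuous.tendsto v₀) c hc
  obtain ⟨δ, hδ, hball⟩ := Metric.eventually_nhds_iff_ball.1 h1
  filter_upwards [Metric.ball_mem_nhds v₀ hδ] with v hv
  rw [ContinuousMap.norm_le _ (by positivity)]
  intro σ
  -- The mean value inequality is applied for each `σ` separately. The radius `δ` does not depend on
  -- `σ`, because `Φ` is continuous into a space with the supremum norm.
  exact (convex_ball v₀ δ).norm_image_sub_le_of_norm_hasFDerivWithin_le'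
    (f := fun v => B v σ) (f' := fun v => Φ v σ) (φ := Φ v₀ σ) (C := c)
    (fun x _ => (h x σ).hasFDerivWithinAt)
    (fun x hx => by
      rw [← dist_eq_norm]
      exact (ContinuousMap.dist_apply_le_dist σ).trans (hball x hx).le)
    (Metric.mem_ball_self hδ) hv

/-- Clamping the variable to `[0, 1]` extends the integrand continuously to the whole line, so that
primitives are differentiable on both sides even at the endpoints `0` and `1`. -/
theorem continuous_volterra_integrand (b : C(unitInterval, F →L[ℝ] F)) (X : C(unitInterval, F)) :
    Continuous fun σ : ℝ => (b (Set.projIcc 0 1 zero_le_one σ))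
      (X (Set.projIcc 0 1 zero_le_one σ)) := by
  have := continuous_projIcc (a := (0 : ℝ)) (b := 1) (h := zero_le_one)
  fun_prop

/-- The Volterra operator `X ↦ (s ↦ ∫₀ˢ b(σ) X(σ) dσ)`, as a function of `b`. -/
def volterra (F : Type*) [NormedAddCommGroup F] [NormedSpace ℝ F] :
    C(unitInterval, F →L[ℝ] F) →L[ℝ] C(unitInterval, F) →L[ℝ] C(unitInterval, F) :=
  LinearMap.mkContinuous₂
    (LinearMap.mk₂ ℝ
      (fun (b : C(unitInterval, F →L[ℝ] F)) (X : C(unitInterval, F)) =>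
        (⟨fun s : unitInterval => ∫ σ in (0 : ℝ)..s, (b (Set.projIcc 0 1 zero_le_one σ))
            (X (Set.projIcc 0 1 zero_le_one σ)), 
          (intervalIntegral.continuous_primitive
            (fun a b' => (continuous_volterra_integrand b X).intervalIntegrable a b') 0).comp
              continuous_subtype_val⟩ : C(unitInterval, F)))
      (fun b b' X => by
        ext s
        simp only [ContinuousMap.coe_mk, ContinuousMap.add_apply, add_apply]
        exact intervalIntegral.integral_add
          ((continuous_volterra_integrand b X).intervalIntegrable _ _)
          ((continuous_volterra_integrand b' X).intervalIntegrable _ _))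
      (fun c b X => by
        ext s
        simp only [ContinuousMap.coe_mk, ContinuousMap.smul_apply, smul_apply]
        exact intervalIntegral.integral_smul _ _)
      (fun b X X' => by
        ext s
        simp only [ContinuousMap.coe_mk, ContinuousMap.add_apply, map_add]
        exact intervalIntegral.integral_add
          ((continuous_volterra_integrand b X).intervalIntegrable _ _)
          ((continuous_volterra_integrand b X').intervalIntegrable _ _))
      (fun c b X => by
        ext s
        simp only [ContinuousMap.coe_mk, ContinuousMap.smul_apply, map_smul]
        exact intervalIntegral.integral_smul _ _)) 1 (fun b X => by
        rw [ContinuousMap.norm_le _ (by positivity)]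
        intro s
        refine (intervalIntegral.norm_integral_le_of_norm_le_const (C := ‖b‖ * ‖X‖)
          fun σ _ => ?_).trans ?_
        · exact ((b _).le_of_opNorm_le (b.norm_coe_le_norm _) _).trans
            (by gcongr; exact X.norm_coe_le_norm _)
        · rw [sub_zero, abs_of_nonneg s.2.1, one_mul]
          exact mul_le_of_le_one_right (by positivity) s.2.2)

theorem volterra_apply (b : C(unitInterval, F →L[ℝ] F)) (X : C(unitInterval, F))
    (s : unitInterval) :
    volterra F b X s = ∫ σ in (0 : ℝ)..s, (b (Set.projIcc 0 1 zero_le_one σ))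
            (X (Set.projIcc 0 1 zero_le_one σ)) := rfl

/-- `B v` is the coefficient of the system restricted to the ray `σ ↦ y₀ + σ v`. Regarding it as a
point of one Banach space of curves turns dependence on the direction `v` into ordinary
differentiability. -/
theorem exists_radialFamily {A : E → E →L[ℝ] W} (hA : ContDiff ℝ 1 A) (y₀ : E) :
    ∃ B : E → C(unitInterval, W), (∀ v σ, B v σ = A (y₀ + (σ : ℝ) • v) v) ∧
      ∀ v, ∃ B' : E →L[ℝ] C(unitInterval, W), HasFDerivAt B B' v ∧
        ∀ h σ, B' h σ = (σ : ℝ) • fderiv ℝ A (y₀ + (σ : ℝ) • v) h v + A (y₀ + (σ : ℝ) • v) h := by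
  have hAd : ∀ y, HasFDerivAt A (fderiv ℝ A y) y := fun y =>
    (hA.differentiable one_ne_zero y).hasFDerivAt
  have hAc : Continuous A := hA.continuous
  have hA'c : Continuous (fderiv ℝ A) := hA.continuous_fderiv one_ne_zero
  let B : E → C(unitInterval, W) := fun v =>
    ⟨fun σ => A (y₀ + (σ : ℝ) • v) v, by fun_prop⟩
  let Φ : C(E, C(unitInterval, E →L[ℝ] W)) := ContinuousMap.curry
    ⟨fun p : E × unitInterval => (p.2 : ℝ) • (fderiv ℝ A (y₀ + (p.2 : ℝ) • p.1)).flip p.1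
        + A (y₀ + (p.2 : ℝ) • p.1), by
      have : Continuous fun p : E × unitInterval =>
        (ContinuousLinearMap.flipₗᵢ ℝ E E W) (fderiv ℝ A (y₀ + (p.2 : ℝ) • p.1)) := by
        fun_prop
      exact (((continuous_subtype_val.comp continuous_snd).smul (this.clm_apply continuous_fst)).add
        (by fun_prop))⟩
  refine ⟨B, fun v σ => rfl, fun v => ⟨(Φ v).applyCLM,
    ContinuousMap.hasFDerivAt_of_pointwise B Φ (fun v σ => ?_) v, fun h σ => ?_⟩⟩
  · have h1 : HasFDerivAt (fun v : E => y₀ + (σ : ℝ) • v)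
        ((σ : ℝ) • ContinuousLinearMap.id ℝ E) v :=
      ((hasFDerivAt_id v).const_smul (σ : ℝ)).const_add y₀
    have h2 := HasFDerivAt.clm_apply (c := fun v => A (y₀ + (σ : ℝ) • v))
      (HasFDerivAt.comp v (hAd (y₀ + (σ : ℝ) • v)) h1) (hasFDerivAt_id v)
    refine h2.congr_fderiv ?_
    ext h
    simp [Φ, ContinuousMap.curry, add_comm]
  · rfl

end FlatSystem

end

noncomputable section
section FlatSystem
set_option synthInstance.maxHeartbeats 400000
set_option maxHeartbeats 1000000
open Filter Topology

variable {E F W : Type*} [NormedAddCommGroup E] [NormedSpace ℝ E]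
  [NormedAddCommGroup F] [NormedSpace ℝ F] [NormedAddCommGroup W] [NormedSpace ℝ W]

/-- The solution is `(1 - K v)⁻¹ c`: units are open and inversion is differentiable on them.
Uniqueness is kept for every inhomogeneous term `h`, since it serves to identify the derivative of
`Y`, which solves an equation with a different right-hand side. -/
theorem exists_fixedPoint_family [CompleteSpace F] {K : E → F →L[ℝ] F}
    (hK : ∀ v, DifferentiableAt ℝ K v) (hK0 : K 0 = 0) (c : F) :
    ∃ Y : E → F, Y 0 = c ∧ ∀ᶠ v in 𝓝 0, Y v = c + K v (Y v) ∧
      DifferentiableAt ℝ Y v ∧ ∀ h Z Z' : F, Z = h + K v Z → Z' = h + K v Z' → Z = Z' := by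
  have hT : ∀ v, DifferentiableAt ℝ (fun v => 1 - K v) v := fun v => (hK v).const_sub 1
  have hunit : ∀ᶠ v in 𝓝 (0 : E), IsUnit (1 - K v) :=
    (hT 0).continuousAt (Units.isOpen.mem_nhds (by simp only [hK0, sub_zero]; exact isUnit_one))
  refine ⟨fun v => Ring.inverse (1 - K v) c, by simp [hK0], ?_⟩
  filter_upwards [hunit] with v hv
  refine ⟨?_, ?_, ?_⟩
  · have : ((1 - K v) * Ring.inverse (1 - K v)) c = c := by rw [Ring.mul_inverse_cancel _ hv]; rfl
    have h2 : Ring.inverse (1 - K v) c - K v (Ring.inverse (1 - K v) c) = c := this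
    rw [sub_eq_iff_eq_add] at h2
    exact h2
  · obtain ⟨u, hu⟩ := hv
    have h1 : DifferentiableAt ℝ (Ring.inverse : (F →L[ℝ] F) → _) (1 - K v) := by
      rw [← hu]
      exact (contDiffAt_ringInverse (n := 1) ℝ u).differentiableAt one_ne_zero
    exact DifferentiableAt.clm_apply (c := fun v => Ring.inverse (1 - K v)) (DifferentiableAt.comp (g := Ring.inverse) (f := fun v => 1 - K v) v h1 (hT v))
      (differentiableAt_const c)
  · have key : ∀ h Z : F, Z = h + K v Z → Z = Ring.inverse (1 - K v) h := by
      intro h Z hZ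
      have h1 : (1 - K v) Z = h := by
        change Z - K v Z = h
        rw [sub_eq_iff_eq_add]; exact hZ
      have : (Ring.inverse (1 - K v) * (1 - K v)) Z = Z := by
        rw [Ring.inverse_mul_cancel _ hv]; rfl
      rw [← h1]; exact this.symm
    intro h Z Z' hZ hZ'
    rw [key h Z hZ, key h Z' hZ']

end FlatSystem

end

noncomputable section
section FlatSystem
set_option synthInstance.maxHeartbeats 400000
set_option maxHeartbeats 1000000
open Filter Topology

variable {E F W : Type*} [NormedAddCommGroup E] [NormedSpace ℝ E]
  [NormedAddCommGroup F] [NormedSpace ℝ F] [NormedAddCommGroup W] [NormedSpace ℝ W]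

/-- A flat linear system `DX(y) v = A(y)(v) X(y)` has local solutions with arbitrary initial
values. -/
theorem exists_parallel [CompleteSpace F] {A : E → E →L[ℝ] F →L[ℝ] F} (hA : ContDiff ℝ 1 A)
    {y₀ : E}
    (hflat : ∀ᶠ y in 𝓝 y₀, ∀ v w, ∀ x, fderiv ℝ A y v w x + A y w (A y v x) =
      fderiv ℝ A y w v x + A y v (A y w x)) (x₀ : F) :
    ∃ X : E → F, X y₀ = x₀ ∧ ∀ᶠ y in 𝓝 y₀, HasFDerivAt X ((A y).flip (X y)) y := by
  obtain ⟨B, hBv, hB'⟩ := exists_radialFamily hA y₀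
  have hB0 : B 0 = 0 := by ext; simp [hBv]
  have hBd : ∀ v, DifferentiableAt ℝ B v := fun v => (hB' v).choose_spec.1.differentiableAt
  obtain ⟨Y, hY0, hY⟩ := exists_fixedPoint_family (K := fun v => volterra F (B v))
    (fun v => (volterra F).differentiableAt.comp v (hBd v)) (by simp [hB0])
    (ContinuousMap.const _ x₀)
  -- The system is integrated along each ray from `y₀`, and `X y` is the value at the end of the ray
  -- to `y`. Only the radial derivative is correct by construction; flatness has to give the others.
  refine ⟨fun y => Y (y - y₀) 1, by simp [hY0], ?_⟩
  obtain ⟨r, hr, hball⟩ := Metric.eventually_nhds_iff_ball.1 hflat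
  have hsub : Tendsto (fun y => y - y₀) (𝓝 y₀) (𝓝 0) := by
    have : Continuous fun y : E => y - y₀ := by fun_prop
    simpa using this.tendsto y₀
  filter_upwards [hsub.eventually hY, hsub.eventually hY.eventually_nhds,
    Metric.ball_mem_nhds y₀ hr] with y hy hy2 hyr
  obtain ⟨v, rfl⟩ : ∃ v, y = y₀ + v := ⟨y - y₀, by simp⟩
  simp only [add_sub_cancel_left] at hy hy2
  obtain ⟨hy1, hyd, hyu⟩ := hy
  obtain ⟨B', hBd', hB'v⟩ := hB' v
  have hderiv : ∀ h, fderiv ℝ Y v h =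
      volterra F (B' h) (Y v) + volterra F (B v) (fderiv ℝ Y v h) := by
    intro h
    have h0 := HasFDerivAt.clm_apply (c := fun v => volterra F (B v)) (u := Y)
      ((volterra F).hasFDerivAt.comp v hBd') hyd.hasFDerivAt
    have h1 := h0.const_add (ContinuousMap.const unitInterval x₀)
    have h2 := h1.congr_of_eventuallyEq (f₁ := Y) (hy2.mono fun w hw => hw.1)
    have h3 := congrArg (fun L => L h) h2.fderiv
    refine h3.trans (add_comm _ _)
  have hD : ∀ h, fderiv ℝ Y v h 1 = A (y₀ + v) h (Y v 1) := by
    intro h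
    have hAc := hA.continuous
    -- If `X` solves the system, the variation of the ray solution in the direction `h` must be `σ ↦
    -- σ A(y₀ + σ v) h X`. This candidate is shown to satisfy the linearized Volterra equation
    -- `hderiv`, and uniqueness then applies.
    let D : C(unitInterval, F) := ⟨fun σ => (σ : ℝ) • A (y₀ + (σ : ℝ) • v) h (Y v σ), by
      fun_prop⟩
    have : fderiv ℝ Y v h = D := by
      refine hyu _ _ D (hderiv h) ?_
      ext s
      -- `R` is the curve `Y v` with a real variable, so that it can be differentiated.
      let R : ℝ → F := fun t => x₀ + ∫ σ in (0 : ℝ)..t, (B v (Set.projIcc 0 1 zero_le_one σ))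
            (Y v (Set.projIcc 0 1 zero_le_one σ))
      have hRY : ∀ t : unitInterval, R t = Y v t := by
        intro t
        rw [hy1]; rfl
      have hproj : ∀ t ∈ Set.Icc (0 : ℝ) 1, ((Set.projIcc 0 1 zero_le_one t : unitInterval) : ℝ) = t :=
        fun t ht => by rw [Set.projIcc_of_mem _ ht]
      have hR : ∀ t ∈ Set.Icc (0 : ℝ) 1, HasDerivAt R (A (y₀ + t • v) v (R t)) t := by
        intro t ht
        have h1 := (intervalIntegral.integral_hasDerivAt_right
          ((continuous_volterra_integrand (B v) (Y v)).intervalIntegrable 0 t)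
          ((continuous_volterra_integrand (B v) (Y v)).stronglyMeasurableAtFilter _ _)
          (continuous_volterra_integrand (B v) (Y v)).continuousAt).const_add x₀
        refine h1.congr_deriv ?_
        rw [hBv, ← hRY, hproj t ht]
      have hDd : ∀ t ∈ Set.uIcc (0 : ℝ) s, HasDerivAt
          (fun σ : ℝ => σ • A (y₀ + σ • v) h (R σ))
          ((B' h (Set.projIcc 0 1 zero_le_one t)) (Y v (Set.projIcc 0 1 zero_le_one t)) +
            (B v (Set.projIcc 0 1 zero_le_one t)) (D (Set.projIcc 0 1 zero_le_one t))) t := by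
        intro t ht
        rw [Set.uIcc_of_le s.2.1] at ht
        have ht1 : t ∈ Set.Icc (0 : ℝ) 1 := ⟨ht.1, ht.2.trans s.2.2⟩
        have hl : HasDerivAt (fun σ : ℝ => y₀ + σ • v) v t := by
          simpa using ((hasDerivAt_id t).smul_const v).const_add y₀
        have hAt : HasDerivAt (fun σ : ℝ => A (y₀ + σ • v)) (fderiv ℝ A (y₀ + t • v) v) t :=
          ((hA.differentiable one_ne_zero _).hasFDerivAt).comp_hasDerivAt t hl
        have h3 := (hasDerivAt_id t).smul
          ((hAt.clm_apply (hasDerivAt_const t h)).clm_apply (hR t ht1))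
        refine h3.congr_deriv ?_
        have hmem : y₀ + t • v ∈ Metric.ball y₀ r := by
          rw [Metric.mem_ball, dist_eq_norm, add_sub_cancel_left] at hyr ⊢
          rw [norm_smul, Real.norm_of_nonneg ht1.1]
          exact (mul_le_of_le_one_left (norm_nonneg _) ht1.2).trans_lt hyr
        -- Flatness exchanges the directions `v` and `h`. It is available at this point because the
        -- ray stays in the ball.
        have hf := hball _ hmem v h (R t)
        have hf' := congrArg (fun z => t • z) hf
        simp only [smul_add] at hf'
        rw [hB'v, hBv, ← hRY]
        simp only [D, ContinuousMap.coe_mk, ← hRY, hproj t ht1, add_apply, smul_apply, map_zero,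
          add_zero, map_smul, id, one_smul, smul_add]
        rw [hf']
        abel
      have hint := intervalIntegral.integral_eq_sub_of_hasDerivAt hDd
        (((continuous_volterra_integrand (B' h) (Y v)).add
          (continuous_volterra_integrand (B v) D)).intervalIntegrable _ _)
      rw [intervalIntegral.integral_add
        ((continuous_volterra_integrand (B' h) (Y v)).intervalIntegrable _ _)
          ((continuous_volterra_integrand (B v) D).intervalIntegrable _ _)] at hint
      rw [ContinuousMap.add_apply, volterra_apply, volterra_apply, hint, zero_smul, sub_zero, hRY]
      rfl
    rw [this]
    simp [D]
  have h1 : HasFDerivAt (fun y => Y (y - y₀)) (fderiv ℝ Y v) (y₀ + v) := by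
    have h2 : HasFDerivAt Y (fderiv ℝ Y v) (y₀ + v - y₀) := by
      rw [add_sub_cancel_left]; exact hyd.hasFDerivAt
    exact h2.comp (y₀ + v) ((hasFDerivAt_id _).sub_const y₀)
  have h2 := (ContinuousMap.evalCLM ℝ (1 : unitInterval)).hasFDerivAt.comp (y₀ + v) h1
  refine h2.congr_fderiv ?_
  ext h
  rw [add_sub_cancel_left]
  exact hD h

end FlatSystem

end

/-! ### Smoothness of solutions, and flat systems in index form -/

noncomputable section

section FlatSystemCoord

set_option synthInstance.maxHeartbeats 400000
set_option maxHeartbeats 1000000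

open Filter Topology

/-- A smooth function near a point agrees near that point with a globally smooth function. -/
theorem exists_contDiff_eventuallyEq {E F : Type*} [NormedAddCommGroup E] [NormedSpace ℝ E]
    [HasContDiffBump E] [NormedAddCommGroup F] [NormedSpace ℝ F] {f : E → F} {y₀ : E} {U : Set E}
    (hU : U ∈ 𝓝 y₀) (hf : ContDiffOn ℝ ∞ f U) :
    ∃ g : E → F, ContDiff ℝ ∞ g ∧ g =ᶠ[𝓝 y₀] f := by
  obtain ⟨r, hr, hball⟩ := Metric.mem_nhds_iff.1 hU
  let χ : ContDiffBump y₀ := ⟨r / 3, r / 2, by positivity, by linarith⟩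
  refine ⟨fun y => χ y • f y, ?_, ?_⟩
  · rw [contDiff_iff_contDiffAt]
    intro y
    by_cases hy : y ∈ Metric.ball y₀ r
    · exact χ.contDiff.contDiffAt.smul
        ((hf.mono hball).contDiffAt (Metric.isOpen_ball.mem_nhds hy))
    · have : y ∈ (Metric.closedBall y₀ (r / 2))ᶜ := by
        simp only [Metric.mem_ball, not_lt, Set.mem_compl_iff, Metric.mem_closedBall, not_le] at hy ⊢
        linarith
      refine (contDiffAt_const (c := (0 : F))).congr_of_eventuallyEq ?_
      filter_upwards [Metric.isClosed_closedBall.isOpen_compl.mem_nhds this] with z hz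
      rw [χ.zero_of_le_dist (by
        have : r / 2 < dist z y₀ := by simpa using hz
        exact this.le), zero_smul]
  · filter_upwards [χ.eventuallyEq_one] with y hy
    rw [hy]; simp

theorem contDiff_sum_smul {E G κ : Type*} [NormedAddCommGroup E] [NormedSpace ℝ E]
    [NormedAddCommGroup G] [NormedSpace ℝ G] [Fintype κ] {C : κ → E → ℝ}
    (hC : ∀ i, ContDiff ℝ ∞ (C i)) (L : κ → G) : ContDiff ℝ ∞ (fun y => ∑ i, C i y • L i) :=
  ContDiff.sum fun i _ => (hC i).smul contDiff_const

theorem hasFDerivAt_sum_smul {E G κ : Type*} [NormedAddCommGroup E] [NormedSpace ℝ E]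
    [NormedAddCommGroup G] [NormedSpace ℝ G] [Fintype κ] {C : κ → E → ℝ}
    (hC : ∀ i, ContDiff ℝ ∞ (C i)) (L : κ → G) (y : E) :
    HasFDerivAt (fun y => ∑ i, C i y • L i) (∑ i, (fderiv ℝ (C i) y).smulRight (L i)) y :=
  HasFDerivAt.fun_sum fun i _ => ((hC i).differentiable (by simp) y).hasFDerivAt.smul_const _

/-- Solutions of smooth linear systems are smooth. -/
theorem contDiffOn_of_parallel {E F : Type*} [NormedAddCommGroup E] [NormedSpace ℝ E]
    [NormedAddCommGroup F] [NormedSpace ℝ F] {Φ : E → F →L[ℝ] E →L[ℝ] F} (hΦ : ContDiff ℝ ∞ Φ)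
    {V : Set E} (hV : IsOpen V) {X : E → F}
    (hX : ∀ y ∈ V, HasFDerivAt X (Φ y (X y)) y) : ContDiffOn ℝ ∞ X V := by
  rw [contDiffOn_infty]
  intro k
  -- Bootstrap: if `X` is `C^k`, then its derivative `Φ y (X y)` is `C^k`, so `X` is `C^(k+1)`.
  induction k with
  | zero =>
    exact contDiffOn_zero.2 fun y hy => (hX y hy).continuousAt.continuousWithinAt
  | succ k ih =>
    have : ((k + 1 : ℕ) : WithTop ℕ∞) = (k : WithTop ℕ∞) + 1 := by norm_cast
    rw [this, contDiffOn_succ_iff_fderiv_of_isOpen hV]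
    refine ⟨fun y hy => (hX y hy).differentiableAt.differentiableWithinAt, by simp, ?_⟩
    have hle : (k : WithTop ℕ∞) ≤ ∞ := by exact_mod_cast (le_top : (k : ℕ∞) ≤ ⊤)
    exact ((hΦ.of_le hle).contDiffOn.clm_apply ih).congr fun y hy => (hX y hy).fderiv

/-- The coefficients are replaced by globally smooth functions with the same germ at `y₀`, as
`exists_parallel` asks for global regularity but only local flatness. Writing the system as scalar
functions times constant operators `L i` lets derivatives fall on the scalars alone. -/
theorem exists_solution_of_flat_sum {E F κ : Type*} [NormedAddCommGroup E] [NormedSpace ℝ E]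
    [HasContDiffBump E] [NormedAddCommGroup F] [NormedSpace ℝ F] [CompleteSpace F] [Fintype κ]
    {B : κ → E → ℝ} (L : κ → E →L[ℝ] F →L[ℝ] F) {U : Set E} {y₀ : E} (hU : U ∈ 𝓝 y₀)
    (hB : ∀ i, ContDiffOn ℝ ∞ (B i) U)
    (hflat : ∀ y ∈ U, ∀ v w x,
      ∑ i, fderiv ℝ (B i) y v • L i w x + ∑ i, B i y • L i w (∑ j, B j y • L j v x) =
      ∑ i, fderiv ℝ (B i) y w • L i v x + ∑ i, B i y • L i v (∑ j, B j y • L j w x)) (x₀ : F) :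
    ∃ X : E → F, X y₀ = x₀ ∧ ∃ V ∈ 𝓝 y₀, IsOpen V ∧ ContDiffOn ℝ ∞ X V ∧
      ∀ y ∈ V, ∀ v, fderiv ℝ X y v = ∑ i, B i y • L i v (X y) := by
  choose C hC hCB using fun i => exists_contDiff_eventuallyEq hU (hB i)
  have hA := contDiff_sum_smul (G := E →L[ℝ] F →L[ℝ] F) hC L
  have hAd := hasFDerivAt_sum_smul (G := E →L[ℝ] F →L[ℝ] F) hC L
  have h1 : ∀ᶠ y in 𝓝 y₀, ∀ i, C i =ᶠ[𝓝 y] B i := by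
    simp only [Filter.eventually_all]
    exact fun i => (hCB i).eventuallyEq_nhds
  have hflat' : ∀ᶠ y in 𝓝 y₀, ∀ v w, ∀ x,
      fderiv ℝ (fun y => ∑ i, C i y • L i) y v w x +
        (∑ i, C i y • L i) w ((∑ i, C i y • L i) v x) =
      fderiv ℝ (fun y => ∑ i, C i y • L i) y w v x +
        (∑ i, C i y • L i) v ((∑ i, C i y • L i) w x) := by
    filter_upwards [h1, hU] with y hy hyU v w x
    have := hflat y hyU v w x
    rw [(hAd y).fderiv]
    simp only [sum_apply, smul_apply, ContinuousLinearMap.smulRight_apply,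
      (hy _).fderiv_eq, (hy _).eq_of_nhds] at this ⊢
    exact this
  obtain ⟨X, hX0, hX⟩ := exists_parallel (hA.of_le (by simp)) hflat' x₀
  obtain ⟨V, hV, hVo, hyV⟩ := eventually_nhds_iff.1 (hX.and h1)
  refine ⟨X, hX0, V, hVo.mem_nhds hyV, hVo,
    contDiffOn_of_parallel (contDiff_sum_smul (G := F →L[ℝ] E →L[ℝ] F) hC fun i => (L i).flip) hVo
      fun y hy => (hV y hy).1.congr_fderiv ?_, fun y hy v => ?_⟩
  · ext v
    simp only [sum_apply, smul_apply, ContinuousLinearMap.flip_apply]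
  rw [(hV y hy).1.fderiv]
  simp only [sum_apply, smul_apply, ContinuousLinearMap.flip_apply,
    ((hV y hy).2 _).eq_of_nhds]

variable {n : ℕ} {ι : Type*} [DecidableEq ι]

theorem Coord.fderiv_eq_sum (F : EuclideanSpace ℝ (Fin n) → ℝ) (y v : EuclideanSpace ℝ (Fin n)) :
    fderiv ℝ F y v = ∑ l, v l * Coord.partialDeriv l F y := by
  have : v = ∑ l, v l • EuclideanSpace.single l (1 : ℝ) := by
    ext i
    simp [Finset.sum_apply, Pi.single_apply]
  conv_lhs => rw [this]
  simp [Coord.partialDeriv]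

/-- The elementary coefficient `v ↦ x ↦ v_k x_b e_a`. -/
def elementaryCLM (k : Fin n) (a b : ι) : EuclideanSpace ℝ (Fin n) →L[ℝ] (ι → ℝ) →L[ℝ] (ι → ℝ) :=
  (EuclideanSpace.proj k : EuclideanSpace ℝ (Fin n) →L[ℝ] ℝ).smulRight
    ((ContinuousLinearMap.proj b : (ι → ℝ) →L[ℝ] ℝ).smulRight (Pi.single a (1 : ℝ)))

theorem elementaryCLM_apply (k : Fin n) (a b c : ι) (v : EuclideanSpace ℝ (Fin n)) (x : ι → ℝ) :
    elementaryCLM k a b v x c = if c = a then v k * x b else 0 := by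
  simp [elementaryCLM, Pi.single_apply]

variable [Fintype ι]

/-- For the system `∂_k X = B_k X`, flatness is the equality of the mixed derivatives `∂_l ∂_k X`
and `∂_k ∂_l X`, that is, symmetry of `∂_l B_k + B_k B_l` in `k` and `l`. -/
theorem exists_solution_of_flat {B : Fin n → ι → ι → EuclideanSpace ℝ (Fin n) → ℝ}
    {U : Set (EuclideanSpace ℝ (Fin n))} {y₀ : EuclideanSpace ℝ (Fin n)} (hU : U ∈ 𝓝 y₀)
    (hB : ∀ k a b, ContDiffOn ℝ ∞ (B k a b) U)
    (hflat : ∀ y ∈ U, ∀ k l a b,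
      Coord.partialDeriv l (B k a b) y + ∑ c, B k a c y * B l c b y =
      Coord.partialDeriv k (B l a b) y + ∑ c, B l a c y * B k c b y) (x₀ : ι → ℝ) :
    ∃ X : ι → EuclideanSpace ℝ (Fin n) → ℝ, (∀ a, X a y₀ = x₀ a) ∧
      ∃ V ∈ 𝓝 y₀, IsOpen V ∧ ∀ a, ContDiffOn ℝ ∞ (X a) V ∧ ∀ y ∈ V, ∀ k,
        Coord.partialDeriv k (X a) y = ∑ b, B k a b y * X b y := by
  have hsum : ∀ (g : Fin n × ι × ι → ℝ) v x a,
      (∑ i, g i • elementaryCLM i.1 i.2.1 i.2.2 v x) a =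
        ∑ k, ∑ b, g (k, a, b) * (v k * x b) := by
    intro g v x a
    simp only [Fintype.sum_prod_type, Finset.sum_apply, Pi.smul_apply, elementaryCLM_apply,
      smul_eq_mul]
    refine Finset.sum_congr rfl fun k _ => ?_
    rw [Finset.sum_comm]
    refine Finset.sum_congr rfl fun b _ => ?_
    simp
  obtain ⟨X, hX0, V, hVn, hVo, hXs, hX⟩ := exists_solution_of_flat_sum (κ := Fin n × ι × ι)
    (B := fun i => B i.1 i.2.1 i.2.2) (fun i => elementaryCLM i.1 i.2.1 i.2.2) hU
    (fun i => hB _ _ _) (fun y hy v w x => by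
      ext a
      rw [Pi.add_apply, Pi.add_apply]
      simp only [hsum]
      have h1 : ∀ v w : EuclideanSpace ℝ (Fin n),
          ∑ k, ∑ b, fderiv ℝ (B k a b) y v * (w k * x b) +
          ∑ k, ∑ b, B k a b y * (w k * ∑ l, ∑ c, B l b c y * (v l * x c)) =
          ∑ b, ∑ k, ∑ l, v l * w k * x b *
            (Coord.partialDeriv l (B k a b) y + ∑ c, B k a c y * B l c b y) := by
        intro v w
        conv_rhs => rw [Finset.sum_comm]
        rw [← Finset.sum_add_distrib]
        refine Finset.sum_congr rfl fun k _ => ?_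
        simp only [mul_add, Finset.sum_add_distrib, Finset.mul_sum]
        congr 1
        · refine Finset.sum_congr rfl fun b _ => ?_
          rw [Coord.fderiv_eq_sum, Finset.sum_mul]
          refine Finset.sum_congr rfl fun l _ => ?_
          ring
        · rw [Finset.sum_comm]
          conv_rhs => rw [Finset.sum_comm]
          refine Finset.sum_congr rfl fun l _ => ?_
          rw [Finset.sum_comm]
          refine Finset.sum_congr rfl fun b _ => Finset.sum_congr rfl fun c _ => ?_
          ring
      rw [h1, h1]
      refine Finset.sum_congr rfl fun b _ => ?_
      rw [Finset.sum_comm]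
      refine Finset.sum_congr rfl fun l _ => Finset.sum_congr rfl fun k _ => ?_
      rw [hflat y hy]; ring) x₀
  refine ⟨fun a y => X y a, fun a => congrFun hX0 a, V, hVn, hVo,
    fun a => ⟨contDiffOn_pi.1 hXs a, fun y hy k => ?_⟩⟩
  have h2 := hasFDerivAt_pi'.1
    ((hXs.contDiffAt (hVo.mem_nhds hy)).differentiableAt (by simp)).hasFDerivAt a
  rw [Coord.partialDeriv, h2.fderiv, ContinuousLinearMap.comp_apply,
    ContinuousLinearMap.proj_apply, hX y hy, hsum, Finset.sum_eq_single k]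
  · simp
  · intro j _ hj; simp [hj]
  · simp

end FlatSystemCoord

end

noncomputable section

/-! ### Curvature in coordinates -/

namespace Coord

open Filter Topology

variable {m : ℕ}

section PartialDeriv

variable {F F' : EuclideanSpace ℝ (Fin m) → ℝ} {y : EuclideanSpace ℝ (Fin m)}
  {U : Set (EuclideanSpace ℝ (Fin m))}

theorem partialDeriv_add (k : Fin m) (h : DifferentiableAt ℝ F y) (h' : DifferentiableAt ℝ F' y) :
    partialDeriv k (fun z => F z + F' z) y = partialDeriv k F y + partialDeriv k F' y := by
  simp only [partialDeriv]
  rw [fderiv_fun_add h h']; rfl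

theorem partialDeriv_sub (k : Fin m) (h : DifferentiableAt ℝ F y) (h' : DifferentiableAt ℝ F' y) :
    partialDeriv k (fun z => F z - F' z) y = partialDeriv k F y - partialDeriv k F' y := by
  simp only [partialDeriv]
  rw [fderiv_fun_sub h h']; rfl

theorem partialDeriv_mul (k : Fin m) (h : DifferentiableAt ℝ F y) (h' : DifferentiableAt ℝ F' y) :
    partialDeriv k (fun z => F z * F' z) y =
      F y * partialDeriv k F' y + partialDeriv k F y * F' y := by
  simp only [partialDeriv]
  rw [fderiv_fun_mul h h']
  simp only [add_apply, smul_apply, smul_eq_mul]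
  ring

theorem partialDeriv_const_mul (k : Fin m) (c : ℝ) (h : DifferentiableAt ℝ F y) :
    partialDeriv k (fun z => c * F z) y = c * partialDeriv k F y := by
  simp only [partialDeriv]
  rw [fderiv_const_mul h]; rfl

theorem partialDeriv_neg (k : Fin m) :
    partialDeriv k (fun z => - F z) y = - partialDeriv k F y := by
  simp only [partialDeriv]
  rw [fderiv_fun_neg]; rfl

theorem partialDeriv_sum {ι : Type*} {s : Finset ι} {f : ι → EuclideanSpace ℝ (Fin m) → ℝ}
    (k : Fin m) (h : ∀ i ∈ s, DifferentiableAt ℝ (f i) y) :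
    partialDeriv k (fun z => ∑ i ∈ s, f i z) y = ∑ i ∈ s, partialDeriv k (f i) y := by
  simp only [partialDeriv]
  rw [fderiv_fun_sum h]
  simp

theorem partialDeriv_congr (k : Fin m) (h : F =ᶠ[𝓝 y] F') :
    partialDeriv k F y = partialDeriv k F' y := by
  simp only [partialDeriv, h.fderiv_eq]

theorem partialDeriv_congr_of_isOpen (hU : IsOpen U) (h : ∀ z ∈ U, F z = F' z) (k : Fin m)
    (hy : y ∈ U) : partialDeriv k F y = partialDeriv k F' y :=
  partialDeriv_congr k (Filter.eventuallyEq_of_mem (hU.mem_nhds hy) h)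

@[simp] theorem partialDeriv_const (k : Fin m) (c : ℝ) : partialDeriv k (fun _ => c) y = 0 := by
  simp [partialDeriv]

theorem contDiffOn_partialDeriv (hU : IsOpen U) (h : ContDiffOn ℝ ∞ F U) (k : Fin m) :
    ContDiffOn ℝ ∞ (partialDeriv k F) U :=
  (h.fderiv_of_isOpen hU (by simp)).clm_apply contDiffOn_const

theorem partialDeriv_comm (hU : IsOpen U) (h : ContDiffOn ℝ ∞ F U) (k l : Fin m) (hy : y ∈ U) :
    partialDeriv k (partialDeriv l F) y = partialDeriv l (partialDeriv k F) y := by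
  have h1 : ContDiffAt ℝ ∞ F y := h.contDiffAt (hU.mem_nhds hy)
  have h2 : DifferentiableAt ℝ (fderiv ℝ F) y :=
    (h1.fderiv_right (m := 1) (by norm_cast)).differentiableAt one_ne_zero
  have h2le : (2 : WithTop ℕ∞) ≤ ∞ := WithTop.coe_le_coe.2 (le_top : (2 : ℕ∞) ≤ ⊤)
  have h3 := h1.isSymmSndFDerivAt (by simp [h2le])
  have h4 : ∀ k l : Fin m, partialDeriv k (partialDeriv l F) y =
      fderiv ℝ (fderiv ℝ F) y (EuclideanSpace.single k 1) (EuclideanSpace.single l 1) := by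
    intro k l
    have : HasFDerivAt (partialDeriv l F)
      ((fderiv ℝ (fderiv ℝ F) y).flip (EuclideanSpace.single l 1)) y := by
      have := h2.hasFDerivAt.clm_apply
        (hasFDerivAt_const (EuclideanSpace.single l (1 : ℝ) : EuclideanSpace ℝ (Fin m)) y)
      simpa using! this
    rw [partialDeriv, this.fderiv]; rfl
  rw [h4, h4, h3.eq]

theorem differentiableAt_of_contDiffOn (hU : IsOpen U) (h : ContDiffOn ℝ ∞ F U) (hy : y ∈ U) :
    DifferentiableAt ℝ F y := (h.contDiffAt (hU.mem_nhds hy)).differentiableAt (by simp)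

end PartialDeriv

theorem contDiffOn_det {E : Type*} [NormedAddCommGroup E] [NormedSpace ℝ E] {U : Set E} {n : ℕ}
    {G : E → Matrix (Fin n) (Fin n) ℝ} (h : ∀ i j, ContDiffOn ℝ ∞ (fun z => G z i j) U) :
    ContDiffOn ℝ ∞ (fun z => (G z).det) U := by
  simp only [Matrix.det_apply']
  exact ContDiffOn.sum fun σ _ => contDiffOn_const.mul (contDiffOn_prod fun i _ => h _ _)

theorem contDiffOn_matrix_inv {E : Type*} [NormedAddCommGroup E] [NormedSpace ℝ E] {U : Set E}
    {n : ℕ} {G : E → Matrix (Fin n) (Fin n) ℝ} (h : ∀ i j, ContDiffOn ℝ ∞ (fun z => G z i j) U)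
    (hdet : ∀ z ∈ U, (G z).det ≠ 0) (i j : Fin n) :
    ContDiffOn ℝ ∞ (fun z => (G z)⁻¹ i j) U := by
  simp only [Matrix.inv_def, Matrix.smul_apply, smul_eq_mul, Ring.inverse_eq_inv',
    Matrix.adjugate_apply]
  refine ((contDiffOn_det h).inv hdet).mul (contDiffOn_det fun a b => ?_)
  by_cases hj : a = j
  · subst hj; simp only [Matrix.updateRow_self]; exact contDiffOn_const
  · simp only [Matrix.updateRow_ne hj]; exact h a b

/-- `G` is a smooth pseudo-Riemannian metric on the open set `U`, in coordinates. -/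
structure IsMetricOn (G : EuclideanSpace ℝ (Fin m) → Matrix (Fin m) (Fin m) ℝ)
    (U : Set (EuclideanSpace ℝ (Fin m))) : Prop where
  isOpen : IsOpen U
  contDiffOn : ∀ i j, ContDiffOn ℝ ∞ (fun z => G z i j) U
  symm : ∀ z ∈ U, ∀ i j, G z i j = G z j i
  det_ne_zero : ∀ z ∈ U, (G z).det ≠ 0

/-- Christoffel symbols of the first kind. -/
def christoffelLow (G : EuclideanSpace ℝ (Fin m) → Matrix (Fin m) (Fin m) ℝ) (l i j : Fin m)
    (y : EuclideanSpace ℝ (Fin m)) : ℝ :=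
  (1 / 2) * (partialDeriv i (fun z => G z j l) y + partialDeriv j (fun z => G z i l) y
      - partialDeriv l (fun z => G z i j) y)

theorem christoffel_eq_sum (G : EuclideanSpace ℝ (Fin m) → Matrix (Fin m) (Fin m) ℝ)
    (k i j : Fin m) (y : EuclideanSpace ℝ (Fin m)) :
    christoffel G k i j y = ∑ l, (G y)⁻¹ k l * christoffelLow G l i j y := by
  simp only [christoffel, christoffelLow, Finset.mul_sum]
  exact Finset.sum_congr rfl fun l _ => by ring

namespace IsMetricOn

variable {G : EuclideanSpace ℝ (Fin m) → Matrix (Fin m) (Fin m) ℝ}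
  {U : Set (EuclideanSpace ℝ (Fin m))} {y : EuclideanSpace ℝ (Fin m)}

theorem sum_mul_inv (h : IsMetricOn G U) (hy : y ∈ U) (f : Fin m → ℝ) (i : Fin m) :
    ∑ a, G y i a * ∑ l, (G y)⁻¹ a l * f l = f i := by
  have h1 : G y * (G y)⁻¹ = 1 := Matrix.mul_nonsing_inv _ (h.det_ne_zero y hy).isUnit
  have : (G y).mulVec ((G y)⁻¹.mulVec f) = f := by
    rw [Matrix.mulVec_mulVec, h1, Matrix.one_mulVec]
  exact congrFun this i

theorem sum_inv_mul (h : IsMetricOn G U) (hy : y ∈ U) (f : Fin m → ℝ) (i : Fin m) :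
    ∑ a, (G y)⁻¹ i a * ∑ l, G y a l * f l = f i := by
  have h1 : (G y)⁻¹ * G y = 1 := Matrix.nonsing_inv_mul _ (h.det_ne_zero y hy).isUnit
  have : (G y)⁻¹.mulVec ((G y).mulVec f) = f := by
    rw [Matrix.mulVec_mulVec, h1, Matrix.one_mulVec]
  exact congrFun this i

/-- Nondegeneracy lets identities with an upper index be checked after lowering it, so that explicit
formulas for the inverse matrix are never needed. -/
theorem eq_of_sum_mul_eq (h : IsMetricOn G U) (hy : y ∈ U) {f f' : Fin m → ℝ}
    (hf : ∀ i, ∑ a, G y i a * f a = ∑ a, G y i a * f' a) : f = f' := by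
  ext i
  rw [← h.sum_inv_mul hy f i, ← h.sum_inv_mul hy f' i]
  simp only [hf]

theorem sum_mul_christoffel (h : IsMetricOn G U) (hy : y ∈ U) (i j k : Fin m) :
    ∑ a, G y i a * christoffel G a j k y = christoffelLow G i j k y := by
  simp only [christoffel_eq_sum]
  exact h.sum_mul_inv hy (fun l => christoffelLow G l j k y) i

theorem partialDeriv_symm (h : IsMetricOn G U) (hy : y ∈ U) (k i j : Fin m) :
    partialDeriv k (fun z => G z i j) y = partialDeriv k (fun z => G z j i) y :=
  partialDeriv_congr_of_isOpen h.isOpen (fun z hz => h.symm z hz i j) k hy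

theorem christoffelLow_symm (h : IsMetricOn G U) (hy : y ∈ U) (l i j : Fin m) :
    christoffelLow G l i j y = christoffelLow G l j i y := by
  rw [christoffelLow, christoffelLow, h.partialDeriv_symm hy l i j]; ring

theorem christoffel_symm (h : IsMetricOn G U) (hy : y ∈ U) (l i j : Fin m) :
    christoffel G l i j y = christoffel G l j i y := by
  simp only [christoffel_eq_sum, h.christoffelLow_symm hy _ i j]

theorem partialDeriv_eq (h : IsMetricOn G U) (hy : y ∈ U) (k i a : Fin m) :
    partialDeriv k (fun z => G z i a) y = christoffelLow G i k a y + christoffelLow G a k i y := by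
  rw [christoffelLow, christoffelLow, h.partialDeriv_symm hy k a i]; ring

theorem contDiffOn_christoffelLow (h : IsMetricOn G U) (l i j : Fin m) :
    ContDiffOn ℝ ∞ (christoffelLow G l i j) U :=
  contDiffOn_const.mul (((contDiffOn_partialDeriv h.isOpen (h.contDiffOn _ _) _).add
    (contDiffOn_partialDeriv h.isOpen (h.contDiffOn _ _) _)).sub
    (contDiffOn_partialDeriv h.isOpen (h.contDiffOn _ _) _))

theorem contDiffOn_christoffel (h : IsMetricOn G U) (k i j : Fin m) :
    ContDiffOn ℝ ∞ (christoffel G k i j) U :=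
  (ContDiffOn.sum fun l _ => (contDiffOn_matrix_inv h.contDiffOn h.det_ne_zero k l).mul
    (h.contDiffOn_christoffelLow l i j)).congr fun z _ => christoffel_eq_sum G k i j z

/-- Differentiate `G Γ = Γ_low` and express `∂G` through Christoffel symbols of the first kind. This
trades `∂Γ` in the curvature for derivatives of `Γ_low`, in which no inverse matrix occurs. -/
theorem sum_mul_partialDeriv_christoffel (h : IsMetricOn G U) (hy : y ∈ U) (i j k l : Fin m) :
    ∑ a, G y i a * partialDeriv l (christoffel G a j k) y =
      partialDeriv l (christoffelLow G i j k) y -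
        ∑ a, (christoffelLow G i l a y + christoffelLow G a l i y) * christoffel G a j k y := by
  have h1 : partialDeriv l (christoffelLow G i j k) y =
      partialDeriv l (fun z => ∑ a, G z i a * christoffel G a j k z) y :=
    partialDeriv_congr_of_isOpen h.isOpen (fun z hz => (h.sum_mul_christoffel hz i j k).symm) l hy
  have hd1 : ∀ a, DifferentiableAt ℝ (fun z => G z i a) y := fun a =>
    differentiableAt_of_contDiffOn h.isOpen (h.contDiffOn i a) hy
  have hd2 : ∀ a, DifferentiableAt ℝ (christoffel G a j k) y := fun a =>
    differentiableAt_of_contDiffOn h.isOpen (h.contDiffOn_christoffel a j k) hy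
  rw [h1, partialDeriv_sum (f := fun a z => G z i a * christoffel G a j k z) l
    fun a _ => (hd1 a).mul (hd2 a), eq_sub_iff_add_eq,
    ← Finset.sum_add_distrib]
  refine Finset.sum_congr rfl fun a _ => ?_
  rw [partialDeriv_mul l (hd1 a) (hd2 a), h.partialDeriv_eq hy]

/-- The covariant curvature in terms of Christoffel symbols of the first kind. -/
theorem curvature_eq (h : IsMetricOn G U) (hy : y ∈ U) (i j k l : Fin m) :
    curvature G i j k l y = partialDeriv k (christoffelLow G i l j) y
      - partialDeriv l (christoffelLow G i k j) y
      - ∑ a, christoffelLow G a k i y * christoffel G a l j y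
      + ∑ a, christoffelLow G a l i y * christoffel G a k j y := by
  have h1 : ∀ k l, ∑ a, G y i a * ∑ b, christoffel G a k b y * christoffel G b l j y =
      ∑ b, christoffelLow G i k b y * christoffel G b l j y := by
    intro k l
    simp only [Finset.mul_sum]
    rw [Finset.sum_comm]
    refine Finset.sum_congr rfl fun b _ => ?_
    rw [← h.sum_mul_christoffel hy, Finset.sum_mul]
    exact Finset.sum_congr rfl fun a _ => by ring
  simp only [curvature, riemannUp, mul_add, mul_sub, Finset.sum_add_distrib,
    Finset.sum_sub_distrib, h1, h.sum_mul_partialDeriv_christoffel hy, add_mul]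
  ring

end IsMetricOn

end Coord

end

/-! ### Conformal change of the curvature -/

noncomputable section

namespace Coord

open Filter Topology

variable {m : ℕ}

namespace IsMetricOn

variable {G : EuclideanSpace ℝ (Fin m) → Matrix (Fin m) (Fin m) ℝ}
  {U : Set (EuclideanSpace ℝ (Fin m))} {y : EuclideanSpace ℝ (Fin m)}
  {u : EuclideanSpace ℝ (Fin m) → ℝ}

theorem smul (h : IsMetricOn G U) (hu : ContDiffOn ℝ ∞ u U) (hu0 : ∀ z ∈ U, u z ≠ 0) :
    IsMetricOn (fun z => u z • G z) U where
  isOpen := h.isOpen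
  contDiffOn i j := hu.mul (h.contDiffOn i j)
  symm z hz i j := by simp [h.symm z hz i j]
  det_ne_zero z hz := by
    rw [Matrix.det_smul]
    exact mul_ne_zero (pow_ne_zero _ (hu0 z hz)) (h.det_ne_zero z hz)

theorem partialDeriv_smul (h : IsMetricOn G U) (hu : ContDiffOn ℝ ∞ u U) (hy : y ∈ U)
    (k i j : Fin m) :
    partialDeriv k (fun z => (u z • G z) i j) y =
      u y * partialDeriv k (fun z => G z i j) y + partialDeriv k u y * G y i j :=
  partialDeriv_mul k (differentiableAt_of_contDiffOn h.isOpen hu hy)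
    (differentiableAt_of_contDiffOn h.isOpen (h.contDiffOn i j) hy)

theorem christoffelLow_smul (h : IsMetricOn G U) (hu : ContDiffOn ℝ ∞ u U) (hy : y ∈ U)
    (a i j : Fin m) :
    christoffelLow (fun z => u z • G z) a i j y = u y * christoffelLow G a i j y +
      (1 / 2) * (partialDeriv i u y * G y j a + partialDeriv j u y * G y i a
        - partialDeriv a u y * G y i j) := by
  simp only [christoffelLow, h.partialDeriv_smul hu hy]
  ring

theorem partialDeriv_christoffelLow_smul (h : IsMetricOn G U) (hu : ContDiffOn ℝ ∞ u U)
    (hy : y ∈ U) (k a i j : Fin m) :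
    partialDeriv k (christoffelLow (fun z => u z • G z) a i j) y =
      u y * partialDeriv k (christoffelLow G a i j) y
        + partialDeriv k u y * christoffelLow G a i j y +
      (1 / 2) * (partialDeriv k (partialDeriv i u) y * G y j a
        + partialDeriv i u y * partialDeriv k (fun z => G z j a) y
        + partialDeriv k (partialDeriv j u) y * G y i a
        + partialDeriv j u y * partialDeriv k (fun z => G z i a) y
        - partialDeriv k (partialDeriv a u) y * G y i j
        - partialDeriv a u y * partialDeriv k (fun z => G z i j) y) := by
  rw [partialDeriv_congr_of_isOpen h.isOpen
    (fun z hz => h.christoffelLow_smul hu hz a i j) k hy]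
  have hud : DifferentiableAt ℝ u y := differentiableAt_of_contDiffOn h.isOpen hu hy
  have hpd : ∀ i, DifferentiableAt ℝ (partialDeriv i u) y := fun i =>
    differentiableAt_of_contDiffOn h.isOpen (contDiffOn_partialDeriv h.isOpen hu i) hy
  have hGd : ∀ i j, DifferentiableAt ℝ (fun z => G z i j) y := fun i j =>
    differentiableAt_of_contDiffOn h.isOpen (h.contDiffOn i j) hy
  have hLd : DifferentiableAt ℝ (christoffelLow G a i j) y :=
    differentiableAt_of_contDiffOn h.isOpen (h.contDiffOn_christoffelLow a i j) hy
  have hpG : ∀ i j l, DifferentiableAt ℝ (fun z => partialDeriv i u z * G z j l) y :=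
    fun i j l => (hpd i).mul (hGd j l)
  have h1 : DifferentiableAt ℝ (fun z => u z * christoffelLow G a i j z) y := hud.mul hLd
  have h2 : DifferentiableAt ℝ
      (fun z => partialDeriv i u z * G z j a + partialDeriv j u z * G z i a) y :=
    (hpG i j a).add (hpG j i a)
  have h3 : DifferentiableAt ℝ (fun z => partialDeriv i u z * G z j a
      + partialDeriv j u z * G z i a - partialDeriv a u z * G z i j) y := h2.sub (hpG a i j)
  rw [partialDeriv_add k h1 (h3.const_mul _), partialDeriv_mul k hud hLd,
    partialDeriv_const_mul k _ h3, partialDeriv_sub k h2 (hpG a i j),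
    partialDeriv_add k (hpG i j a) (hpG j i a), partialDeriv_mul k (hpd i) (hGd j a),
    partialDeriv_mul k (hpd j) (hGd i a), partialDeriv_mul k (hpd a) (hGd i j)]
  ring

/-- The gradient of a function. -/
def _root_.Coord.grad (G : EuclideanSpace ℝ (Fin m) → Matrix (Fin m) (Fin m) ℝ)
    (u : EuclideanSpace ℝ (Fin m) → ℝ) (a : Fin m) (y : EuclideanSpace ℝ (Fin m)) : ℝ :=
  ∑ l, (G y)⁻¹ a l * partialDeriv l u y

theorem sum_mul_grad (h : IsMetricOn G U) (hy : y ∈ U) (i : Fin m) :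
    ∑ a, G y i a * grad G u a y = partialDeriv i u y :=
  h.sum_mul_inv hy (fun l => partialDeriv l u y) i

theorem christoffel_smul (h : IsMetricOn G U) (hu : ContDiffOn ℝ ∞ u U)
    (hu0 : ∀ z ∈ U, u z ≠ 0) (hy : y ∈ U) (a i j : Fin m) :
    christoffel (fun z => u z • G z) a i j y = christoffel G a i j y +
      (1 / (2 * u y)) * ((if a = j then partialDeriv i u y else 0)
        + (if a = i then partialDeriv j u y else 0) - grad G u a y * G y i j) := by
  have huy := hu0 y hy
  refine congrFun (h.eq_of_sum_mul_eq hy (f := fun a => christoffel (fun z => u z • G z) a i j y)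
    (f' := fun a => christoffel G a i j y +
      (1 / (2 * u y)) * ((if a = j then partialDeriv i u y else 0)
        + (if a = i then partialDeriv j u y else 0) - grad G u a y * G y i j)) fun l => ?_) a
  have h1 := (h.smul hu hu0).sum_mul_christoffel hy l i j
  simp only [Matrix.smul_apply, smul_eq_mul, mul_assoc] at h1
  rw [← Finset.mul_sum, h.christoffelLow_smul hu hy] at h1
  have h2 : ∑ a, G y l a * (christoffel G a i j y +
      (1 / (2 * u y)) * ((if a = j then partialDeriv i u y else 0)
        + (if a = i then partialDeriv j u y else 0) - grad G u a y * G y i j)) =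
      christoffelLow G l i j y + (1 / (2 * u y)) * (G y l j * partialDeriv i u y
        + G y l i * partialDeriv j u y - partialDeriv l u y * G y i j) := by
    rw [← h.sum_mul_grad hy l, ← h.sum_mul_christoffel hy, Finset.sum_mul]
    simp only [mul_add, mul_sub, Finset.sum_add_distrib, Finset.sum_sub_distrib, mul_ite, mul_zero,
      Finset.sum_ite_eq', Finset.mem_univ, if_true, Finset.mul_sum]
    congr 1
    congr 1
    · ring
    · exact Finset.sum_congr rfl fun a _ => by ring
  rw [h2]
  apply mul_left_cancel₀ huy
  rw [h1, h.symm y hy l j, h.symm y hy l i]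
  field_simp

/-- The part of the curvature quadratic in the Christoffel symbols. On the right, terms are grouped
by their degree `0`, `1` or `2` in `du`; the two linear groups come from the two factors. -/
theorem sum_christoffelLow_mul_christoffel_smul (h : IsMetricOn G U) (hu : ContDiffOn ℝ ∞ u U)
    (hu0 : ∀ z ∈ U, u z ≠ 0) (hy : y ∈ U) (k i l j : Fin m) :
    ∑ a, christoffelLow (fun z => u z • G z) a k i y * christoffel (fun z => u z • G z) a l j y =
      u y * ∑ a, christoffelLow G a k i y * christoffel G a l j y
      + (1 / 2) * (partialDeriv k u y * christoffelLow G i l j y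
        + partialDeriv i u y * christoffelLow G k l j y
        - G y k i * ∑ a, partialDeriv a u y * christoffel G a l j y)
      + (1 / 2) * (partialDeriv l u y * christoffelLow G j k i y
        + partialDeriv j u y * christoffelLow G l k i y
        - G y l j * ∑ a, partialDeriv a u y * christoffel G a k i y)
      + (1 / (4 * u y)) * (partialDeriv k u y * partialDeriv l u y * G y i j
        + partialDeriv k u y * partialDeriv j u y * G y i l
        - partialDeriv k u y * partialDeriv i u y * G y l j
        + partialDeriv i u y * partialDeriv l u y * G y k j
        + partialDeriv i u y * partialDeriv j u y * G y k l
        - partialDeriv i u y * partialDeriv k u y * G y l j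
        - 2 * partialDeriv l u y * partialDeriv j u y * G y k i
        + (∑ a, partialDeriv a u y * grad G u a y) * G y k i * G y l j) := by
  have huy := hu0 y hy
  have e1 : ∀ k l j, ∑ a, G y k a * christoffel G a l j y = christoffelLow G k l j y :=
    fun k l j => h.sum_mul_christoffel hy k l j
  have e2 : ∀ k, ∑ a, G y k a * grad G u a y = partialDeriv k u y := fun k => h.sum_mul_grad hy k
  have e3 : ∑ a, christoffelLow G a k i y * grad G u a y =
      ∑ a, partialDeriv a u y * christoffel G a k i y := by
    simp only [← e2, ← e1, Finset.sum_mul]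
    rw [Finset.sum_comm]
    exact Finset.sum_congr rfl fun a _ => Finset.sum_congr rfl fun b _ => by
      rw [h.symm y hy]; ring
  have e4 : ∀ a, christoffelLow (fun z => u z • G z) a k i y *
      christoffel (fun z => u z • G z) a l j y =
      u y * (christoffelLow G a k i y * christoffel G a l j y)
      + (1 / 2) * (partialDeriv k u y * (G y i a * christoffel G a l j y)
        + partialDeriv i u y * (G y k a * christoffel G a l j y)
        - G y k i * (partialDeriv a u y * christoffel G a l j y))
      + (1 / 2) * ((if a = j then partialDeriv l u y * christoffelLow G a k i y else 0)
        + (if a = l then partialDeriv j u y * christoffelLow G a k i y else 0)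
        - G y l j * (christoffelLow G a k i y * grad G u a y))
      + (1 / (4 * u y)) * ((if a = j then partialDeriv l u y * (partialDeriv k u y * G y i a
          + partialDeriv i u y * G y k a - partialDeriv a u y * G y k i) else 0)
        + (if a = l then partialDeriv j u y * (partialDeriv k u y * G y i a
          + partialDeriv i u y * G y k a - partialDeriv a u y * G y k i) else 0)
        - G y l j * (partialDeriv k u y * (G y i a * grad G u a y))
        - G y l j * (partialDeriv i u y * (G y k a * grad G u a y))
        + G y l j * (G y k i * (partialDeriv a u y * grad G u a y))) := by
    intro a
    rw [h.christoffelLow_smul hu hy, h.christoffel_smul hu hu0 hy]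
    split_ifs <;> field_simp <;> ring
  rw [Finset.sum_congr rfl fun a _ => e4 a]
  simp only [Finset.sum_add_distrib, Finset.sum_sub_distrib, ← Finset.mul_sum, e1, e2, e3,
    Finset.sum_ite_eq', Finset.mem_univ, if_true]
  ring

/-- Conformal change of the covariant curvature. -/
theorem curvature_smul (h : IsMetricOn G U) (hu : ContDiffOn ℝ ∞ u U)
    (hu0 : ∀ z ∈ U, u z ≠ 0) (hy : y ∈ U) :
    ∃ c : Fin m → Fin m → ℝ, ∀ i j k l, curvature (fun z => u z • G z) i j k l y =
      u y * curvature G i j k l y + kulkarniNomizu c (fun a b => G y a b) i j k l := by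
  -- For `u = e^{2φ}` this is the classical tensor `-e^{2φ} (∇dφ - dφ ⊗ dφ + ½ |dφ|² g)`. Written in
  -- `u` it needs no logarithm, and the sign of `u` does not matter.
  refine ⟨fun i j => -(1 / 2) * (partialDeriv i (partialDeriv j u) y
      - ∑ a, partialDeriv a u y * christoffel G a i j y)
    + 3 / (4 * u y) * partialDeriv i u y * partialDeriv j u y
    - (∑ a, partialDeriv a u y * grad G u a y) / (8 * u y) * G y i j, fun i j k l => ?_⟩
  have huy := hu0 y hy
  rw [(h.smul hu hu0).curvature_eq hy, h.curvature_eq hy,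
    h.partialDeriv_christoffelLow_smul hu hy, h.partialDeriv_christoffelLow_smul hu hy,
    h.sum_christoffelLow_mul_christoffel_smul hu hu0 hy,
    h.sum_christoffelLow_mul_christoffel_smul hu hu0 hy]
  simp only [kulkarniNomizu, h.partialDeriv_eq hy]
  rw [partialDeriv_comm h.isOpen hu l k hy, partialDeriv_comm h.isOpen hu k i hy,
    partialDeriv_comm h.isOpen hu l i hy, partialDeriv_comm h.isOpen hu k j hy,
    partialDeriv_comm h.isOpen hu l j hy,
    h.symm y hy l j, h.symm y hy k j, h.symm y hy j i, h.symm y hy l i, h.symm y hy k i,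
    h.symm y hy l k]
  simp only [h.christoffelLow_symm hy _ l k, h.christoffelLow_symm hy _ l j,
    h.christoffelLow_symm hy _ l i, h.christoffelLow_symm hy _ k j, h.christoffelLow_symm hy _ k i,
    h.christoffel_symm hy _ l j, h.christoffel_symm hy _ k j,
    h.christoffel_symm hy _ l i, h.christoffel_symm hy _ k i]
  field_simp
  ring

/-- From `u K + c • G = θ • (u G)` follows `K = (θ - c / u) • G`. It is irrelevant which form `θ`
is, so the transformation law of the Schouten tensor is not required. -/
theorem curvature_eq_kulkarniNomizu_of_smul (h : IsMetricOn G U) (hu : ContDiffOn ℝ ∞ u U)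
    (hu0 : ∀ z ∈ U, u z ≠ 0) (hy : y ∈ U) {θ : Fin m → Fin m → ℝ}
    (hθ : ∀ i j k l, curvature (fun z => u z • G z) i j k l y =
      kulkarniNomizu θ (fun a b => (u y • G y) a b) i j k l) :
    ∃ θ' : Fin m → Fin m → ℝ, ∀ i j k l, curvature G i j k l y =
      kulkarniNomizu θ' (fun a b => G y a b) i j k l := by
  obtain ⟨c, hc⟩ := h.curvature_smul hu hu0 hy
  refine ⟨fun i j => θ i j - c i j / u y, fun i j k l => ?_⟩
  have huy := hu0 y hy
  have := (hc i j k l).symm.trans (hθ i j k l)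
  simp only [kulkarniNomizu, Matrix.smul_apply, smul_eq_mul] at this ⊢
  apply mul_left_cancel₀ huy
  field_simp
  linear_combination this

end IsMetricOn

end Coord

end

/-! ### Product metrics with a one-dimensional factor -/

noncomputable section

namespace Coord

open Filter Topology

variable {n : ℕ}

/-- The projection of `ℝ^(n+1)` to its first `n` coordinates. -/
def head : EuclideanSpace ℝ (Fin (n + 1)) →L[ℝ] EuclideanSpace ℝ (Fin n) :=
  LinearMap.toContinuousLinearMap
    { toFun := fun z => WithLp.toLp 2 fun i => z i.castSucc
      map_add' := fun _ _ => rfl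
      map_smul' := fun _ _ => rfl }

@[simp] theorem head_apply (z : EuclideanSpace ℝ (Fin (n + 1))) (i : Fin n) :
    head z i = z i.castSucc := rfl

theorem head_single_castSucc (i : Fin n) (c : ℝ) :
    head (EuclideanSpace.single i.castSucc c) = EuclideanSpace.single i c := by
  ext j; simp

theorem head_single_last (c : ℝ) :
    head (n := n) (EuclideanSpace.single (Fin.last n) c) = 0 := by
  ext j; simp

theorem partialDeriv_comp_head_castSucc {F : EuclideanSpace ℝ (Fin n) → ℝ}
    {z : EuclideanSpace ℝ (Fin (n + 1))} (hF : DifferentiableAt ℝ F (head z)) (i : Fin n) :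
    partialDeriv i.castSucc (fun z => F (head z)) z = partialDeriv i F (head z) := by
  have : HasFDerivAt (fun z => F (head z)) (fderiv ℝ F (head z) ∘SL head) z :=
    hF.hasFDerivAt.comp z head.hasFDerivAt
  rw [partialDeriv, this.fderiv, ContinuousLinearMap.comp_apply, head_single_castSucc]
  rfl

theorem partialDeriv_comp_head_last {F : EuclideanSpace ℝ (Fin n) → ℝ}
    {z : EuclideanSpace ℝ (Fin (n + 1))} (hF : DifferentiableAt ℝ F (head z)) :
    partialDeriv (Fin.last n) (fun z => F (head z)) z = 0 := by
  have : HasFDerivAt (fun z => F (head z)) (fderiv ℝ F (head z) ∘SL head) z :=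
    hF.hasFDerivAt.comp z head.hasFDerivAt
  rw [partialDeriv, this.fderiv, ContinuousLinearMap.comp_apply, head_single_last, map_zero]

theorem partialDeriv_comp_last {α : ℝ → ℝ} {z : EuclideanSpace ℝ (Fin (n + 1))}
    (hα : DifferentiableAt ℝ α (z (Fin.last n))) (i : Fin n) :
    partialDeriv i.castSucc (fun z => α (z (Fin.last n))) z = 0 := by
  have h1 : HasFDerivAt (fun z : EuclideanSpace ℝ (Fin (n + 1)) => z (Fin.last n))
    (EuclideanSpace.proj (Fin.last n) : EuclideanSpace ℝ (Fin (n + 1)) →L[ℝ] ℝ) z :=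
    (EuclideanSpace.proj (Fin.last n) : EuclideanSpace ℝ (Fin (n + 1)) →L[ℝ] ℝ).hasFDerivAt
  have : HasFDerivAt (fun z : EuclideanSpace ℝ (Fin (n + 1)) => α (z (Fin.last n))) _ z :=
    hα.hasFDerivAt.comp z h1
  rw [partialDeriv, this.fderiv, ContinuousLinearMap.comp_apply]
  have h2 : (EuclideanSpace.proj (Fin.last n) : EuclideanSpace ℝ (Fin (n + 1)) →L[ℝ] ℝ)
      (EuclideanSpace.single i.castSucc 1) = 0 := by
    simp [Fin.ext_iff, i.2.ne']
  rw [h2, map_zero]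

/-- The product metric `H + α dt²`. -/
def productMetric (H : EuclideanSpace ℝ (Fin n) → Matrix (Fin n) (Fin n) ℝ) (α : ℝ → ℝ)
    (z : EuclideanSpace ℝ (Fin (n + 1))) : Matrix (Fin (n + 1)) (Fin (n + 1)) ℝ :=
  Matrix.of fun i j =>
    Fin.lastCases (motive := fun _ => ℝ)
      (Fin.lastCases (motive := fun _ => ℝ) (α (z (Fin.last n))) (fun _ => 0) j)
      (fun i' => Fin.lastCases (motive := fun _ => ℝ) 0 (fun j' => H (head z) i' j') j) i

section

variable (H : EuclideanSpace ℝ (Fin n) → Matrix (Fin n) (Fin n) ℝ) (α : ℝ → ℝ)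
  (z : EuclideanSpace ℝ (Fin (n + 1)))

@[simp] theorem productMetric_castSucc_castSucc (i j : Fin n) :
    productMetric H α z i.castSucc j.castSucc = H (head z) i j := by simp [productMetric]

@[simp] theorem productMetric_castSucc_last (i : Fin n) :
    productMetric H α z i.castSucc (Fin.last n) = 0 := by simp [productMetric]

@[simp] theorem productMetric_last_castSucc (i : Fin n) :
    productMetric H α z (Fin.last n) i.castSucc = 0 := by simp [productMetric]

@[simp] theorem productMetric_last_last :
    productMetric H α z (Fin.last n) (Fin.last n) = α (z (Fin.last n)) := by simp [productMetric]

end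

variable {H : EuclideanSpace ℝ (Fin n) → Matrix (Fin n) (Fin n) ℝ} {α : ℝ → ℝ}
  {V : Set (EuclideanSpace ℝ (Fin n))} {T : Set ℝ}

theorem contDiff_last : ContDiff ℝ ∞ (fun z : EuclideanSpace ℝ (Fin (n + 1)) => z (Fin.last n)) :=
  (EuclideanSpace.proj (Fin.last n) : EuclideanSpace ℝ (Fin (n + 1)) →L[ℝ] ℝ).contDiff

theorem IsMetricOn.product (h : IsMetricOn H V) (hT : IsOpen T) (hα : ContDiffOn ℝ ∞ α T)
    (hα0 : ∀ t ∈ T, α t ≠ 0) :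
    IsMetricOn (productMetric H α) {z | head z ∈ V ∧ z (Fin.last n) ∈ T} where
  isOpen := (h.isOpen.preimage head.continuous).inter (hT.preimage contDiff_last.continuous)
  contDiffOn i j := by
    refine Fin.lastCases ?_ (fun i => ?_) i <;> refine Fin.lastCases ?_ (fun j => ?_) j
    · simp only [productMetric_last_last]
      exact hα.comp contDiff_last.contDiffOn fun z hz => hz.2
    · simp only [productMetric_last_castSucc]; exact contDiffOn_const
    · simp only [productMetric_castSucc_last]; exact contDiffOn_const
    · simp only [productMetric_castSucc_castSucc]
      exact (h.contDiffOn i j).comp head.contDiff.contDiffOn fun z hz => hz.1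
  symm z hz i j := by
    refine Fin.lastCases ?_ (fun i => ?_) i <;> refine Fin.lastCases ?_ (fun j => ?_) j <;> simp
    exact h.symm _ hz.1 i j
  det_ne_zero z hz hdet := by
    obtain ⟨v, hv0, hv⟩ := Matrix.exists_mulVec_eq_zero_iff.2 hdet
    have h1 : ∀ i, ∑ j, productMetric H α z i j * v j = 0 := fun i => congrFun hv i
    have hl : v (Fin.last n) = 0 := by
      have := h1 (Fin.last n)
      rw [Fin.sum_univ_castSucc] at this
      simpa [hα0 _ hz.2] using this
    have hc : (fun i : Fin n => v i.castSucc) = 0 := by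
      by_contra hne
      refine h.det_ne_zero _ hz.1 (Matrix.exists_mulVec_eq_zero_iff.1 ⟨_, hne, ?_⟩)
      ext i
      have := h1 i.castSucc
      rw [Fin.sum_univ_castSucc] at this
      simp only [productMetric_castSucc_castSucc, productMetric_castSucc_last, zero_mul,
        add_zero] at this
      exact this
    refine hv0 (funext fun i => ?_)
    refine Fin.lastCases hl (fun i => ?_) i
    exact congrFun hc i

section

variable {z : EuclideanSpace ℝ (Fin (n + 1))} (h : IsMetricOn H V) (hT : IsOpen T)
  (hα : ContDiffOn ℝ ∞ α T) (hα0 : ∀ t ∈ T, α t ≠ 0) (hz : head z ∈ V) (hzT : z (Fin.last n) ∈ T)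

include h hz in
theorem christoffelLow_productMetric_castSucc (l i j : Fin n) :
    christoffelLow (productMetric H α) l.castSucc i.castSucc j.castSucc z =
      christoffelLow H l i j (head z) := by
  have hd : ∀ i j, DifferentiableAt ℝ (fun y => H y i j) (head z) := fun i j =>
    differentiableAt_of_contDiffOn h.isOpen (h.contDiffOn i j) hz
  simp only [christoffelLow, productMetric_castSucc_castSucc,
    partialDeriv_comp_head_castSucc (hd _ _)]

include h hz in
theorem christoffelLow_productMetric_last_castSucc (i j : Fin n) :
    christoffelLow (productMetric H α) (Fin.last n) i.castSucc j.castSucc z = 0 := by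
  have hd : ∀ i j, DifferentiableAt ℝ (fun y => H y i j) (head z) := fun i j =>
    differentiableAt_of_contDiffOn h.isOpen (h.contDiffOn i j) hz
  simp [christoffelLow, partialDeriv_comp_head_last (hd _ _)]

include h hz in
theorem christoffelLow_productMetric_castSucc_last (i j : Fin n) :
    christoffelLow (productMetric H α) i.castSucc j.castSucc (Fin.last n) z = 0 := by
  have hd : ∀ i j, DifferentiableAt ℝ (fun y => H y i j) (head z) := fun i j =>
    differentiableAt_of_contDiffOn h.isOpen (h.contDiffOn i j) hz
  simp [christoffelLow, partialDeriv_comp_head_last (hd _ _)]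

include hT hα hzT in
theorem christoffelLow_productMetric_castSucc_last_last (i : Fin n) :
    christoffelLow (productMetric H α) i.castSucc (Fin.last n) (Fin.last n) z = 0 := by
  have hd : DifferentiableAt ℝ α (z (Fin.last n)) :=
    (hα.contDiffAt (hT.mem_nhds hzT)).differentiableAt (by simp)
  simp [christoffelLow, partialDeriv_comp_last hd]

include hT hα hzT in
theorem christoffelLow_productMetric_last_last_castSucc (i : Fin n) :
    christoffelLow (productMetric H α) (Fin.last n) (Fin.last n) i.castSucc z = 0 := by
  have hd : DifferentiableAt ℝ α (z (Fin.last n)) :=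
    (hα.contDiffAt (hT.mem_nhds hzT)).differentiableAt (by simp)
  simp [christoffelLow, partialDeriv_comp_last hd]

include h hT hα hα0 hz hzT

theorem christoffel_productMetric_castSucc (l i j : Fin n) :
    christoffel (productMetric H α) l.castSucc i.castSucc j.castSucc z =
      christoffel H l i j (head z) := by
  have hG := h.product hT hα hα0
  refine congrFun (h.eq_of_sum_mul_eq hz (f := fun l =>
    christoffel (productMetric H α) l.castSucc i.castSucc j.castSucc z)
    (f' := fun l => christoffel H l i j (head z)) fun k => ?_) l
  have h1 := hG.sum_mul_christoffel ⟨hz, hzT⟩ k.castSucc i.castSucc j.castSucc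
  rw [Fin.sum_univ_castSucc, christoffelLow_productMetric_castSucc h hz] at h1
  simp only [productMetric_castSucc_castSucc, productMetric_castSucc_last, zero_mul, add_zero] at h1
  rw [h1, h.sum_mul_christoffel hz]

theorem christoffel_productMetric_castSucc_last_last (l : Fin n) :
    christoffel (productMetric H α) l.castSucc (Fin.last n) (Fin.last n) z = 0 := by
  have hG := h.product hT hα hα0
  refine congrFun (h.eq_of_sum_mul_eq hz (f := fun l =>
    christoffel (productMetric H α) l.castSucc (Fin.last n) (Fin.last n) z)
    (f' := fun l => 0) fun k => ?_) l
  have h1 := hG.sum_mul_christoffel ⟨hz, hzT⟩ k.castSucc (Fin.last n) (Fin.last n)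
  rw [Fin.sum_univ_castSucc, christoffelLow_productMetric_castSucc_last_last hT hα hzT] at h1
  simpa using h1

theorem curvature_productMetric_castSucc (i j k l : Fin n) :
    curvature (productMetric H α) i.castSucc j.castSucc k.castSucc l.castSucc z =
      curvature H i j k l (head z) := by
  have hG := h.product hT hα hα0
  have hd : ∀ i k l j, partialDeriv k.castSucc
      (christoffelLow (productMetric H α) i.castSucc l.castSucc j.castSucc) z =
      partialDeriv k (christoffelLow H i l j) (head z) := by
    intro i k l j
    rw [← partialDeriv_comp_head_castSucc
      (differentiableAt_of_contDiffOn h.isOpen (h.contDiffOn_christoffelLow i l j) hz)]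
    exact partialDeriv_congr_of_isOpen (h.isOpen.preimage head.continuous)
      (fun z' hz' => christoffelLow_productMetric_castSucc h hz' i l j) _ hz
  rw [hG.curvature_eq ⟨hz, hzT⟩, h.curvature_eq hz, hd, hd, Fin.sum_univ_castSucc,
    Fin.sum_univ_castSucc]
  simp only [christoffelLow_productMetric_castSucc h hz,
    christoffelLow_productMetric_last_castSucc h hz,
    christoffel_productMetric_castSucc h hT hα hα0 hz hzT, zero_mul, add_zero]

/-- Neither block of the metric depends on the variables of the other, so every Christoffel symbol
with indices from both factors vanishes. This component is the one that determines the trace form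
along the fibre. -/
theorem curvature_productMetric_mixed (i k : Fin n) :
    curvature (productMetric H α) i.castSucc (Fin.last n) k.castSucc (Fin.last n) z = 0 := by
  have hG := h.product hT hα hα0
  have hd1 : partialDeriv k.castSucc
      (christoffelLow (productMetric H α) i.castSucc (Fin.last n) (Fin.last n)) z = 0 := by
    rw [partialDeriv_congr_of_isOpen hG.isOpen (fun z' hz' =>
      christoffelLow_productMetric_castSucc_last_last hT hα hz'.2 i) _ ⟨hz, hzT⟩, partialDeriv_const]
  have hd2 : partialDeriv (Fin.last n)
      (christoffelLow (productMetric H α) i.castSucc k.castSucc (Fin.last n)) z = 0 := by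
    rw [partialDeriv_congr_of_isOpen hG.isOpen (fun z' hz' =>
      christoffelLow_productMetric_castSucc_last h hz'.1 i k) _ ⟨hz, hzT⟩, partialDeriv_const]
  rw [hG.curvature_eq ⟨hz, hzT⟩, hd1, hd2, Fin.sum_univ_castSucc, Fin.sum_univ_castSucc]
  simp only [christoffelLow_productMetric_last_castSucc h hz,
    christoffel_productMetric_castSucc_last_last h hT hα hα0 hz hzT,
    christoffelLow_productMetric_last_last_castSucc hT hα hzT,
    hG.christoffelLow_symm ⟨hz, hzT⟩ _ (Fin.last n) (Fin.castSucc _),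
    christoffelLow_productMetric_castSucc_last h hz]
  simp

/-- If the curvature of a product `H + α dt²` is pure trace, then the sectional curvature of `H` is
constant at each point. -/
theorem exists_curvature_eq_of_productMetric {θ : Fin (n + 1) → Fin (n + 1) → ℝ}
    (hθ : ∀ i j k l, curvature (productMetric H α) i j k l z =
      kulkarniNomizu θ (fun a b => productMetric H α z a b) i j k l) :
    ∃ κ : ℝ, ∀ i j k l, curvature H i j k l (head z) =
      κ * (H (head z) i k * H (head z) j l - H (head z) i l * H (head z) j k) := by
  have hα' := hα0 _ hzT
  have h1 : ∀ i k : Fin n, θ i.castSucc k.castSucc =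
      -(θ (Fin.last n) (Fin.last n) / α (z (Fin.last n))) * H (head z) i k := by
    intro i k
    have := hθ i.castSucc (Fin.last n) k.castSucc (Fin.last n)
    rw [curvature_productMetric_mixed h hT hα hα0 hz hzT] at this
    simp only [kulkarniNomizu, productMetric_last_last, productMetric_castSucc_castSucc,
      productMetric_castSucc_last, productMetric_last_castSucc] at this
    field_simp
    linear_combination -this
  refine ⟨-2 * (θ (Fin.last n) (Fin.last n) / α (z (Fin.last n))), fun i j k l => ?_⟩
  rw [← curvature_productMetric_castSucc h hT hα hα0 hz hzT, hθ]
  simp only [kulkarniNomizu, productMetric_castSucc_castSucc, h1]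
  ring

end

end Coord

end

/-! ### The second Bianchi identity and Schur's lemma -/

noncomputable section

namespace Coord

open Filter Topology

variable {n : ℕ}

namespace IsMetricOn

variable {G : EuclideanSpace ℝ (Fin n) → Matrix (Fin n) (Fin n) ℝ}
  {U : Set (EuclideanSpace ℝ (Fin n))} {y : EuclideanSpace ℝ (Fin n)}

theorem contDiffOn_riemannUp (h : IsMetricOn G U) (i j k l : Fin n) :
    ContDiffOn ℝ ∞ (riemannUp G i j k l) U :=
  ((contDiffOn_partialDeriv h.isOpen (h.contDiffOn_christoffel i l j) k).sub
    (contDiffOn_partialDeriv h.isOpen (h.contDiffOn_christoffel i k j) l)).add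
    (ContDiffOn.sum fun a _ =>
      ((h.contDiffOn_christoffel i k a).mul (h.contDiffOn_christoffel a l j)).sub
        ((h.contDiffOn_christoffel i l a).mul (h.contDiffOn_christoffel a k j)))

theorem partialDeriv_riemannUp (h : IsMetricOn G U) (hy : y ∈ U) (i j k l p : Fin n) :
    partialDeriv p (riemannUp G i j k l) y =
      partialDeriv p (partialDeriv k (christoffel G i l j)) y
      - partialDeriv p (partialDeriv l (christoffel G i k j)) y
      + (∑ a, christoffel G i k a y * partialDeriv p (christoffel G a l j) y
      + ∑ a, partialDeriv p (christoffel G i k a) y * christoffel G a l j y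
      - ∑ a, christoffel G i l a y * partialDeriv p (christoffel G a k j) y
      - ∑ a, partialDeriv p (christoffel G i l a) y * christoffel G a k j y) := by
  have hc : ∀ i j k, DifferentiableAt ℝ (christoffel G i j k) y := fun i j k =>
    differentiableAt_of_contDiffOn h.isOpen (h.contDiffOn_christoffel i j k) hy
  have hp : ∀ l i j k, DifferentiableAt ℝ (partialDeriv l (christoffel G i j k)) y :=
    fun l i j k => differentiableAt_of_contDiffOn h.isOpen
      (contDiffOn_partialDeriv h.isOpen (h.contDiffOn_christoffel i j k) l) hy
  have hm : ∀ i j k i' j' k', DifferentiableAt ℝ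
      (fun z => christoffel G i j k z * christoffel G i' j' k' z) y := fun i j k i' j' k' =>
    (hc i j k).mul (hc i' j' k')
  have hs : ∀ a, DifferentiableAt ℝ (fun z => christoffel G i k a z * christoffel G a l j z
      - christoffel G i l a z * christoffel G a k j z) y := fun a => (hm _ _ _ _ _ _).sub (hm _ _ _ _ _ _)
  have h1 : partialDeriv p (riemannUp G i j k l) y = partialDeriv p (fun z =>
      (partialDeriv k (christoffel G i l j) z - partialDeriv l (christoffel G i k j) z)
        + ∑ a, (christoffel G i k a z * christoffel G a l j z
          - christoffel G i l a z * christoffel G a k j z)) y := rfl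
  have hd : DifferentiableAt ℝ (fun z =>
      partialDeriv k (christoffel G i l j) z - partialDeriv l (christoffel G i k j) z) y :=
    (hp _ _ _ _).sub (hp _ _ _ _)
  rw [h1, partialDeriv_add p hd (DifferentiableAt.fun_sum fun a _ => hs a),
    partialDeriv_sub p (hp _ _ _ _) (hp _ _ _ _), partialDeriv_sum p fun a _ => hs a]
  simp only [fun a => partialDeriv_sub p (hm i k a a l j) (hm i l a a k j),
    fun i j k i' j' k' => partialDeriv_mul p (hc i j k) (hc i' j' k'),
    Finset.sum_add_distrib, Finset.sum_sub_distrib]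
  ring

/-- The second Bianchi identity. -/
theorem bianchi (h : IsMetricOn G U) (hy : y ∈ U) (i j k l p : Fin n) :
    (partialDeriv p (riemannUp G i j k l) y
      + (∑ a, christoffel G i p a y * riemannUp G a j k l y
        - ∑ a, riemannUp G i a k l y * christoffel G a p j y))
    + (partialDeriv k (riemannUp G i j l p) y
      + (∑ a, christoffel G i k a y * riemannUp G a j l p y
        - ∑ a, riemannUp G i a l p y * christoffel G a k j y))
    + (partialDeriv l (riemannUp G i j p k) y
      + (∑ a, christoffel G i l a y * riemannUp G a j p k y
        - ∑ a, riemannUp G i a p k y * christoffel G a l j y)) = 0 := by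
  -- With the connection matrices `A_k = (Γ^i_{kj})`, the curvature is `R_kl = ∂_k A_l - ∂_l A_k +
  -- [A_k, A_l]`, and the claim is that the cyclic sum of `∂_p R_kl + [A_p, R_kl]` vanishes. The
  -- form indices `k`, `l` need no correction terms.
  let A : Fin n → Matrix (Fin n) (Fin n) ℝ := fun k => Matrix.of fun i j => christoffel G i k j y
  let D : Fin n → Fin n → Matrix (Fin n) (Fin n) ℝ := fun p k =>
    Matrix.of fun i j => partialDeriv p (christoffel G i k j) y
  let D2 : Fin n → Fin n → Fin n → Matrix (Fin n) (Fin n) ℝ := fun p k l =>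
    Matrix.of fun i j => partialDeriv p (partialDeriv k (christoffel G i l j)) y
  let R : Fin n → Fin n → Matrix (Fin n) (Fin n) ℝ := fun k l =>
    Matrix.of fun i j => riemannUp G i j k l y
  let R' : Fin n → Fin n → Fin n → Matrix (Fin n) (Fin n) ℝ := fun p k l =>
    Matrix.of fun i j => partialDeriv p (riemannUp G i j k l) y
  have hR : ∀ k l, R k l = D k l - D l k + (A k * A l - A l * A k) := by
    intro k l
    ext i j
    simp only [R, D, A, Matrix.of_apply, Matrix.add_apply, Matrix.sub_apply, Matrix.mul_apply,
      riemannUp, Finset.sum_sub_distrib]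
  have hR' : ∀ p k l, R' p k l = D2 p k l - D2 p l k +
      (A k * D p l + D p k * A l - A l * D p k - D p l * A k) := by
    intro p k l
    ext i j
    simp only [R', D, D2, A, Matrix.of_apply, Matrix.add_apply, Matrix.sub_apply, Matrix.mul_apply,
      h.partialDeriv_riemannUp hy]
  have hD2 : ∀ p k l, D2 p k l = D2 k p l := by
    intro p k l
    ext i j
    exact partialDeriv_comm h.isOpen (h.contDiffOn_christoffel i l j) p k hy
  have key : (R' p k l + (A p * R k l - R k l * A p)) + (R' k l p + (A k * R l p - R l p * A k))
      + (R' l p k + (A l * R p k - R p k * A l)) = 0 := by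
    -- After equality of mixed second derivatives, everything left cancels in the algebra of
    -- matrices, the triple brackets by the Jacobi identity.
    simp only [hR, hR']
    rw [hD2 p k l, hD2 p l k, hD2 k l p]
    noncomm_ring
  have := congrFun (congrFun key i) j
  simpa only [R, R', A, Matrix.add_apply, Matrix.sub_apply, Matrix.mul_apply, Matrix.of_apply,
    Matrix.zero_apply] using this

theorem riemannUp_eq_of_curvature_eq (h : IsMetricOn G U) (hy : y ∈ U) {κ : ℝ}
    (hκ : ∀ i j k l, curvature G i j k l y = κ * (G y i k * G y j l - G y i l * G y j k))
    (i j k l : Fin n) :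
    riemannUp G i j k l y =
      κ * ((if i = k then G y j l else 0) - (if i = l then G y j k else 0)) := by
  refine congrFun (h.eq_of_sum_mul_eq hy (f := fun i => riemannUp G i j k l y)
    (f' := fun i => κ * ((if i = k then G y j l else 0) - (if i = l then G y j k else 0)))
    fun p => ?_) i
  refine (hκ p j k l).trans ?_
  simp only [mul_sub, mul_ite, mul_zero, Finset.sum_sub_distrib, Finset.sum_ite_eq',
    Finset.mem_univ, if_true]
  ring

theorem sum_mul_inv_eq (h : IsMetricOn G U) (hy : y ∈ U) (i j : Fin n) :
    ∑ a, (G y)⁻¹ i a * G y a j = if i = j then 1 else 0 := by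
  have h1 : (G y)⁻¹ * G y = 1 := Matrix.nonsing_inv_mul _ (h.det_ne_zero y hy).isUnit
  have := congrFun (congrFun h1 i) j
  rwa [Matrix.mul_apply, Matrix.one_apply] at this

/-- Schur's lemma: in dimension at least three, pointwise constant sectional curvature is
locally constant. -/
theorem exists_const_curvature (hn : 3 ≤ n) (h : IsMetricOn G U) (hU : Convex ℝ U)
    (hκ : ∀ y ∈ U, ∃ κ : ℝ, ∀ i j k l, curvature G i j k l y =
      κ * (G y i k * G y j l - G y i l * G y j k)) :
    ∃ C : ℝ, ∀ y ∈ U, ∀ i j k l, riemannUp G i j k l y =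
      C * ((if i = k then G y j l else 0) - (if i = l then G y j k else 0)) := by
  have hR : ∀ y ∈ U, ∃ κ : ℝ, ∀ i j k l, riemannUp G i j k l y =
      κ * ((if i = k then G y j l else 0) - (if i = l then G y j k else 0)) := fun y hy =>
    (hκ y hy).imp fun κ h' => h.riemannUp_eq_of_curvature_eq hy h'
  -- Three distinct indices are the reason for the assumption `3 ≤ n`.
  have hdist : ∀ l : Fin n, ∃ k p : Fin n, k ≠ l ∧ p ≠ l ∧ k ≠ p := by
    intro l
    have h1 : 1 < (Finset.univ.erase l).card := by
      rw [Finset.card_erase_of_mem (Finset.mem_univ _), Finset.card_univ, Fintype.card_fin]; omega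
    obtain ⟨k, hk, p, hp, hkp⟩ := Finset.one_lt_card.1 h1
    exact ⟨k, p, (Finset.mem_erase.1 hk).1, (Finset.mem_erase.1 hp).1, hkp⟩
  choose! κ hκ using hR
  -- The chosen `κ` carries no regularity. It is smooth because, for fixed `k ≠ l`, it is the
  -- contraction `∑ j, G^{lj} R^k_{jkl}`.
  have hκs : ContDiffOn ℝ ∞ κ U := by
    let l : Fin n := ⟨0, by omega⟩
    let k : Fin n := ⟨1, by omega⟩
    have hkl : k ≠ l := by simp [k, l]
    refine ContDiffOn.congr (f := fun y => ∑ j, (G y)⁻¹ l j * riemannUp G k j k l y)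
      (ContDiffOn.sum fun j _ => (contDiffOn_matrix_inv h.contDiffOn h.det_ne_zero l j).mul
        (h.contDiffOn_riemannUp k j k l)) fun y hy => ?_
    simp only [hκ y hy, if_true, if_neg hkl, sub_zero]
    have := h.sum_mul_inv_eq hy l l
    rw [if_pos rfl] at this
    calc κ y = κ y * ∑ a, (G y)⁻¹ l a * G y a l := by rw [this, mul_one]
      _ = _ := by rw [Finset.mul_sum]; exact Finset.sum_congr rfl fun j _ => by ring
  have hd0 : ∀ y ∈ U, ∀ l, partialDeriv l κ y = 0 := by
    intro y hy l
    obtain ⟨k, p, hkl, hpl, hkp⟩ := hdist l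
    have hκd := differentiableAt_of_contDiffOn h.isOpen hκs hy
    have hGd : ∀ i j, DifferentiableAt ℝ (fun z => G z i j) y := fun i j =>
      differentiableAt_of_contDiffOn h.isOpen (h.contDiffOn i j) hy
    -- In the Bianchi identity for `R^k_j` with form indices `k, l, p`, the terms containing
    -- undifferentiated `κ` cancel because the connection is metric and torsion-free. Only
    -- derivatives of `κ` remain.
    have key : ∀ j, partialDeriv p κ y * G y j l = partialDeriv l κ y * G y j p := by
      intro j
      have hb := h.bianchi hy k j k l p
      have hp1 : partialDeriv p (riemannUp G k j k l) y =
          κ y * partialDeriv p (fun z => G z j l) y + partialDeriv p κ y * G y j l := by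
        rw [partialDeriv_congr_of_isOpen h.isOpen (F' := fun z => κ z * G z j l)
          (fun z hz => by simp [hκ z hz, hkl]) p hy, partialDeriv_mul p hκd (hGd j l)]
      have hp2 : partialDeriv k (riemannUp G k j l p) y = 0 := by
        rw [partialDeriv_congr_of_isOpen h.isOpen (F' := fun z => 0)
          (fun z hz => by simp [hκ z hz, hkl, hkp]) k hy, partialDeriv_const]
      have hp3 : partialDeriv l (riemannUp G k j p k) y =
          -(κ y * partialDeriv l (fun z => G z j p) y + partialDeriv l κ y * G y j p) := by
        rw [partialDeriv_congr_of_isOpen h.isOpen (F' := fun z => -(κ z * G z j p))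
          (fun z hz => by simp [hκ z hz, hkp]) l hy, partialDeriv_neg,
          partialDeriv_mul l hκd (hGd j p)]
      have hs1 : ∀ q r s, ∑ a, christoffel G k q a y * riemannUp G a j r s y =
          κ y * (christoffel G k q r y * G y j s - christoffel G k q s y * G y j r) := by
        intro q r s
        simp only [hκ y hy, mul_sub, mul_ite, mul_zero, Finset.sum_sub_distrib,
          Finset.sum_ite_eq', Finset.mem_univ, if_true]
        ring
      have hs2 : ∀ q r s, ∑ a, riemannUp G k a r s y * christoffel G a q j y =
          κ y * ((if k = r then christoffelLow G s q j y else 0)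
            - (if k = s then christoffelLow G r q j y else 0)) := by
        intro q r s
        simp only [hκ y hy, ← h.sum_mul_christoffel hy, h.symm y hy s, h.symm y hy r]
        split_ifs <;> simp only [Finset.mul_sum, ← Finset.sum_sub_distrib, sub_zero, zero_sub,
          mul_neg, neg_mul, Finset.sum_neg_distrib, sub_self, mul_zero, zero_mul,
          Finset.sum_const_zero] <;> simp only [mul_assoc, mul_sub, sub_mul]
      rw [hp1, hp2, hp3] at hb
      simp only [hs1, hs2, if_true, if_neg hkl, if_neg hkp, h.partialDeriv_eq hy] at hb
      rw [h.christoffel_symm hy k p k, h.christoffel_symm hy k l k, h.christoffel_symm hy k p l,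
        h.christoffelLow_symm hy j p l] at hb
      linear_combination hb
    -- Contracting with `G^{pj}` turns `G_jl` into `0`, since `p ≠ l`, and `G_jp` into `1`, which
    -- leaves `∂_l κ = 0`.
    have h1 : ∑ j, (G y)⁻¹ p j * (partialDeriv p κ y * G y j l) =
        ∑ j, (G y)⁻¹ p j * (partialDeriv l κ y * G y j p) :=
      Finset.sum_congr rfl fun j _ => by rw [key j]
    have h2 : ∀ c q, ∑ j, (G y)⁻¹ p j * (c * G y j q) = c * if p = q then 1 else 0 := by
      intro c q
      rw [← h.sum_mul_inv_eq hy, Finset.mul_sum]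
      exact Finset.sum_congr rfl fun j _ => by ring
    rw [h2, h2, if_neg hpl, if_pos rfl] at h1
    linarith
  rcases U.eq_empty_or_nonempty with hempty | ⟨y₀, hy₀⟩
  · exact ⟨0, fun y hy => by simp [hempty] at hy⟩
  · refine ⟨κ y₀, fun y hy i j k l => ?_⟩
    have hconst := h.isOpen.is_const_of_fderiv_eq_zero hU.isPreconnected
      (hκs.differentiableOn (by simp)) (fun z hz => by
        ext v
        rw [fderiv_eq_sum]
        simp [hd0 z hz]) hy hy₀
    rw [hκ y hy, hconst]

end IsMetricOn

end Coord

end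

/-! ### Stereographic coordinates from the equation `Hess u = -C u H` -/

noncomputable section

namespace Coord

open Filter Topology

variable {n : ℕ}

/-- The coefficients of the linear system `∂_k u = H_{bk} V^b`, `∂_k V^i = -Γ^i_{ka} V^a - C u δ^i_k`
for a function `u` (index `none`) with gradient `V` and Hessian `-C u H`. -/
def hessianSystem (H : EuclideanSpace ℝ (Fin n) → Matrix (Fin n) (Fin n) ℝ) (C : ℝ) (k : Fin n) :
    Option (Fin n) → Option (Fin n) → EuclideanSpace ℝ (Fin n) → ℝ
  | none, none => fun _ => 0
  | none, some b => fun y => H y b k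
  | some i, none => fun _ => -(if i = k then C else 0)
  | some i, some a => fun y => -christoffel H i k a y

variable {H : EuclideanSpace ℝ (Fin n) → Matrix (Fin n) (Fin n) ℝ}
  {U : Set (EuclideanSpace ℝ (Fin n))} {y₀ : EuclideanSpace ℝ (Fin n)}

namespace IsMetricOn

/-- Flatness is checked in four blocks. The block from `V` to `V` is the assumption of constant
curvature `C`. The other three follow from the symmetry of `H`, from the symmetry of the Christoffel
symbols, and from metric compatibility together with that symmetry. -/
theorem exists_hessian_solution (h : IsMetricOn H U) (hy₀ : y₀ ∈ U) {C : ℝ}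
    (hC : ∀ y ∈ U, ∀ i j k l, riemannUp H i j k l y =
      C * ((if i = k then H y j l else 0) - (if i = l then H y j k else 0)))
    (x₀ : Option (Fin n) → ℝ) :
    ∃ (u : EuclideanSpace ℝ (Fin n) → ℝ) (V : Fin n → EuclideanSpace ℝ (Fin n) → ℝ),
      u y₀ = x₀ none ∧ (∀ a, V a y₀ = x₀ (some a)) ∧
      ∃ W ∈ 𝓝 y₀, IsOpen W ∧ ContDiffOn ℝ ∞ u W ∧ (∀ a, ContDiffOn ℝ ∞ (V a) W) ∧
        ∀ y ∈ W, ∀ k, partialDeriv k u y = ∑ b, H y b k * V b y ∧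
          ∀ i, partialDeriv k (V i) y =
            -(∑ a, christoffel H i k a y * V a y) - (if i = k then C else 0) * u y := by
  have hs : ∀ k a b, ContDiffOn ℝ ∞ (hessianSystem H C k a b) U := by
    rintro k (_ | a) (_ | b)
    · exact contDiffOn_const
    · exact h.contDiffOn b k
    · exact contDiffOn_const
    · exact (h.contDiffOn_christoffel a k b).neg
  obtain ⟨X, hX0, W, hW, hWo, hX⟩ := exists_solution_of_flat (h.isOpen.mem_nhds hy₀) hs
    (fun y hy k l a b => by
      rcases a with _ | i <;> rcases b with _ | b <;>
        simp only [hessianSystem, Fintype.sum_option, partialDeriv_const, partialDeriv_neg,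
          mul_zero, zero_mul, zero_add, mul_neg, neg_mul, mul_ite, neg_neg,
          Finset.sum_neg_distrib, Finset.sum_ite_eq', Finset.mem_univ, if_true, ite_mul]
      · rw [h.symm y hy k l]
      · have h1 : ∀ k l, ∑ c, H y c k * christoffel H c l b y = christoffelLow H k l b y := by
          intro k l
          rw [← h.sum_mul_christoffel hy]
          exact Finset.sum_congr rfl fun c _ => by rw [h.symm y hy]
        rw [h1, h1, h.partialDeriv_eq hy, h.partialDeriv_eq hy, h.christoffelLow_symm hy b k l]
        ring
      · rw [h.christoffel_symm hy i k l]
      · have := hC y hy i b k l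
        rw [riemannUp, Finset.sum_sub_distrib] at this
        rw [mul_sub, mul_ite, mul_ite, mul_zero] at this
        linear_combination this) x₀
  refine ⟨X none, fun a => X (some a), hX0 _, fun a => hX0 _, W, hW, hWo, (hX none).1,
    fun a => (hX _).1, fun y hy k => ⟨?_, fun i => ?_⟩⟩
  · rw [(hX none).2 y hy, Fintype.sum_option]
    simp [hessianSystem]
  · rw [(hX (some i)).2 y hy, Fintype.sum_option]
    simp only [hessianSystem, neg_mul, Finset.sum_neg_distrib]
    ring

/-- Two solutions of the system have a constant product `C u u' + H(V, V')`. -/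
theorem hessian_product_const (h : IsMetricOn H U) {C : ℝ} {W : Set (EuclideanSpace ℝ (Fin n))}
    (hWo : IsOpen W) (hWc : IsPreconnected W) (hWU : W ⊆ U)
    {u u' : EuclideanSpace ℝ (Fin n) → ℝ} {V V' : Fin n → EuclideanSpace ℝ (Fin n) → ℝ}
    (hu : ContDiffOn ℝ ∞ u W) (hu' : ContDiffOn ℝ ∞ u' W)
    (hV : ∀ a, ContDiffOn ℝ ∞ (V a) W) (hV' : ∀ a, ContDiffOn ℝ ∞ (V' a) W)
    (hd : ∀ y ∈ W, ∀ k, partialDeriv k u y = ∑ b, H y b k * V b y ∧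
          ∀ i, partialDeriv k (V i) y =
            -(∑ a, christoffel H i k a y * V a y) - (if i = k then C else 0) * u y)
    (hd' : ∀ y ∈ W, ∀ k, partialDeriv k u' y = ∑ b, H y b k * V' b y ∧
          ∀ i, partialDeriv k (V' i) y =
            -(∑ a, christoffel H i k a y * V' a y) - (if i = k then C else 0) * u' y)
    {y : EuclideanSpace ℝ (Fin n)} (hy : y ∈ W) (hy₀ : y₀ ∈ W) :
    C * (u y * u' y) + ∑ a, ∑ b, H y a b * (V a y * V' b y) =
      C * (u y₀ * u' y₀) + ∑ a, ∑ b, H y₀ a b * (V a y₀ * V' b y₀) := by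
  have hH : ∀ a b, ContDiffOn ℝ ∞ (fun z => H z a b) W := fun a b => (h.contDiffOn a b).mono hWU
  have hVV : ∀ a b, ContDiffOn ℝ ∞ (fun z => V a z * V' b z) W := fun a b => (hV a).mul (hV' b)
  have hterm : ∀ a b, ContDiffOn ℝ ∞ (fun z => H z a b * (V a z * V' b z)) W := fun a b =>
    (hH a b).mul (hVV a b)
  have hsum : ContDiffOn ℝ ∞ (fun z => ∑ a, ∑ b, H z a b * (V a z * V' b z)) W :=
    ContDiffOn.sum fun a _ => ContDiffOn.sum fun b _ => hterm a b
  have huu : ContDiffOn ℝ ∞ (fun z => C * (u z * u' z)) W := contDiffOn_const.mul (hu.mul hu')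
  refine hWo.is_const_of_fderiv_eq_zero hWc
    (f := fun y => C * (u y * u' y) + ∑ a, ∑ b, H y a b * (V a y * V' b y))
    ((huu.add hsum).differentiableOn (by simp)) (fun z hz => ?_) hy hy₀
  have hzU := hWU hz
  ext v
  rw [fderiv_eq_sum, Pi.zero_apply, zero_apply]
  refine Finset.sum_eq_zero fun k _ => ?_
  have dd : ∀ {F : EuclideanSpace ℝ (Fin n) → ℝ}, ContDiffOn ℝ ∞ F W → DifferentiableAt ℝ F z :=
    fun hF => differentiableAt_of_contDiffOn hWo hF hz
  rw [partialDeriv_add k (dd huu) (dd hsum), partialDeriv_const_mul k _ (dd (hu.mul hu')),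
    partialDeriv_mul k (dd hu) (dd hu'), partialDeriv_sum k fun a _ =>
      dd (ContDiffOn.sum fun b _ => hterm a b)]
  simp only [fun a => partialDeriv_sum (s := Finset.univ) k fun b _ => dd (hterm a b),
    fun a b => partialDeriv_mul k (dd (hH a b)) (dd (hVV a b)),
    fun a b => partialDeriv_mul k (dd (hV a)) (dd (hV' b)), (hd z hz k).1, (hd' z hz k).1,
    (hd z hz k).2, (hd' z hz k).2, h.partialDeriv_eq hzU]
  -- In the derivative of `H(V, V')`, the sums `e1` and `e2` cancel `∂_k H` by metric compatibility,
  -- and `e3` and `e4` cancel the derivative of `C u u'`.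
  have e1 : ∑ a, ∑ b, H z a b * (V a z * ∑ c, christoffel H b k c z * V' c z) =
      ∑ a, ∑ b, christoffelLow H a k b z * (V a z * V' b z) := by
    refine Finset.sum_congr rfl fun a _ => ?_
    simp only [← h.sum_mul_christoffel hzU, Finset.mul_sum, Finset.sum_mul]
    rw [Finset.sum_comm]
    exact Finset.sum_congr rfl fun b _ => Finset.sum_congr rfl fun c _ => by ring
  have e2 : ∑ a, ∑ b, H z a b * ((∑ c, christoffel H a k c z * V c z) * V' b z) =
      ∑ a, ∑ b, christoffelLow H b k a z * (V a z * V' b z) := by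
    rw [Finset.sum_comm]
    conv_rhs => rw [Finset.sum_comm]
    refine Finset.sum_congr rfl fun b _ => ?_
    simp only [← h.sum_mul_christoffel hzU, Finset.mul_sum, Finset.sum_mul]
    rw [Finset.sum_comm]
    exact Finset.sum_congr rfl fun a _ => Finset.sum_congr rfl fun c _ => by
      rw [h.symm z hzU]; ring
  have e3 : ∑ a, ∑ b, H z a b * (V a z * ((if b = k then C else 0) * u' z)) =
      C * ((∑ b, H z b k * V b z) * u' z) := by
    rw [Finset.sum_mul, Finset.mul_sum]
    refine Finset.sum_congr rfl fun a _ => ?_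
    simp only [ite_mul, zero_mul, mul_ite, mul_zero, Finset.sum_ite_eq', Finset.mem_univ, if_true]
    ring
  have e4 : ∑ a, ∑ b, H z a b * (((if a = k then C else 0) * u z) * V' b z) =
      C * (u z * ∑ b, H z b k * V' b z) := by
    rw [Finset.sum_comm, Finset.mul_sum, Finset.mul_sum]
    refine Finset.sum_congr rfl fun b _ => ?_
    simp only [ite_mul, zero_mul, mul_ite, mul_zero, Finset.sum_ite_eq', Finset.mem_univ, if_true]
    rw [h.symm z hzU]; ring
  have e5 : ∀ a b, H z a b * (V a z * (-(∑ c, christoffel H b k c z * V' c z)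
        - (if b = k then C else 0) * u' z)
        + (-(∑ c, christoffel H a k c z * V c z) - (if a = k then C else 0) * u z) * V' b z)
      + (christoffelLow H a k b z + christoffelLow H b k a z) * (V a z * V' b z) =
      christoffelLow H a k b z * (V a z * V' b z) + christoffelLow H b k a z * (V a z * V' b z)
      - H z a b * (V a z * ∑ c, christoffel H b k c z * V' c z)
      - H z a b * ((∑ c, christoffel H a k c z * V c z) * V' b z)
      - H z a b * (V a z * ((if b = k then C else 0) * u' z))
      - H z a b * (((if a = k then C else 0) * u z) * V' b z) := fun a b => by ring
  simp only [e5, Finset.sum_sub_distrib, Finset.sum_add_distrib, e1, e2, e3, e4]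
  ring

/-- Eigenvectors are divided by the square roots of their eigenvalues. -/
theorem exists_orthonormal {n : ℕ} {A : Matrix (Fin n) (Fin n) ℝ} (hA : A.PosDef) :
    ∃ e : Fin n → Fin n → ℝ, ∀ i j, ∑ a, ∑ b, A a b * (e i a * e j b) = if i = j then 1 else 0 := by
  have hv := hA.isHermitian.mulVec_eigenvectorBasis
  have hpos := hA.eigenvalues_pos
  set v := hA.isHermitian.eigenvectorBasis
  set d := hA.isHermitian.eigenvalues
  refine ⟨fun i a => (√(d i))⁻¹ * v i a, fun i j => ?_⟩
  have h1 : ∀ a, ∑ b, A a b * v j b = d j * v j a := fun a => congrFun (hv j) a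
  have h2 : ∑ a, v i a * v j a = if i = j then 1 else 0 := by
    have := orthonormal_iff_ite.1 v.orthonormal i j
    rw [← this, PiLp.inner_apply]
    exact Finset.sum_congr rfl fun a _ => by simp [mul_comm]
  calc ∑ a, ∑ b, A a b * ((√(d i))⁻¹ * v i a * ((√(d j))⁻¹ * v j b))
      = (√(d i))⁻¹ * (√(d j))⁻¹ * ∑ a, v i a * ∑ b, A a b * v j b := by
        simp only [Finset.mul_sum]
        exact Finset.sum_congr rfl fun a _ => Finset.sum_congr rfl fun b _ => by ring
    _ = (√(d i))⁻¹ * (√(d j))⁻¹ * d j * ∑ a, v i a * v j a := by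
        simp only [h1, Finset.mul_sum]
        exact Finset.sum_congr rfl fun a _ => by ring
    _ = if i = j then 1 else 0 := by
        rw [h2]
        split_ifs with hij
        · subst hij
          have h3 : √(d i) ≠ 0 := (Real.sqrt_pos.2 (hpos i)).ne'
          have h4 : √(d i) * √(d i) = d i := Real.mul_self_sqrt (hpos i).le
          field_simp
          rw [sq, h4]
        · simp

end IsMetricOn

/-- A metric of constant curvature is locally conformally flat: stereographic coordinates. -/
theorem IsMetricOn.exists_stereographic (h : IsMetricOn H U) (hy₀ : y₀ ∈ U)
    (hpos : (H y₀).PosDef) {C : ℝ}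
    (hC : ∀ y ∈ U, ∀ i j k l, riemannUp H i j k l y =
      C * ((if i = k then H y j l else 0) - (if i = l then H y j k else 0))) :
    ∃ (θ : Fin n → EuclideanSpace ℝ (Fin n) → ℝ) (w : EuclideanSpace ℝ (Fin n) → ℝ),
      ∃ W ∈ 𝓝 y₀, IsOpen W ∧ (∀ a, ContDiffOn ℝ ∞ (θ a) W) ∧ ContDiffOn ℝ ∞ w W ∧
        ∀ y ∈ W, 0 < w y ∧ ∀ i j, H y i j =
          w y ^ 2 * ∑ a, partialDeriv i (θ a) y * partialDeriv j (θ a) y := by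
  obtain ⟨e, he⟩ := IsMetricOn.exists_orthonormal hpos
  -- On the unit sphere, `u₀` would be the height function with its maximum at `y₀`, and the `u a`
  -- below the remaining ambient coordinates. For `C = 0` they are the constant `1` and affine
  -- functions.
  obtain ⟨u₀, V₀, hu₀y, hV₀y, W₀, hW₀, hW₀o, hu₀, hV₀, hd₀⟩ := h.exists_hessian_solution hy₀ hC
    (fun o => o.elim 1 fun _ => 0)
  choose u V huy hVy W hW hWo hu hV hd using fun a : Fin n => h.exists_hessian_solution hy₀ hC
    (fun o => o.elim 0 (e a))
  have hnhds : ∀ᶠ y in 𝓝 y₀, y ∈ U ∧ y ∈ W₀ ∧ (∀ a, y ∈ W a) ∧ 0 < 1 + u₀ y := by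
    have : ContinuousAt u₀ y₀ := (hu₀.contDiffAt hW₀).continuousAt
    have h1 : Tendsto (fun y => 1 + u₀ y) (𝓝 y₀) (𝓝 (1 + u₀ y₀)) := this.tendsto.const_add 1
    have h2 : ∀ᶠ y in 𝓝 y₀, 0 < 1 + u₀ y :=
      h1.eventually (lt_mem_nhds (by rw [hu₀y]; norm_num))
    have h3 : ∀ᶠ y in 𝓝 y₀, ∀ a, y ∈ W a := Filter.eventually_all.2 hW
    filter_upwards [h.isOpen.mem_nhds hy₀, hW₀, h3, h2] with y h4 h5 h6 h7
    exact ⟨h4, h5, h6, h7⟩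
  obtain ⟨r, hr, hball⟩ := Metric.eventually_nhds_iff_ball.1 hnhds
  have hBo : IsOpen (Metric.ball y₀ r) := Metric.isOpen_ball
  have hBc : IsPreconnected (Metric.ball y₀ r) := (convex_ball y₀ r).isPreconnected
  have hBU : Metric.ball y₀ r ⊆ U := fun y hy => (hball y hy).1
  have hBW₀ : Metric.ball y₀ r ⊆ W₀ := fun y hy => (hball y hy).2.1
  have hBW : ∀ a, Metric.ball y₀ r ⊆ W a := fun a y hy => (hball y hy).2.2.1 a
  have hp : ∀ y ∈ Metric.ball y₀ r, 0 < 1 + u₀ y := fun y hy => (hball y hy).2.2.2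
  have hy₀B : y₀ ∈ Metric.ball y₀ r := Metric.mem_ball_self hr
  have hu₀' := hu₀.mono hBW₀
  have hu' := fun a => (hu a).mono (hBW a)
  have hV₀' := fun a => (hV₀ a).mono hBW₀
  have hV' := fun a b => (hV a b).mono (hBW a)
  have hd₀' := fun y hy => hd₀ y (hBW₀ hy)
  have hd' := fun a y hy => hd a y (hBW a hy)
  -- The conserved products, evaluated at `y₀` from the initial values. On the unit sphere they
  -- express the orthonormality of the ambient coordinate vectors.
  have q00 : ∀ y ∈ Metric.ball y₀ r,
      C * (u₀ y * u₀ y) + ∑ a, ∑ b, H y a b * (V₀ a y * V₀ b y) = C := fun y hy => by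
    rw [h.hessian_product_const hBo hBc hBU hu₀' hu₀' hV₀' hV₀' hd₀' hd₀' hy hy₀B]
    simp [hu₀y, hV₀y]
  have q0 : ∀ y ∈ Metric.ball y₀ r, ∀ c,
      C * (u₀ y * u c y) + ∑ a, ∑ b, H y a b * (V₀ a y * V c b y) = 0 := fun y hy c => by
    rw [h.hessian_product_const hBo hBc hBU hu₀' (hu' c) hV₀' (hV' c) hd₀' (hd' c) hy hy₀B]
    simp [hu₀y, hV₀y, huy]
  have q0' : ∀ y ∈ Metric.ball y₀ r, ∀ c,
      C * (u c y * u₀ y) + ∑ a, ∑ b, H y a b * (V c a y * V₀ b y) = 0 := fun y hy c => by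
    rw [h.hessian_product_const hBo hBc hBU (hu' c) hu₀' (hV' c) hV₀' (hd' c) hd₀' hy hy₀B]
    simp [hV₀y, huy]
  have q : ∀ y ∈ Metric.ball y₀ r, ∀ c d,
      C * (u c y * u d y) + ∑ a, ∑ b, H y a b * (V c a y * V d b y) =
        if c = d then 1 else 0 := fun y hy c d => by
    rw [h.hessian_product_const hBo hBc hBU (hu' c) (hu' d) (hV' c) (hV' d) (hd' c) (hd' d) hy hy₀B]
    simp only [huy, hVy, Option.elim_none, Option.elim_some, he]
    simp
  -- Stereographic projection from the pole `u₀ = -1`, which is avoided near `y₀` since `u₀ y₀ = 1`.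
  refine ⟨fun a y => 2 * (u a y * (1 + u₀ y)⁻¹), fun y => (1 / 2) * (1 + u₀ y), _,
    hBo.mem_nhds hy₀B, hBo, fun a => contDiffOn_const.mul ((hu' a).mul
      ((contDiffOn_const.add hu₀').inv fun y hy => (hp y hy).ne')),
    contDiffOn_const.mul (contDiffOn_const.add hu₀'), fun y hy => ⟨by have := hp y hy; positivity,
      fun i j => ?_⟩⟩
  have hpy := (hp y hy).ne'
  -- Row `a` of `Z` is the gradient of `θ_a`, so `Z * H` is the Jacobian matrix.
  let Z : Matrix (Fin n) (Fin n) ℝ := Matrix.of fun a b =>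
    2 * (V a b y * (1 + u₀ y) - u a y * V₀ b y) / (1 + u₀ y) ^ 2
  have hJ : ∀ a i, partialDeriv i (fun y => 2 * (u a y * (1 + u₀ y)⁻¹)) y = (Z * H y) a i := by
    intro a i
    have du : DifferentiableAt ℝ (u a) y := differentiableAt_of_contDiffOn hBo (hu' a) hy
    have du₀ : DifferentiableAt ℝ (fun y => 1 + u₀ y) y :=
      (differentiableAt_of_contDiffOn hBo hu₀' hy).const_add 1
    have hinv : partialDeriv i (fun y => (1 + u₀ y)⁻¹) y =
        -(partialDeriv i u₀ y) / (1 + u₀ y) ^ 2 := by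
      have h1 := (hasDerivAt_inv hpy).comp_hasFDerivAt y
        ((differentiableAt_of_contDiffOn hBo hu₀' hy).hasFDerivAt.const_add 1)
      have h2 : HasFDerivAt (fun y => (1 + u₀ y)⁻¹) _ y := h1
      rw [partialDeriv, h2.fderiv, smul_apply, smul_eq_mul, partialDeriv]
      ring
    have dinv : DifferentiableAt ℝ (fun y => (1 + u₀ y)⁻¹) y := du₀.inv hpy
    rw [partialDeriv_const_mul (F := fun y => u a y * (1 + u₀ y)⁻¹) i 2 (du.mul dinv), partialDeriv_mul i du dinv, hinv,
      (hd' a y hy i).1, (hd₀' y hy i).1, Matrix.mul_apply]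
    simp only [Z, Matrix.of_apply]
    have h3 : ∀ b, 2 * (V a b y * (1 + u₀ y) - u a y * V₀ b y) / (1 + u₀ y) ^ 2 * H y b i =
        2 / (1 + u₀ y) * (H y b i * V a b y) -
          2 * u a y / (1 + u₀ y) ^ 2 * (H y b i * V₀ b y) := fun b => by
      field_simp
    simp only [h3, Finset.sum_sub_distrib, ← Finset.mul_sum]
    field_simp
    ring
  -- The gradients of the `θ_a` are orthogonal and of equal length. After the conserved products are
  -- inserted, the coefficients of `C u_c u_d` add up to zero.
  have hZ : Z * H y * Z.transpose = (4 / (1 + u₀ y) ^ 2) • (1 : Matrix (Fin n) (Fin n) ℝ) := by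
    ext c d
    have h0 : (Z * H y * Z.transpose) c d = ∑ a, ∑ b, H y a b * (Z c a * Z d b) := by
      simp only [Matrix.mul_apply, Finset.sum_mul, Matrix.transpose_apply]
      rw [Finset.sum_comm]
      exact Finset.sum_congr rfl fun a _ => Finset.sum_congr rfl fun b _ => by ring
    have h1 : ∀ a b, H y a b * (Z c a * Z d b) = 4 / (1 + u₀ y) ^ 4 *
        ((1 + u₀ y) ^ 2 * (H y a b * (V c a y * V d b y))
        - (1 + u₀ y) * u d y * (H y a b * (V c a y * V₀ b y))
        - (1 + u₀ y) * u c y * (H y a b * (V₀ a y * V d b y))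
        + u c y * u d y * (H y a b * (V₀ a y * V₀ b y))) := by
      intro a b
      simp only [Z, Matrix.of_apply]
      field_simp
      ring
    rw [h0]
    simp only [h1, ← Finset.mul_sum, Finset.sum_add_distrib, Finset.sum_sub_distrib]
    rw [eq_sub_of_add_eq' (q y hy c d), eq_sub_of_add_eq' (q0 y hy d),
      eq_sub_of_add_eq' (q0' y hy c), eq_sub_of_add_eq' (q00 y hy), Matrix.smul_apply,
      Matrix.one_apply, smul_eq_mul]
    field_simp
    ring
  have h1 : Z * (H y * (((1 + u₀ y) ^ 2 / 4) • Z.transpose)) = 1 := by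
    rw [Matrix.mul_smul, Matrix.mul_smul, ← Matrix.mul_assoc, hZ, smul_smul]
    field_simp
    simp
  -- For square matrices a right inverse is a left inverse. This converts the Gram matrix of the
  -- gradients into the formula for `H` in terms of the Jacobian.
  have h2 := mul_eq_one_comm.1 h1
  have hsymm : (H y).transpose = H y := by
    ext i j; exact h.symm y (hBU hy) j i
  have h3 : H y = ((1 + u₀ y) ^ 2 / 4) • ((Z * H y).transpose * (Z * H y)) := by
    rw [Matrix.transpose_mul, hsymm, ← Matrix.mul_assoc, ← Matrix.smul_mul, ← Matrix.smul_mul,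
      ← Matrix.mul_smul, h2, Matrix.one_mul]
  have h4 := congrFun (congrFun h3 i) j
  rw [Matrix.smul_apply, Matrix.mul_apply, smul_eq_mul] at h4
  simp only [hJ]
  rw [h4]
  simp only [Matrix.transpose_apply]
  ring

end Coord

end

noncomputable section

/-! ### Charts and metrics in charts -/

section Charts

open Filter Topology

/-- An injective endomorphism of `ℝ^m` is a unit among the continuous linear maps. -/
theorem ContinuousLinearMap.isUnit_of_injective {E : Type*} [NormedAddCommGroup E]
    [NormedSpace ℝ E] [FiniteDimensional ℝ E] {L : E →L[ℝ] E} (h : Function.Injective L) :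
    IsUnit L := by
  let e := (LinearEquiv.ofInjectiveEndo (L : E →ₗ[ℝ] E) h).toContinuousLinearEquiv
  have : L = (ContinuousLinearEquiv.toUnit e : (E →L[ℝ] E)ˣ) := by ext v; rfl
  rw [this]
  exact Units.isUnit _

/-- Inverse function theorem: a smooth map to `ℝ^m` with injective differential at `p` is a chart
near `p`. -/
theorem exists_chart_of_injective_mfderiv {m : ℕ} {M : Type*} [TopologicalSpace M]
    [ChartedSpace (EuclideanSpace ℝ (Fin m)) M] [IsManifold (𝓡 m) ∞ M]
    {p : M} {Ψ : M → EuclideanSpace ℝ (Fin m)} {W : Set M} (hW : W ∈ 𝓝 p)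
    (hΨ : ContMDiffOn (𝓡 m) (𝓡 m) ∞ Ψ W)
    (hinj : Function.Injective (mfderiv (𝓡 m) (𝓡 m) Ψ p)) :
    ∃ x ∈ IsManifold.maximalAtlas (𝓡 m) ∞ M, p ∈ x.source ∧ x.source ⊆ W ∧
      ∀ q ∈ x.source, x q = Ψ q := by
  let c := chartAt (EuclideanSpace ℝ (Fin m)) p
  have hc : c ∈ IsManifold.maximalAtlas (𝓡 m) ∞ M := IsManifold.chart_mem_maximalAtlas p
  have hpc : p ∈ c.source := mem_chart_source _ p
  have hpct : c p ∈ c.target := c.map_source hpc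
  let O₀ : Set (EuclideanSpace ℝ (Fin m)) := c.target ∩ c.symm ⁻¹' (interior W)
  have hO₀ : IsOpen O₀ := c.symm.isOpen_inter_preimage isOpen_interior
  let F : EuclideanSpace ℝ (Fin m) → EuclideanSpace ℝ (Fin m) := Ψ ∘ c.symm
  have hF : ContDiffOn ℝ ∞ F O₀ := by
    rw [← contMDiffOn_iff_contDiffOn]
    exact (hΨ.mono interior_subset).comp
      ((contMDiffOn_symm_of_mem_maximalAtlas hc).mono Set.inter_subset_left) fun y hy => hy.2
  have hp₀ : c p ∈ O₀ := ⟨hpct, by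
    change c.symm (c p) ∈ interior W
    rw [c.left_inv hpc]; exact mem_interior_iff_mem_nhds.2 hW⟩
  have hFinj : Function.Injective (fderiv ℝ F (c p)) := by
    have h1 : MDifferentiableAt (𝓡 m) (𝓡 m) Ψ (c.symm (c p)) := by
      rw [c.left_inv hpc]
      exact (hΨ.contMDiffAt hW).mdifferentiableAt (by simp)
    have h2 : MDifferentiableAt (𝓡 m) (𝓡 m) c.symm (c p) :=
      (contMDiffAt_symm_of_mem_maximalAtlas hc hpct).mdifferentiableAt (by simp)
    have h3 : fderiv ℝ F (c p) = (mfderiv (𝓡 m) (𝓡 m) Ψ (c.symm (c p))).comp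
        (mfderiv (𝓡 m) (𝓡 m) c.symm (c p)) := by
      rw [← mfderiv_eq_fderiv]
      exact mfderiv_comp _ h1 h2
    rw [h3]
    have h4 : Function.Injective (mfderiv (𝓡 m) (𝓡 m) c.symm (c p)) :=
      (mdifferentiable_chart (I := 𝓡 m) p).symm.mfderiv_injective hpct
    have h5 : Function.Injective (mfderiv (𝓡 m) (𝓡 m) Ψ (c.symm (c p))) := by
      rw [c.left_inv hpc]; exact hinj
    exact h5.comp h4
  -- Restricting to the open set where the derivative is invertible makes the local inverse smooth
  -- on its entire domain and not only at the image of `p`.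
  let O : Set (EuclideanSpace ℝ (Fin m)) := O₀ ∩ fderiv ℝ F ⁻¹' {L | IsUnit L}
  have hO : IsOpen O :=
    (hF.continuousOn_fderiv_of_isOpen hO₀ (by simp)).isOpen_inter_preimage hO₀ Units.isOpen
  have hpO : c p ∈ O := ⟨hp₀, ContinuousLinearMap.isUnit_of_injective hFinj⟩
  have hFd : ∀ y ∈ O, ∃ L : EuclideanSpace ℝ (Fin m) ≃L[ℝ] EuclideanSpace ℝ (Fin m),
      HasFDerivAt F (L : EuclideanSpace ℝ (Fin m) →L[ℝ] EuclideanSpace ℝ (Fin m)) y := by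
    rintro y ⟨hy, u, hu⟩
    refine ⟨ContinuousLinearEquiv.ofUnit u, ?_⟩
    have h1 := ((hF.contDiffAt (hO₀.mem_nhds hy)).differentiableAt (by simp)).hasFDerivAt
    rw [← hu] at h1
    exact h1
  obtain ⟨L, hL⟩ := hFd _ hpO
  have hFp : ContDiffAt ℝ ∞ F (c p) := hF.contDiffAt (hO₀.mem_nhds hp₀)
  let T := (hFp.toOpenPartialHomeomorph F hL (by simp)).restrOpen O hO
  have hTF : ∀ y, T y = F y := fun y => rfl
  have hTO : T.source ⊆ O := Set.inter_subset_right
  have hTsymm : ContDiffOn ℝ ∞ T.symm T.target := by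
    intro y hy
    have hy' : T.symm y ∈ O := hTO (T.map_target hy)
    obtain ⟨L', hL'⟩ := hFd _ hy'
    exact (T.contDiffAt_symm hy hL' (hF.contDiffAt (hO₀.mem_nhds hy'.1))).contDiffWithinAt
  have hTs : ContDiffOn ℝ ∞ T T.source := hF.mono fun y hy => (hTO hy).1
  have hval : ∀ q ∈ (c.trans T).source, (c.trans T) q = Ψ q := by
    intro q hq
    have hq' : q ∈ c.source ∧ c q ∈ T.source := by simpa using hq
    change F (c q) = Ψ q
    change Ψ (c.symm (c q)) = Ψ q
    rw [c.left_inv hq'.1]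
  refine ⟨c.trans T, ?_, ?_, ?_, hval⟩
  · refine OpenPartialHomeomorph.mem_maximalAtlas_of_contMDiffOn _ ?_ ?_
    · exact (contMDiffOn_iff_contDiffOn.2 hTs).comp
        ((contMDiffOn_of_mem_maximalAtlas hc).mono fun q hq => by
          have hq' : q ∈ c.source ∧ c q ∈ T.source := by simpa using hq
          exact hq'.1) fun q hq => by
          have hq' : q ∈ c.source ∧ c q ∈ T.source := by simpa using hq
          exact hq'.2
    · exact (contMDiffOn_symm_of_mem_maximalAtlas hc).comp
        ((contMDiffOn_iff_contDiffOn.2 hTsymm).mono fun q hq => by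
          have hq' : q ∈ T.target ∧ T.symm q ∈ c.target := by simpa using hq
          exact hq'.1) fun q hq => by
          have hq' : q ∈ T.target ∧ T.symm q ∈ c.target := by simpa using hq
          exact hq'.2
  · have : p ∈ c.source ∧ c p ∈ T.source :=
      ⟨hpc, hFp.mem_toOpenPartialHomeomorph_source hL (by simp), hpO⟩
    simpa using this
  · intro q hq
    have hq' : q ∈ c.source ∧ c q ∈ T.source := by simpa using hq
    have h1 := (hTO hq'.2).1.2
    change c.symm (c q) ∈ interior W at h1
    rw [c.left_inv hq'.1] at h1
    exact interior_subset h1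

/-- The inclusion of an open set has injective differential. -/
theorem mfderiv_opens_val_injective (J : TopologicalSpace.Opens ℝ) (t : J) :
    Function.Injective (mfderiv 𝓘(ℝ, ℝ) 𝓘(ℝ, ℝ) (fun s : J => (s : ℝ)) t) := by
  have h := (mdifferentiable_chart (I := 𝓘(ℝ, ℝ)) t).mfderiv_injective (mem_chart_source ℝ t)
  exact h

end Charts

end

/-! ### Extension of conformal factors, and Riemannian metrics in charts -/

noncomputable section

section Extension

open Filter Topology

variable {m : ℕ} {M : Type*} [TopologicalSpace M]
  [ChartedSpace (EuclideanSpace ℝ (Fin m)) M] [IsManifold (𝓡 m) ∞ M]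

/-- A locally defined smooth function agrees near a point with a global smooth function. -/
theorem exists_contMDiff_eventuallyEq [T2Space M] {p : M} {W : Set M} (hW : W ∈ 𝓝 p) {χ : M → ℝ}
    (hχ : ContMDiffOn (𝓡 m) 𝓘(ℝ, ℝ) ∞ χ W) :
    ∃ χ' : M → ℝ, ContMDiff (𝓡 m) 𝓘(ℝ, ℝ) ∞ χ' ∧ χ' =ᶠ[𝓝 p] χ := by
  obtain ⟨b, -, hb⟩ := (SmoothBumpFunction.nhds_basis_tsupport (I := 𝓡 m) p).mem_iff.1
    (interior_mem_nhds.2 hW)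
  refine ⟨fun q => b q • χ q, contMDiff_of_tsupport fun q hq => ?_, ?_⟩
  · have hq' : q ∈ interior W := hb (tsupport_smul_subset_left (b : M → ℝ) χ hq)
    exact b.contMDiffAt.smul (hχ.contMDiffAt (mem_interior_iff_mem_nhds.1 hq'))
  · filter_upwards [b.eventuallyEq_one] with q hq
    rw [hq]; simp

/-- The conformally equivalent tensor `e^{2χ} g`. -/
def SymTwoTensor.conformalChange (g : SymTwoTensor m M) {χ : M → ℝ}
    (hχ : ContMDiff (𝓡 m) 𝓘(ℝ, ℝ) ∞ χ) : SymTwoTensor m M where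
  form p := Real.exp (2 * χ p) • g.form p
  symm p v w := by
    change Real.exp (2 * χ p) * g.form p v w = Real.exp (2 * χ p) * g.form p w v
    rw [g.symm]
  contMDiff := by
    have h1 : ContMDiff (𝓡 m) 𝓘(ℝ, ℝ) ∞ fun p => Real.exp (2 * χ p) :=
      (Real.contDiff_exp.contMDiff.comp
        (((contDiff_const (c := (2 : ℝ))).mul contDiff_id).contMDiff.comp hχ))
    exact ContMDiff.smul_section h1 g.contMDiff

theorem SymTwoTensor.conformalChange_mem (g : SymTwoTensor m M) {χ : M → ℝ}
    (hχ : ContMDiff (𝓡 m) 𝓘(ℝ, ℝ) ∞ χ) : g.conformalChange hχ ∈ g.conformalClass :=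
  ⟨χ, hχ, fun _ _ _ => rfl⟩

end Extension

section RiemannianChart

open Filter Topology

variable {n : ℕ} {S : Type*} [TopologicalSpace S]
    [ChartedSpace (EuclideanSpace ℝ (Fin n)) S] [IsManifold (𝓡 n) ∞ S]
    (gS : Bundle.ContMDiffRiemannianMetric (𝓡 n) ∞ (EuclideanSpace ℝ (Fin n))
      (fun s : S ↦ TangentSpace (𝓡 n) s))

/-- The inner product of a Riemannian metric, on the model space. -/
def modelInner (s : S) (v w : EuclideanSpace ℝ (Fin n)) : ℝ :=
  gS.inner s (v : TangentSpace (𝓡 n) s) (w : TangentSpace (𝓡 n) s)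

theorem modelInner_symm (s : S) (v w : EuclideanSpace ℝ (Fin n)) :
    modelInner gS s v w = modelInner gS s w v := gS.symm s v w

theorem modelInner_sum (s : S) {ι : Type*} [Fintype ι] (a b : ι → ℝ)
    (e : ι → EuclideanSpace ℝ (Fin n)) :
    modelInner gS s (∑ i, a i • e i) (∑ j, b j • e j) =
      ∑ i, ∑ j, a i * b j * modelInner gS s (e i) (e j) := by
  have h1 : ∀ L : EuclideanSpace ℝ (Fin n) →L[ℝ] EuclideanSpace ℝ (Fin n) →L[ℝ] ℝ,
      L (∑ i, a i • e i) (∑ j, b j • e j) = ∑ i, ∑ j, a i * b j * L (e i) (e j) := by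
    intro L
    simp only [map_sum, map_smul, sum_apply, smul_apply, smul_eq_mul, Finset.mul_sum]
    rw [Finset.sum_comm]
    exact Finset.sum_congr rfl fun i _ => Finset.sum_congr rfl fun j _ => by ring
  exact h1 (gS.inner s)

/-- The matrix of a Riemannian metric in a chart. -/
def chartMatrix (c : OpenPartialHomeomorph S (EuclideanSpace ℝ (Fin n)))
    (y : EuclideanSpace ℝ (Fin n)) : Matrix (Fin n) (Fin n) ℝ :=
  Matrix.of fun i j => modelInner gS (c.symm y)
    (mfderiv (𝓡 n) (𝓡 n) c.symm y (EuclideanSpace.single i (1 : ℝ) : EuclideanSpace ℝ (Fin n)))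
    (mfderiv (𝓡 n) (𝓡 n) c.symm y (EuclideanSpace.single j (1 : ℝ) : EuclideanSpace ℝ (Fin n)))

theorem modelInner_mfderiv_symm (c : OpenPartialHomeomorph S (EuclideanSpace ℝ (Fin n)))
    (y ξ η : EuclideanSpace ℝ (Fin n)) :
    modelInner gS (c.symm y) (mfderiv (𝓡 n) (𝓡 n) c.symm y ξ) (mfderiv (𝓡 n) (𝓡 n) c.symm y η) =
      ∑ i, ∑ j, ξ i * η j * chartMatrix gS c y i j := by
  have h1 : ∀ (L : EuclideanSpace ℝ (Fin n) →L[ℝ] EuclideanSpace ℝ (Fin n))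
      (ξ : EuclideanSpace ℝ (Fin n)),
      L ξ = ∑ i, ξ i • L (EuclideanSpace.single i (1 : ℝ)) := by
    intro L ξ
    have : ξ = ∑ l, ξ l • EuclideanSpace.single l (1 : ℝ) := by
      ext i
      simp [Finset.sum_apply, Pi.single_apply]
    conv_lhs => rw [this]
    simp
  exact (congrArg₂ (modelInner gS (c.symm y)) (h1 (mfderiv (𝓡 n) (𝓡 n) c.symm y) ξ)
    (h1 (mfderiv (𝓡 n) (𝓡 n) c.symm y) η)).trans (modelInner_sum gS (c.symm y) _ _ _)

variable {c : OpenPartialHomeomorph S (EuclideanSpace ℝ (Fin n))}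

/-- The coordinate fields are the tangent map of `c.symm` applied to constant sections, hence smooth
sections along `c.symm`. The metric, a smooth section of the bundle of bilinear forms, is then
evaluated on them. -/
theorem contDiffOn_chartMatrix (hc : c ∈ IsManifold.maximalAtlas (𝓡 n) ∞ S) (i j : Fin n) :
    ContDiffOn ℝ ∞ (fun y => chartMatrix gS c y i j) c.target := by
  have hcs := contMDiffOn_symm_of_mem_maximalAtlas hc
  have hv : ∀ i, ContMDiffOn (𝓡 n) ((𝓡 n).prod (𝓡 n)) ∞
      (fun y => Bundle.TotalSpace.mk' (EuclideanSpace ℝ (Fin n))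
        (E := fun s : S => TangentSpace (𝓡 n) s) (c.symm y)
        (mfderiv (𝓡 n) (𝓡 n) c.symm y
          (EuclideanSpace.single i (1 : ℝ) : EuclideanSpace ℝ (Fin n)))) c.target := by
    intro i
    have h1 := hcs.contMDiffOn_tangentMapWithin (m := ∞) (by simp) c.open_target.uniqueMDiffOn
    have h2 : ContMDiff (𝓡 n) ((𝓡 n).prod (𝓡 n)) ∞
        (fun y : EuclideanSpace ℝ (Fin n) => (⟨y, (EuclideanSpace.single i (1 : ℝ) :
          EuclideanSpace ℝ (Fin n))⟩ : TangentBundle (𝓡 n) (EuclideanSpace ℝ (Fin n)))) :=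
      contMDiff_vectorSpace_iff_contDiff.2 contDiff_const
    refine (h1.comp h2.contMDiffOn fun y hy => hy).congr fun y hy => ?_
    simp only [Function.comp, tangentMapWithin]
    rw [mfderivWithin_of_isOpen c.open_target hy]
  have hg : ContMDiffOn (𝓡 n)
      ((𝓡 n).prod 𝓘(ℝ, EuclideanSpace ℝ (Fin n) →L[ℝ] EuclideanSpace ℝ (Fin n) →L[ℝ] ℝ)) ∞
      (fun y ↦ Bundle.TotalSpace.mk'
        (EuclideanSpace ℝ (Fin n) →L[ℝ] EuclideanSpace ℝ (Fin n) →L[ℝ] ℝ)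
        (E := fun s : S ↦ TangentSpace (𝓡 n) s →L[ℝ] TangentSpace (𝓡 n) s →L[ℝ] ℝ)
        (c.symm y) (gS.inner (c.symm y))) c.target :=
    gS.contMDiff.comp_contMDiffOn hcs
  have h3 : ContMDiffOn (𝓡 n) ((𝓡 n).prod 𝓘(ℝ)) ∞
      (fun y ↦ Bundle.TotalSpace.mk' ℝ (E := Bundle.Trivial S ℝ) (c.symm y)
        (chartMatrix gS c y i j)) c.target :=
    ContMDiffOn.clm_bundle_apply₂ (F₁ := EuclideanSpace ℝ (Fin n))
      (F₂ := EuclideanSpace ℝ (Fin n)) hg (hv i) (hv j)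
  rw [← contMDiffOn_iff_contDiffOn]
  intro y hy
  have h4 := h3 y hy
  simp only [Bundle.contMDiffWithinAt_totalSpace] at h4
  exact h4.2

/-- The differential of `c.symm` undoes that of `c`. The images `ξ`, `η` are named as vectors of the
model space so that their components make sense. -/
theorem modelInner_eq_sum (hc : c ∈ IsManifold.maximalAtlas (𝓡 n) ∞ S) {s : S}
    (hs : s ∈ c.source) (v w : TangentSpace (𝓡 n) s) (ξ η : EuclideanSpace ℝ (Fin n))
    (hξ : mfderiv (𝓡 n) (𝓡 n) c s v = ξ) (hη : mfderiv (𝓡 n) (𝓡 n) c s w = η) :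
    modelInner gS s v w = ∑ i, ∑ j, ξ i * η j * chartMatrix gS c (c s) i j := by
  have h : c.MDifferentiable (𝓡 n) (𝓡 n) :=
    ⟨(contMDiffOn_of_mem_maximalAtlas hc).mdifferentiableOn (by simp),
      (contMDiffOn_symm_of_mem_maximalAtlas hc).mdifferentiableOn (by simp)⟩
  have hL : ∀ u : TangentSpace (𝓡 n) s,
      mfderiv (𝓡 n) (𝓡 n) c.symm (c s) (mfderiv (𝓡 n) (𝓡 n) c s u) = u := fun u =>
    congrArg (fun L => L u) (h.symm_comp_deriv hs)
  have hv := hL v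
  have hw := hL w
  rw [hξ] at hv
  rw [hη] at hw
  rw [← modelInner_mfderiv_symm gS c (c s) ξ η]
  calc modelInner gS s v w = modelInner gS (c.symm (c s)) v w := by rw [c.left_inv hs]
    _ = _ := congrArg₂ (modelInner gS (c.symm (c s))) hv.symm hw.symm

theorem posDef_chartMatrix (hc : c ∈ IsManifold.maximalAtlas (𝓡 n) ∞ S)
    {y : EuclideanSpace ℝ (Fin n)} (hy : y ∈ c.target) : (chartMatrix gS c y).PosDef := by
  refine Matrix.PosDef.of_dotProduct_mulVec_pos ?_ fun v hv => ?_
  · ext i j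
    exact modelInner_symm gS _ _ _
  · have h : c.MDifferentiable (𝓡 n) (𝓡 n) :=
      ⟨(contMDiffOn_of_mem_maximalAtlas hc).mdifferentiableOn (by simp),
        (contMDiffOn_symm_of_mem_maximalAtlas hc).mdifferentiableOn (by simp)⟩
    have h1 := modelInner_mfderiv_symm gS c y (WithLp.toLp 2 v) (WithLp.toLp 2 v)
    have h2 : (mfderiv (𝓡 n) (𝓡 n) c.symm y (WithLp.toLp 2 v : EuclideanSpace ℝ (Fin n)) :
        TangentSpace (𝓡 n) (c.symm y)) ≠ 0 := by
      intro h0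
      have h3 := h.symm.mfderiv_injective hy (h0.trans (map_zero _).symm)
      exact hv (congrArg WithLp.ofLp h3)
    have h3 : 0 < modelInner gS (c.symm y)
      (mfderiv (𝓡 n) (𝓡 n) c.symm y (WithLp.toLp 2 v : EuclideanSpace ℝ (Fin n)))
      (mfderiv (𝓡 n) (𝓡 n) c.symm y (WithLp.toLp 2 v : EuclideanSpace ℝ (Fin n))) :=
      gS.pos _ _ h2
    rw [h1] at h3
    refine h3.trans_eq ?_
    simp only [dotProduct, Matrix.mulVec, Finset.mul_sum, star_trivial]
    exact Finset.sum_congr rfl fun i _ => Finset.sum_congr rfl fun j _ => by ring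

theorem isMetricOn_chartMatrix (hc : c ∈ IsManifold.maximalAtlas (𝓡 n) ∞ S) :
    Coord.IsMetricOn (chartMatrix gS c) c.target where
  isOpen := c.open_target
  contDiffOn := contDiffOn_chartMatrix gS hc
  symm _ _ _ _ := modelInner_symm gS _ _ _
  det_ne_zero _ hz := (posDef_chartMatrix gS hc hz).det_pos.ne'

end RiemannianChart

end

/-! ### Conformally flat coordinates on the fibre, and charts adapted to a product -/

noncomputable section

section LocalFlatness

open Filter Topology

variable {n : ℕ} {S : Type*} [TopologicalSpace S]
    [ChartedSpace (EuclideanSpace ℝ (Fin n)) S] [IsManifold (𝓡 n) ∞ S]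
    (gS : Bundle.ContMDiffRiemannianMetric (𝓡 n) ∞ (EuclideanSpace ℝ (Fin n))
      (fun s : S ↦ TangentSpace (𝓡 n) s))

theorem Coord.IsMetricOn.mono {H : EuclideanSpace ℝ (Fin n) → Matrix (Fin n) (Fin n) ℝ}
    {U V : Set (EuclideanSpace ℝ (Fin n))} (h : Coord.IsMetricOn H U) (hV : IsOpen V)
    (hVU : V ⊆ U) : Coord.IsMetricOn H V where
  isOpen := hV
  contDiffOn i j := (h.contDiffOn i j).mono hVU
  symm z hz := h.symm z (hVU hz)
  det_ne_zero z hz := h.det_ne_zero z (hVU hz)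

/-- A Riemannian metric whose curvature is pointwise constant is locally conformally flat. -/
theorem exists_conformallyFlat_coordinates (hn : 3 ≤ n)
    {c : OpenPartialHomeomorph S (EuclideanSpace ℝ (Fin n))}
    (hc : c ∈ IsManifold.maximalAtlas (𝓡 n) ∞ S) {s₀ : S} (hs₀ : s₀ ∈ c.source)
    (hκ : ∀ y ∈ c.target, ∃ κ : ℝ, ∀ i j k l, Coord.curvature (chartMatrix gS c) i j k l y =
      κ * (chartMatrix gS c y i k * chartMatrix gS c y j l -
        chartMatrix gS c y i l * chartMatrix gS c y j k)) :
    ∃ θ : Fin n → S → ℝ, ∃ w : S → ℝ, ∃ W ∈ 𝓝 s₀, IsOpen W ∧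
      (∀ a, ContMDiffOn (𝓡 n) 𝓘(ℝ, ℝ) ∞ (θ a) W) ∧ ContMDiffOn (𝓡 n) 𝓘(ℝ, ℝ) ∞ w W ∧
      ∀ s ∈ W, 0 < w s ∧ ∀ u v : TangentSpace (𝓡 n) s,
        gS.inner s u v = w s ^ 2 * ∑ a, SymTwoTensor.differentialAt (θ a) s u *
          SymTwoTensor.differentialAt (θ a) s v := by
  -- A ball is taken because Schur's lemma is stated on a convex set.
  obtain ⟨r, hr, hrc⟩ := Metric.isOpen_iff.1 c.open_target (c s₀) (c.map_source hs₀)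
  have hM := (isMetricOn_chartMatrix gS hc).mono Metric.isOpen_ball hrc
  obtain ⟨C, hC⟩ := hM.exists_const_curvature hn (convex_ball _ _) fun y hy => hκ y (hrc hy)
  obtain ⟨θ, w, W, hW, hWo, hθ, hw, hH⟩ := hM.exists_stereographic (Metric.mem_ball_self hr)
    (posDef_chartMatrix gS hc (c.map_source hs₀)) hC
  have hcs := contMDiffOn_of_mem_maximalAtlas hc
  refine ⟨fun a s => θ a (c s), fun s => w (c s), c.source ∩ c ⁻¹' W, ?_,
    c.isOpen_inter_preimage hWo, fun a => ?_, ?_, ?_⟩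
  · exact (c.isOpen_inter_preimage hWo).mem_nhds ⟨hs₀, (mem_of_mem_nhds hW : c s₀ ∈ W)⟩
  · exact (hθ a).contMDiffOn.comp (hcs.mono Set.inter_subset_left) fun s hs => hs.2
  · exact hw.contMDiffOn.comp (hcs.mono Set.inter_subset_left) fun s hs => hs.2
  · rintro s ⟨hs, hsW⟩
    refine ⟨(hH _ hsW).1, fun u v => ?_⟩
    have hd : ∀ (a : Fin n) (u : TangentSpace (𝓡 n) s) (ξ : EuclideanSpace ℝ (Fin n)),
        mfderiv (𝓡 n) (𝓡 n) c s u = ξ →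
        SymTwoTensor.differentialAt (fun s => θ a (c s)) s u =
          ∑ i, ξ i * Coord.partialDeriv i (θ a) (c s) := by
      intro a u ξ hξ
      have h1 : DifferentiableAt ℝ (θ a) (c s) :=
        ((hθ a).contDiffAt (hWo.mem_nhds hsW)).differentiableAt (by simp)
      have h2 : MDifferentiableAt (𝓡 n) (𝓡 n) c s :=
        (contMDiffAt_of_mem_maximalAtlas hc hs).mdifferentiableAt (by simp)
      have h3 := mfderiv_comp s h1.mdifferentiableAt h2
      rw [mfderiv_eq_fderiv] at h3
      have h4 : SymTwoTensor.differentialAt (fun s => θ a (c s)) s u =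
          fderiv ℝ (θ a) (c s) (mfderiv (𝓡 n) (𝓡 n) c s u) := congrArg (fun L => L u) h3
      rw [h4, hξ]
      exact Coord.fderiv_eq_sum _ _ _
    have h5 := modelInner_eq_sum gS hc hs u v _ _ rfl rfl
    refine h5.trans ?_
    simp_rw [hd _ u _ rfl, hd _ v _ rfl, (hH _ hsW).2]
    simp_rw [Finset.sum_mul_sum, Finset.mul_sum]
    refine (Finset.sum_congr rfl fun i _ => Finset.sum_comm).trans (Finset.sum_comm.trans ?_)
    exact Finset.sum_congr rfl fun a _ => Finset.sum_congr rfl fun i _ =>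
      Finset.sum_congr rfl fun j _ => by ring

end LocalFlatness

section ProductCharts

open Filter Topology

variable {n : ℕ} {M : Type*} [TopologicalSpace M]
    [ChartedSpace (EuclideanSpace ℝ (Fin (n + 1))) M] [IsManifold (𝓡 (n + 1)) ∞ M]
    {S : Type*} [TopologicalSpace S]
    [ChartedSpace (EuclideanSpace ℝ (Fin n)) S]

/-- The linear map `(y, t) ↦ (y₁, …, yₙ, t)`. -/
def snocCLM (n : ℕ) : EuclideanSpace ℝ (Fin n) × ℝ →L[ℝ] EuclideanSpace ℝ (Fin (n + 1)) :=
  LinearMap.toContinuousLinearMap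
    { toFun := fun z => WithLp.toLp 2 (Fin.snoc (α := fun _ => ℝ) (fun i => z.1 i) z.2)
      map_add' := fun z z' => by
        ext i
        refine Fin.lastCases ?_ (fun i => ?_) i <;> simp
      map_smul' := fun r z => by
        ext i
        refine Fin.lastCases ?_ (fun i => ?_) i <;> simp }

@[simp] theorem snocCLM_castSucc (z : EuclideanSpace ℝ (Fin n) × ℝ) (i : Fin n) :
    snocCLM n z i.castSucc = z.1 i := by
  simp [snocCLM]

@[simp] theorem snocCLM_last (z : EuclideanSpace ℝ (Fin n) × ℝ) :
    snocCLM n z (Fin.last n) = z.2 := by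
  simp [snocCLM]

@[simp] theorem head_snocCLM (z : EuclideanSpace ℝ (Fin n) × ℝ) :
    Coord.head (snocCLM n z) = z.1 := by
  ext i; simp

/-- If `(dpr, dt)` is injective, then a system of coordinates `u` of `S` near `pr(p)` and the
function `t` make up a system of coordinates near `p`. -/
theorem exists_chart_snoc {pr : M → S} {t : M → ℝ} (hpr : ContMDiff (𝓡 (n + 1)) (𝓡 n) ∞ pr)
    (ht : ContMDiff (𝓡 (n + 1)) 𝓘(ℝ, ℝ) ∞ t) {p : M}
    (hker : ∀ v : TangentSpace (𝓡 (n + 1)) p, mfderiv (𝓡 (n + 1)) (𝓡 n) pr p v = 0 →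
      mfderiv (𝓡 (n + 1)) 𝓘(ℝ, ℝ) t p v = 0 → v = 0)
    {W : Set M} (hW : W ∈ 𝓝 p) {V : Set S} (hV : V ∈ 𝓝 (pr p))
    {u : S → EuclideanSpace ℝ (Fin n)} (hu : ContMDiffOn (𝓡 n) (𝓡 n) ∞ u V)
    (hinj : Function.Injective (mfderiv (𝓡 n) (𝓡 n) u (pr p))) :
    ∃ x ∈ IsManifold.maximalAtlas (𝓡 (n + 1)) ∞ M, p ∈ x.source ∧ x.source ⊆ W ∧
      (∀ q ∈ x.source, pr q ∈ V) ∧ ∀ q ∈ x.source, x q = snocCLM n (u (pr q), t q) := by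
  have hV' : pr ⁻¹' V ∈ 𝓝 p := hpr.continuous.continuousAt hV
  have hupr : ContMDiffOn (𝓡 (n + 1)) (𝓡 n) ∞ (fun q => u (pr q)) (pr ⁻¹' V) :=
    hu.comp hpr.contMDiffOn fun q hq => hq
  have hpair : ContMDiffOn (𝓡 (n + 1)) 𝓘(ℝ, EuclideanSpace ℝ (Fin n) × ℝ) ∞
      (fun q => (u (pr q), t q)) (pr ⁻¹' V) := hupr.prodMk_space ht.contMDiffOn
  have hΨ : ContMDiffOn (𝓡 (n + 1)) (𝓡 (n + 1)) ∞ (fun q => snocCLM n (u (pr q), t q))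
      (pr ⁻¹' V) := (snocCLM n).contDiff.contMDiff.comp_contMDiffOn hpair
  obtain ⟨x, hx, hpx, hxW, hxΨ⟩ := exists_chart_of_injective_mfderiv (inter_mem hW hV')
    (hΨ.mono Set.inter_subset_right) (by
      have hΨp : MDifferentiableAt (𝓡 (n + 1)) (𝓡 (n + 1)) (fun q => snocCLM n (u (pr q), t q)) p :=
        (hΨ.contMDiffAt hV').mdifferentiableAt (by simp)
      -- Composing with `Coord.head` and with the last coordinate recovers `du ∘ dpr` and `dt` from
      -- the differential, so a vector in its kernel is killed by both `dpr` and `dt`.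
      refine (injective_iff_map_eq_zero
        (mfderiv (𝓡 (n + 1)) (𝓡 (n + 1)) (fun q => snocCLM n (u (pr q), t q)) p)).2 fun v hv => ?_
      refine hker v ?_ ?_
      · have h1 := mfderiv_comp p
          (Coord.head (n := n)).differentiableAt.mdifferentiableAt hΨp
        have h2 := mfderiv_comp p ((hu.contMDiffAt hV).mdifferentiableAt (by simp))
          (hpr.contMDiffAt.mdifferentiableAt (by simp) : MDifferentiableAt (𝓡 (n + 1)) (𝓡 n) pr p)
        have h3 : (Coord.head (n := n)) ∘ (fun q => snocCLM n (u (pr q), t q)) = u ∘ pr := by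
          funext q; simp
        rw [h3, h2] at h1
        have h4 := congrArg (fun L => L v) h1
        have h5 : mfderiv (𝓡 n) (𝓡 n) u (pr p) (mfderiv (𝓡 (n + 1)) (𝓡 n) pr p v) = 0 := by
          refine h4.trans ?_
          refine (congrArg (mfderiv (𝓡 (n + 1)) (𝓡 n) (Coord.head (n := n)) _) hv).trans ?_
          exact map_zero _
        exact hinj (h5.trans (map_zero _).symm)
      · have h1 := mfderiv_comp p
          (EuclideanSpace.proj (Fin.last n) :
            EuclideanSpace ℝ (Fin (n + 1)) →L[ℝ] ℝ).differentiableAt.mdifferentiableAt hΨp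
        have h3 : (EuclideanSpace.proj (Fin.last n) :
            EuclideanSpace ℝ (Fin (n + 1)) →L[ℝ] ℝ) ∘
            (fun q => snocCLM n (u (pr q), t q)) = t := by
          funext q; simp
        rw [h3] at h1
        have h4 := congrArg (fun L => L v) h1
        refine h4.trans ?_
        exact (congrArg (mfderiv (𝓡 (n + 1)) 𝓘(ℝ, ℝ) _ _) hv).trans (map_zero _))
  exact ⟨x, hx, hpx, hxW.trans Set.inter_subset_left, fun q hq => (hxW hq).2, hxΨ⟩

end ProductCharts

end

/-! ### Tangent vectors and the singular set of a transverse warped product -/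

noncomputable section

/-- The curvature depends only on the germ of the metric. -/
theorem Coord.curvature_congr {m : ℕ}
    {G G' : EuclideanSpace ℝ (Fin m) → Matrix (Fin m) (Fin m) ℝ}
    {U : Set (EuclideanSpace ℝ (Fin m))} (hU : IsOpen U) (h : ∀ z ∈ U, G z = G' z)
    {y : EuclideanSpace ℝ (Fin m)} (hy : y ∈ U) (i j k l : Fin m) :
    Coord.curvature G i j k l y = Coord.curvature G' i j k l y := by
  have hp : ∀ z ∈ U, ∀ i j k, Coord.partialDeriv k (fun z => G z i j) z =
      Coord.partialDeriv k (fun z => G' z i j) z := fun z hz i j k =>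
    Coord.partialDeriv_congr_of_isOpen hU (fun z hz => by rw [h z hz]) k hz
  have hΓ : ∀ k i j, ∀ z ∈ U, Coord.christoffel G k i j z = Coord.christoffel G' k i j z := by
    intro k i j z hz
    simp only [Coord.christoffel, hp z hz, h z hz]
  simp only [Coord.curvature, Coord.riemannUp, h y hy, fun k i j => hΓ k i j y hy,
    fun k i j l => Coord.partialDeriv_congr_of_isOpen hU (hΓ k i j) l hy]

namespace SymTwoTensor.IsTransverseWarpedProduct

open Filter Topology SymTwoTensor

variable {n : ℕ} {M : Type*} [TopologicalSpace M]
    [ChartedSpace (EuclideanSpace ℝ (Fin (n + 1))) M]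
    {S : Type*} [TopologicalSpace S]
    [ChartedSpace (EuclideanSpace ℝ (Fin n)) S]
    {J : TopologicalSpace.Opens ℝ}
    {Φ : M ≃ₘ^∞⟮𝓡 (n + 1), 𝓘(ℝ, ℝ).prod (𝓡 n)⟯ (J × S)} {f : ℝ → ℝ}

section

variable (Φ)

theorem contMDiff_proj : ContMDiff (𝓡 (n + 1)) (𝓡 n) ∞ (fun q : M => (Φ q).2) :=
  contMDiff_snd.comp Φ.contMDiff

theorem contMDiff_time : ContMDiff (𝓡 (n + 1)) 𝓘(ℝ, ℝ) ∞ (fun q : M => ((Φ q).1 : ℝ)) :=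
  contMDiff_subtype_val.comp (contMDiff_fst.comp Φ.contMDiff)

/-- The differential of the diffeomorphism `Φ` is injective, and so is that of the inclusion of `J`
in `ℝ`; together they make `(dt, dpr)` injective. -/
theorem eq_zero_of_mfderiv {p : M} {v : TangentSpace (𝓡 (n + 1)) p}
    (hv : mfderiv (𝓡 (n + 1)) (𝓡 n) (fun q : M => (Φ q).2) p v = 0)
    (hv' : mfderiv (𝓡 (n + 1)) 𝓘(ℝ, ℝ) (fun q : M => ((Φ q).1 : ℝ)) p v = 0) : v = 0 := by
  have h1 : MDifferentiableAt (𝓡 (n + 1)) (𝓡 n) (fun q : M => (Φ q).2) p :=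
    (contMDiff_proj Φ).contMDiffAt.mdifferentiableAt (by simp)
  have h2 : MDifferentiableAt (𝓡 (n + 1)) 𝓘(ℝ, ℝ) (fun q : M => (Φ q).1) p :=
    (contMDiff_fst.comp Φ.contMDiff).contMDiffAt.mdifferentiableAt (by simp)
  have h3 : MDifferentiableAt 𝓘(ℝ, ℝ) 𝓘(ℝ, ℝ) (fun t : J => (t : ℝ)) (Φ p).1 :=
    (contMDiff_subtype_val (n := ∞)).contMDiffAt.mdifferentiableAt (by simp)
  have h4 : mfderiv (𝓡 (n + 1)) 𝓘(ℝ, ℝ) (fun q : M => (Φ q).1) p v = 0 := by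
    refine mfderiv_opens_val_injective J _ (Eq.trans ?_ (map_zero _).symm)
    exact (congrArg (fun L => L v) (mfderiv_comp p h3 h2)).symm.trans hv'
  have h5 := h2.mfderiv_prod h1
  have h6 : mfderiv (𝓡 (n + 1)) (𝓘(ℝ, ℝ).prod (𝓡 n)) Φ p v = 0 :=
    (congrArg (fun L => L v) h5).trans (Prod.ext h4 hv)
  exact (Φ.mfderivToContinuousLinearEquiv (by simp) p).injective (h6.trans (map_zero _).symm)

/-- An injective linear map between spaces of the same dimension `n + 1` is surjective. This
supplies horizontal and vertical test vectors. -/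
theorem exists_mfderiv_eq (p : M) (ξ : EuclideanSpace ℝ (Fin n)) (r : ℝ) :
    ∃ v : TangentSpace (𝓡 (n + 1)) p,
      mfderiv (𝓡 (n + 1)) (𝓡 n) (fun q : M => (Φ q).2) p v = ξ ∧
      differentialAt (fun q : M => ((Φ q).1 : ℝ)) p v = r := by
  have key : ∀ (A : EuclideanSpace ℝ (Fin (n + 1)) →L[ℝ] EuclideanSpace ℝ (Fin n))
      (B : EuclideanSpace ℝ (Fin (n + 1)) →L[ℝ] ℝ), (∀ v, A v = 0 → B v = 0 → v = 0) →
      ∃ v, A v = ξ ∧ B v = r := by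
    intro A B h
    have hinj : Function.Injective (A.prod B).toLinearMap :=
      (injective_iff_map_eq_zero _).2 fun v hv =>
        h v (congrArg Prod.fst hv) (congrArg Prod.snd hv)
    have hsurj := (LinearMap.injective_iff_surjective_of_finrank_eq_finrank (by simp)).1 hinj
    obtain ⟨v, hv⟩ := hsurj (ξ, r)
    exact ⟨v, congrArg Prod.fst hv, congrArg Prod.snd hv⟩
  exact key (mfderiv (𝓡 (n + 1)) (𝓡 n) (fun q : M => (Φ q).2) p)
    (mfderiv (𝓡 (n + 1)) 𝓘(ℝ, ℝ) (fun q : M => ((Φ q).1 : ℝ)) p)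
    fun v hv hv' => eq_zero_of_mfderiv Φ hv hv'

end

variable [IsManifold (𝓡 (n + 1)) ∞ M] [IsManifold (𝓡 n) ∞ S]
    {gS : Bundle.ContMDiffRiemannianMetric (𝓡 n) ∞ (EuclideanSpace ℝ (Fin n))
      (fun s : S ↦ TangentSpace (𝓡 n) s)}
    {g : SymTwoTensor (n + 1) M}

/-- For `t ≠ 0`, a null vector `v` is tested against the vector with the same projection to `S` and
`dt = 0`, and against `∂_t`; positivity of `g_S` and `t ≠ 0` kill both of its components. For `t =
0`, the field `∂_t` is null. -/
theorem mem_singularSet_iff (h : g.IsTransverseWarpedProduct J Φ f gS) (p : M) :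
    p ∈ g.singularSet ↔ ((Φ p).1 : ℝ) = 0 := by
  constructor
  · rintro ⟨v, hv0, hv⟩
    by_contra ht
    refine hv0 (eq_zero_of_mfderiv Φ ?_ ?_)
    · obtain ⟨w, hw, hw'⟩ := exists_mfderiv_eq Φ p
        (mfderiv (𝓡 (n + 1)) (𝓡 n) (fun q : M => (Φ q).2) p v) 0
      have h1 := hv w
      rw [h.form_eq, hw', mul_zero, mul_zero, sub_zero, hw] at h1
      by_contra h2
      exact (mul_pos (pow_pos (h.pos _ (Φ p).1.2) 2) (gS.pos _ _ h2)).ne' h1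
    · obtain ⟨w, hw, hw'⟩ := exists_mfderiv_eq Φ p 0 1
      have h1 := hv w
      have h2 : gS.inner (Φ p).2 (mfderiv (𝓡 (n + 1)) (𝓡 n) (fun q : M => (Φ q).2) p v)
          (mfderiv (𝓡 (n + 1)) (𝓡 n) (fun q : M => (Φ q).2) p w) = 0 := by
        rw [hw]; exact map_zero _
      rw [h.form_eq, hw', h2] at h1
      have h3 : differentialAt (fun q : M => ((Φ q).1 : ℝ)) p v = 0 := by
        by_contra h4
        apply mul_ne_zero ht h4
        linarith
      exact h3
  · intro ht
    obtain ⟨v, hv, hv'⟩ := exists_mfderiv_eq Φ p 0 1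
    refine ⟨v, ?_, fun w => ?_⟩
    · intro hv0
      rw [hv0] at hv'
      exact zero_ne_one (α := ℝ) ((map_zero
        (mfderiv (𝓡 (n + 1)) 𝓘(ℝ, ℝ) (fun q : M => ((Φ q).1 : ℝ)) p)).symm.trans hv')
    · have h2 : gS.inner (Φ p).2 (mfderiv (𝓡 (n + 1)) (𝓡 n) (fun q : M => (Φ q).2) p v)
          (mfderiv (𝓡 (n + 1)) (𝓡 n) (fun q : M => (Φ q).2) p w) = 0 := by
        refine (gS.symm _ _ _).trans ?_
        rw [hv]; exact map_zero _
      rw [h.form_eq, h2, ht]; ring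

end SymTwoTensor.IsTransverseWarpedProduct

theorem SymTwoTensor.singularSet_eq_of_mem_conformalClass {m : ℕ} {M : Type*} [TopologicalSpace M]
    [ChartedSpace (EuclideanSpace ℝ (Fin m)) M] [IsManifold (𝓡 m) ∞ M]
    {g₀ g : SymTwoTensor m M} (h : g ∈ g₀.conformalClass) : g.singularSet = g₀.singularSet := by
  obtain ⟨φ, -, hφ⟩ := h
  ext p
  simp only [SymTwoTensor.singularSet, Set.mem_ofPred_eq, hφ, mul_eq_zero, Real.exp_ne_zero,
    false_or]

end

/-! ### Curvature of the fibre of a Weyl-flat warped product -/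

noncomputable section

namespace SymTwoTensor.IsTransverseWarpedProduct

open Filter Topology SymTwoTensor

variable {n : ℕ} {M : Type*} [TopologicalSpace M]
    [ChartedSpace (EuclideanSpace ℝ (Fin (n + 1))) M] [IsManifold (𝓡 (n + 1)) ∞ M]
    {S : Type*} [TopologicalSpace S]
    [ChartedSpace (EuclideanSpace ℝ (Fin n)) S] [IsManifold (𝓡 n) ∞ S]
    {J : TopologicalSpace.Opens ℝ}
    {Φ : M ≃ₘ^∞⟮𝓡 (n + 1), 𝓘(ℝ, ℝ).prod (𝓡 n)⟯ (J × S)} {f : ℝ → ℝ}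
    {gS : Bundle.ContMDiffRiemannianMetric (𝓡 n) ∞ (EuclideanSpace ℝ (Fin n))
      (fun s : S ↦ TangentSpace (𝓡 n) s)}
    {g : SymTwoTensor (n + 1) M}

/-- A transverse warped product metric in the coordinates `(c, t)`, where `c` is a coordinate
system of `S`. -/
theorem inCoord_eq (h : g.IsTransverseWarpedProduct J Φ f gS)
    {c : OpenPartialHomeomorph S (EuclideanSpace ℝ (Fin n))}
    (hc : c ∈ IsManifold.maximalAtlas (𝓡 n) ∞ S)
    {x : OpenPartialHomeomorph M (EuclideanSpace ℝ (Fin (n + 1)))}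
    (hx : x ∈ IsManifold.maximalAtlas (𝓡 (n + 1)) ∞ M)
    (hxc : ∀ q ∈ x.source, (Φ q).2 ∈ c.source)
    (hxq : ∀ q ∈ x.source, x q = snocCLM n (c (Φ q).2, ((Φ q).1 : ℝ)))
    {z : EuclideanSpace ℝ (Fin (n + 1))} (hz : z ∈ x.target) :
    Coord.head z ∈ c.target ∧ z (Fin.last n) ∈ J ∧
    g.inCoord x z = f (z (Fin.last n)) ^ 2 • Coord.productMetric (chartMatrix gS c)
      (fun t => -t / f t ^ 2) z := by
  have hxz : ∀ z ∈ x.target, z = snocCLM n (c (Φ (x.symm z)).2, ((Φ (x.symm z)).1 : ℝ)) :=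
    fun z hz => (x.right_inv hz).symm.trans (hxq _ (x.map_target hz))
  have ht : ∀ z ∈ x.target, ((Φ (x.symm z)).1 : ℝ) = z (Fin.last n) := fun z hz => by
    conv_rhs => rw [hxz z hz]
    simp
  have hhead : ∀ z ∈ x.target, Coord.head z = c (Φ (x.symm z)).2 := fun z hz => by
    conv_lhs => rw [hxz z hz]
    simp
  have hcs : ∀ z ∈ x.target, (Φ (x.symm z)).2 = c.symm (Coord.head z) := fun z hz => by
    rw [hhead z hz, c.left_inv (hxc _ (x.map_target hz))]
  have hzc : Coord.head z ∈ c.target := by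
    rw [hhead z hz]; exact c.map_source (hxc _ (x.map_target hz))
  have hzJ : z (Fin.last n) ∈ J := by rw [← ht z hz]; exact (Φ (x.symm z)).1.2
  refine ⟨hzc, hzJ, ?_⟩
  have hxd : MDifferentiableAt (𝓡 (n + 1)) (𝓡 (n + 1)) x.symm z :=
    (contMDiffAt_symm_of_mem_maximalAtlas hx hz).mdifferentiableAt (by simp)
  -- In these coordinates the projection to `S` is `c.symm ∘ head` and `t` is the last coordinate;
  -- the differentials follow by comparing both sides near `z`.
  have hd1 : ∀ i, (mfderiv (𝓡 (n + 1)) (𝓡 n) (fun q : M => (Φ q).2) (x.symm z) (coordVec x z i) :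
      EuclideanSpace ℝ (Fin n)) =
      mfderiv (𝓡 n) (𝓡 n) c.symm (Coord.head z) (Coord.head (EuclideanSpace.single i 1)) := by
    intro i
    have h1 := mfderiv_comp z (((contMDiff_proj Φ).contMDiffAt.mdifferentiableAt (by simp) :
      MDifferentiableAt (𝓡 (n + 1)) (𝓡 n) (fun q : M => (Φ q).2) (x.symm z))) hxd
    have h2 := mfderiv_comp z ((contMDiffAt_symm_of_mem_maximalAtlas hc hzc).mdifferentiableAt
      (by simp)) (Coord.head (n := n)).differentiableAt.mdifferentiableAt
    have h3 : ((fun q : M => (Φ q).2) ∘ x.symm) =ᶠ[𝓝 z] (c.symm ∘ Coord.head (n := n)) :=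
      eventuallyEq_of_mem (x.open_target.mem_nhds hz) hcs
    have h4 := h3.mfderiv_eq (I := 𝓡 (n + 1)) (I' := 𝓡 n)
    have h5 := congrArg (fun L : EuclideanSpace ℝ (Fin (n + 1)) →L[ℝ] EuclideanSpace ℝ (Fin n) =>
      L (EuclideanSpace.single i 1)) ((h1.symm.trans h4).trans h2)
    refine h5.trans ?_
    exact congrArg (mfderiv (𝓡 n) (𝓡 n) c.symm (Coord.head z))
      (congrArg (fun L : EuclideanSpace ℝ (Fin (n + 1)) →L[ℝ] EuclideanSpace ℝ (Fin n) =>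
      L (EuclideanSpace.single i 1)) (mfderiv_eq_fderiv.trans (Coord.head (n := n)).fderiv))
  have hd2 : ∀ i, differentialAt (fun q : M => ((Φ q).1 : ℝ)) (x.symm z) (coordVec x z i) =
      if i = Fin.last n then 1 else 0 := by
    intro i
    have h1 := mfderiv_comp z (((contMDiff_time Φ).contMDiffAt.mdifferentiableAt (by simp) :
      MDifferentiableAt (𝓡 (n + 1)) 𝓘(ℝ, ℝ) (fun q : M => ((Φ q).1 : ℝ)) (x.symm z))) hxd
    have h3 : ((fun q : M => ((Φ q).1 : ℝ)) ∘ x.symm) =ᶠ[𝓝 z] (EuclideanSpace.proj (Fin.last n) :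
        EuclideanSpace ℝ (Fin (n + 1)) →L[ℝ] ℝ) :=
      eventuallyEq_of_mem (x.open_target.mem_nhds hz) ht
    have h4 := h3.mfderiv_eq (I := 𝓡 (n + 1)) (I' := 𝓘(ℝ, ℝ))
    have h5 := congrArg (fun L : EuclideanSpace ℝ (Fin (n + 1)) →L[ℝ] ℝ =>
      L (EuclideanSpace.single i 1)) ((h1.symm.trans h4).trans
        (mfderiv_eq_fderiv.trans (EuclideanSpace.proj (Fin.last n) :
        EuclideanSpace ℝ (Fin (n + 1)) →L[ℝ] ℝ).fderiv))
    refine h5.trans ?_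
    simp [eq_comm]
  have hf0 : f (z (Fin.last n)) ≠ 0 := (h.pos _ hzJ).ne'
  have hform : ∀ i j, g.inCoord x z i j = f (z (Fin.last n)) ^ 2 * modelInner gS
      (c.symm (Coord.head z))
      (mfderiv (𝓡 n) (𝓡 n) c.symm (Coord.head z) (Coord.head (EuclideanSpace.single i 1)))
      (mfderiv (𝓡 n) (𝓡 n) c.symm (Coord.head z) (Coord.head (EuclideanSpace.single j 1))) -
      z (Fin.last n) * ((if i = Fin.last n then 1 else 0) * (if j = Fin.last n then 1 else 0)) := by
    intro i j
    have h1 := h.form_eq (x.symm z) (coordVec x z i) (coordVec x z j)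
    rw [hd2 i, hd2 j, ht z hz] at h1
    refine h1.trans ?_
    congr 2
    rw [← hcs z hz]
    exact congrArg₂ (modelInner gS (Φ (x.symm z)).2) (hd1 i) (hd1 j)
  have h0 : (mfderiv (𝓡 n) (𝓡 n) c.symm (Coord.head z)
      (Coord.head (EuclideanSpace.single (Fin.last n) 1)) : EuclideanSpace ℝ (Fin n)) = 0 :=
    (congrArg (mfderiv (𝓡 n) (𝓡 n) c.symm (Coord.head z)) (Coord.head_single_last 1)).trans
      (map_zero _)
  have h0l : ∀ v, modelInner gS (c.symm (Coord.head z)) (mfderiv (𝓡 n) (𝓡 n) c.symm (Coord.head z)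
      (Coord.head (EuclideanSpace.single (Fin.last n) 1))) v = 0 := fun v =>
    (congrArg (fun w => modelInner gS (c.symm (Coord.head z)) w v) h0).trans
      (congrArg (fun L : EuclideanSpace ℝ (Fin n) →L[ℝ] ℝ => L v) (map_zero (gS.inner _)))
  have h0r := fun v => (modelInner_symm gS (c.symm (Coord.head z)) v _).trans (h0l v)
  -- `P` is the pullback of `g_S`, made opaque so that only its block structure enters the
  -- comparison.
  obtain ⟨P, hP, hPl, hPr, hPc⟩ : ∃ P : Fin (n + 1) → Fin (n + 1) → ℝ,
      (∀ i j, g.inCoord x z i j = f (z (Fin.last n)) ^ 2 * P i j -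
        z (Fin.last n) * ((if i = Fin.last n then 1 else 0) *
          (if j = Fin.last n then 1 else 0))) ∧
      (∀ j, P (Fin.last n) j = 0) ∧ (∀ i, P i (Fin.last n) = 0) ∧
      ∀ i j : Fin n, P i.castSucc j.castSucc = chartMatrix gS c (Coord.head z) i j :=
    ⟨_, hform, fun _ => h0l _, fun _ => h0r _, fun i j => by
      simp only [Coord.head_single_castSucc]; rfl⟩
  ext i j
  rw [hP]
  refine Fin.lastCases ?_ (fun i => ?_) i <;> refine Fin.lastCases ?_ (fun j => ?_) j
  · simp only [hPl, Matrix.smul_apply, Coord.productMetric_last_last, if_true, smul_eq_mul]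
    field_simp
    ring
  · simp [hPl, (Fin.castSucc_lt_last _).ne]
  · simp [hPr, (Fin.castSucc_lt_last _).ne]
  · simp [hPc, (Fin.castSucc_lt_last _).ne]

/-- If the Weyl tensor of a conformal class containing a transverse warped product vanishes, then
the fibre has pointwise constant curvature. -/
theorem exists_curvature_chartMatrix (h : g.IsTransverseWarpedProduct J Φ f gS)
    {g₀ : SymTwoTensor (n + 1) M} (hg : g ∈ g₀.conformalClass) (hW : g₀.WeylVanishes)
    {c : OpenPartialHomeomorph S (EuclideanSpace ℝ (Fin n))}
    (hc : c ∈ IsManifold.maximalAtlas (𝓡 n) ∞ S) {y : EuclideanSpace ℝ (Fin n)}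
    (hy : y ∈ c.target) :
    ∃ κ : ℝ, ∀ i j k l, Coord.curvature (chartMatrix gS c) i j k l y =
      κ * (chartMatrix gS c y i k * chartMatrix gS c y j l -
        chartMatrix gS c y i l * chartMatrix gS c y j k) := by
  -- The Weyl condition holds off `Σ` only, but the curvature of the fibre can be read off at any
  -- height, so one nonzero `t` serves for every point of `S`.
  obtain ⟨t, htJ, ht0⟩ : ∃ t ∈ J, t ≠ 0 := by
    obtain ⟨r, hr, hrJ⟩ := Metric.isOpen_iff.1 J.isOpen 0 h.zero_mem
    refine ⟨r / 2, hrJ ?_, by positivity⟩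
    rw [Metric.mem_ball, dist_zero_right, Real.norm_eq_abs, abs_of_pos (by positivity)]
    linarith
  have hsing := singularSet_eq_of_mem_conformalClass hg
  obtain ⟨φ, hφ, hgφ⟩ := hg
  let p : M := Φ.symm (⟨t, htJ⟩, c.symm y)
  have hΦp : Φ p = (⟨t, htJ⟩, c.symm y) := Φ.apply_symm_apply _
  have hps : (Φ p).2 ∈ c.source := by rw [hΦp]; exact c.map_target hy
  have hcd : c.MDifferentiable (𝓡 n) (𝓡 n) :=
    ⟨(contMDiffOn_of_mem_maximalAtlas hc).mdifferentiableOn (by simp),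
      (contMDiffOn_symm_of_mem_maximalAtlas hc).mdifferentiableOn (by simp)⟩
  obtain ⟨x, hx, hpx, -, hxc, hxq⟩ := exists_chart_snoc (contMDiff_proj Φ) (contMDiff_time Φ)
    (p := p) (fun v hv hv' => eq_zero_of_mfderiv Φ hv hv') univ_mem
    (c.open_source.mem_nhds hps) (contMDiffOn_of_mem_maximalAtlas hc) (hcd.mfderiv_injective hps)
  have hxp : x p = snocCLM n (y, t) := by rw [hxq p hpx, hΦp, c.right_inv hy]
  have hlast : x p (Fin.last n) = t := by rw [hxp]; simp
  have hhead : Coord.head (x p) = y := by rw [hxp]; simp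
  have hpsing : p ∉ g₀.singularSet := by
    rw [← hsing, h.mem_singularSet_iff, hΦp]; exact ht0
  have hweyl := hW x hx p hpx hpsing
  -- From `g = e^{2φ} g₀` and `g = f² (g_S + α dt²)`, the factor between `g₀` and the product is
  -- `e^{-2φ} f²`.
  let u : EuclideanSpace ℝ (Fin (n + 1)) → ℝ := fun z =>
    Real.exp (-(2 * φ (x.symm z))) * f (z (Fin.last n)) ^ 2
  let α : ℝ → ℝ := fun t => -t / f t ^ 2
  let T : Set ℝ := J ∩ {t | t ≠ 0}
  have hT : IsOpen T := J.isOpen.inter isOpen_ne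
  have hαT : ContDiffOn ℝ ∞ α T := contDiff_neg.contDiffOn.div
    ((h.contDiffOn.mono Set.inter_subset_left).pow 2) fun t ht => (pow_pos (h.pos t ht.1) 2).ne'
  have hα0 : ∀ t ∈ T, α t ≠ 0 := fun t ht =>
    div_ne_zero (neg_ne_zero.2 ht.2) (pow_pos (h.pos t ht.1) 2).ne'
  let U : Set (EuclideanSpace ℝ (Fin (n + 1))) := x.target ∩ {z | z (Fin.last n) ≠ 0}
  have hU : IsOpen U := x.open_target.inter
    (isOpen_ne.preimage Coord.contDiff_last.continuous)
  have hpU : x p ∈ U := ⟨x.map_source hpx, by change x p (Fin.last n) ≠ 0; rwa [hlast]⟩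
  have hin : ∀ z ∈ U, g₀.inCoord x z = u z • Coord.productMetric (chartMatrix gS c) α z := by
    intro z hz
    have h1 := (h.inCoord_eq hc hx hxc hxq hz.1).2.2
    ext i j
    have h2 := congrFun (congrFun h1 i) j
    have h3 := hgφ (x.symm z) (coordVec x z i) (coordVec x z j)
    have h4 : g₀.inCoord x z i j = Real.exp (-(2 * φ (x.symm z))) * g.inCoord x z i j := by
      change g₀.form _ _ _ = Real.exp (-(2 * φ (x.symm z))) * g.form _ _ _
      rw [h3, ← mul_assoc, ← Real.exp_add]
      simp
    rw [h4, h2]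
    simp only [Matrix.smul_apply, smul_eq_mul, u, α]
    ring
  have hM := isMetricOn_chartMatrix gS hc
  have hP : Coord.IsMetricOn (Coord.productMetric (chartMatrix gS c) α) U :=
    (hM.product hT hαT hα0).mono hU fun z hz => by
      have h1 := h.inCoord_eq hc hx hxc hxq hz.1
      exact ⟨h1.1, h1.2.1, hz.2⟩
  have huU : ContDiffOn ℝ ∞ u U := by
    have h1 : ContDiffOn ℝ ∞ (fun z => φ (x.symm z)) U := by
      rw [← contMDiffOn_iff_contDiffOn]
      exact hφ.comp_contMDiffOn ((contMDiffOn_symm_of_mem_maximalAtlas hx).mono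
        Set.inter_subset_left)
    refine (contDiffOn_const.mul h1).neg.exp.mul (ContDiffOn.pow ?_ 2)
    exact h.contDiffOn.comp Coord.contDiff_last.contDiffOn fun z hz =>
      (h.inCoord_eq hc hx hxc hxq hz.1).2.1
  have hu0 : ∀ z ∈ U, u z ≠ 0 := fun z hz => mul_ne_zero (Real.exp_ne_zero _)
    (pow_pos (h.pos _ (h.inCoord_eq hc hx hxc hxq hz.1).2.1) 2).ne'
  obtain ⟨θ, hθ⟩ := hP.curvature_eq_kulkarniNomizu_of_smul huU hu0 hpU
    -- `W = 0` is the statement that the curvature of `g₀` is its Schouten tensor times `g₀`.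
    (θ := fun a b => Coord.schouten (g₀.inCoord x) a b (x p)) fun i j k l => by
      rw [← Coord.curvature_congr hU hin hpU, ← hin _ hpU]
      exact sub_eq_zero.1 (hweyl i j k l)
  have := Coord.exists_curvature_eq_of_productMetric hM hT hαT hα0 (z := x p)
    (by rwa [hhead]) (by rw [hlast]; exact ⟨htJ, ht0⟩) hθ
  rwa [hhead] at this

end SymTwoTensor.IsTransverseWarpedProduct

end

/-! ### The conformal factor and the normal form -/

noncomputable section

section Assembly

open Filter Topology SymTwoTensor

/-- A map to Euclidean space is smooth if its components are. -/
theorem contMDiffOn_toLp {n : ℕ} {S : Type*} [TopologicalSpace S]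
    [ChartedSpace (EuclideanSpace ℝ (Fin n)) S] {W : Set S} {θ : Fin n → S → ℝ}
    (hθ : ∀ a, ContMDiffOn (𝓡 n) 𝓘(ℝ, ℝ) ∞ (θ a) W) :
    ContMDiffOn (𝓡 n) (𝓡 n) ∞
      (fun s => (WithLp.toLp 2 (fun a => θ a s) : EuclideanSpace ℝ (Fin n))) W :=
  (EuclideanSpace.equiv (Fin n) ℝ).symm.contDiff.contMDiff.comp_contMDiffOn
    (contMDiffOn_pi_space.2 hθ)

theorem differentialAt_apply_eq_zero {m k : ℕ} {S : Type*} [TopologicalSpace S]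
    [ChartedSpace (EuclideanSpace ℝ (Fin m)) S] {u : S → EuclideanSpace ℝ (Fin k)} {s : S}
    (hu : MDifferentiableAt (𝓡 m) (𝓡 k) u s) {v : TangentSpace (𝓡 m) s}
    (hv : mfderiv (𝓡 m) (𝓡 k) u s v = 0) (a : Fin k) :
    differentialAt (fun s => u s a) s v = 0 := by
  have h1 := mfderiv_comp s
    (EuclideanSpace.proj a : EuclideanSpace ℝ (Fin k) →L[ℝ] ℝ).differentiableAt.mdifferentiableAt
    hu
  refine (congrArg (fun L => L v) h1).trans ?_
  exact (congrArg (mfderiv (𝓡 k) 𝓘(ℝ, ℝ) _ _) hv).trans (map_zero _)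

theorem differentialAt_congr {m : ℕ} {S : Type*} [TopologicalSpace S]
    [ChartedSpace (EuclideanSpace ℝ (Fin m)) S] {u u' : S → ℝ} {s : S} (h : u =ᶠ[𝓝 s] u')
    (v : TangentSpace (𝓡 m) s) : differentialAt u s v = differentialAt u' s v :=
  congrArg (fun L : EuclideanSpace ℝ (Fin m) →L[ℝ] ℝ => L v) h.mfderiv_eq

theorem mfderiv_mul_ne_zero {m : ℕ} {S : Type*} [TopologicalSpace S]
    [ChartedSpace (EuclideanSpace ℝ (Fin m)) S] {t β : S → ℝ} {s : S}
    (ht : MDifferentiableAt (𝓡 m) 𝓘(ℝ, ℝ) t s) (hβ : MDifferentiableAt (𝓡 m) 𝓘(ℝ, ℝ) β s)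
    (hts : t s = 0) (hβs : β s ≠ 0) {v : TangentSpace (𝓡 m) s} (hv : differentialAt t s v ≠ 0) :
    mfderiv (𝓡 m) 𝓘(ℝ, ℝ) (fun q => t q * β q) s ≠ 0 := by
  intro h0
  have h1 := (ht.hasMFDerivAt.mul hβ.hasMFDerivAt).mfderiv
  have h2 : (0 : ℝ) = t s * differentialAt β s v + β s * differentialAt t s v :=
    congrArg (fun L => L v) (h0.symm.trans h1)
  rw [hts, zero_mul, zero_add] at h2
  exact mul_ne_zero hβs hv h2.symm

end Assembly

theorem mainTheorem6 {n : ℕ} (hn : 4 ≤ n + 1)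
    {M : Type*} [TopologicalSpace M] [T2Space M] [SecondCountableTopology M] [ConnectedSpace M]
    [ChartedSpace (EuclideanSpace ℝ (Fin (n + 1))) M] [IsManifold (𝓡 (n + 1)) ∞ M]
    (g₀ : SymTwoTensor (n + 1) M) (hg₀ : g₀.IsTransverseRiemannLorentz)
    {S : Type*} [TopologicalSpace S]
    [ChartedSpace (EuclideanSpace ℝ (Fin n)) S] [IsManifold (𝓡 n) ∞ S]
    (J : TopologicalSpace.Opens ℝ)
    (Φ : M ≃ₘ^∞⟮𝓡 (n + 1), 𝓘(ℝ, ℝ).prod (𝓡 n)⟯ (J × S)) (f : ℝ → ℝ)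
    (gS : Bundle.ContMDiffRiemannianMetric (𝓡 n) ∞ (EuclideanSpace ℝ (Fin n))
      (fun s : S ↦ TangentSpace (𝓡 n) s))
    (hwarped : ∃ g ∈ g₀.conformalClass, g.IsTransverseWarpedProduct J Φ f gS)
    (hW : g₀.WeylVanishes) :
    ∀ p ∈ g₀.singularSet, ∃ x ∈ IsManifold.maximalAtlas (𝓡 (n + 1)) ∞ M, p ∈ x.source ∧
      ∃ g ∈ g₀.conformalClass, ∃ τ : M → ℝ,
        g.IsEquationOn τ x.source ∧ g.HasNormalForm x τ := by
  intro p _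
  obtain ⟨g, hg, hwp⟩ := hwarped
  have hc := IsManifold.chart_mem_maximalAtlas (I := 𝓡 n) (n := ∞) (Φ p).2
  obtain ⟨θ, w, W, hWp, hWo, hθ, hw, hgS⟩ := exists_conformallyFlat_coordinates gS (by omega) hc
    (mem_chart_source _ (Φ p).2) fun y hy => hwp.exists_curvature_chartMatrix hg hW hc hy
  have hsing : ∀ q, q ∈ g₀.singularSet ↔ ((Φ q).1 : ℝ) = 0 := fun q => by
    rw [← SymTwoTensor.singularSet_eq_of_mem_conformalClass hg, hwp.mem_singularSet_iff]
  obtain ⟨φ, hφ, hgφ⟩ := hg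
  have hpr := SymTwoTensor.IsTransverseWarpedProduct.contMDiff_proj Φ
  have ht := SymTwoTensor.IsTransverseWarpedProduct.contMDiff_time Φ
  have hfpos : ∀ q : M, 0 < f (Φ q).1 := fun q => hwp.pos _ (Φ q).1.2
  have hf : ContMDiff (𝓡 (n + 1)) 𝓘(ℝ, ℝ) ∞ (fun q : M => f (Φ q).1) :=
    fun q => (hwp.contDiffOn.contDiffAt (J.isOpen.mem_nhds (Φ q).1.2)).contMDiffAt.comp q
      ht.contMDiffAt
  have hwW : ContMDiffOn (𝓡 (n + 1)) 𝓘(ℝ, ℝ) ∞ (fun q : M => w (Φ q).2)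
      ((fun q : M => (Φ q).2) ⁻¹' W) := hw.comp hpr.contMDiffOn fun q hq => hq
  have hlog : ∀ {u : M → ℝ} {V : Set M}, ContMDiffOn (𝓡 (n + 1)) 𝓘(ℝ, ℝ) ∞ u V →
      (∀ q ∈ V, 0 < u q) → ContMDiffOn (𝓡 (n + 1)) 𝓘(ℝ, ℝ) ∞ (fun q => Real.log (u q)) V :=
    fun hu hpos q hq => (Real.contDiffAt_log.2 (hpos q hq).ne').contMDiffAt.comp_contMDiffWithinAt
      q (hu q hq)
  -- The factor is chosen so that `e^{2χ} g₀ = e^{2φ} g₀ / (f² w²) = g / (f² w²)`. The formula makes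
  -- sense only over `W`, hence the passage to a global function with the same germ at `p`.
  obtain ⟨χ, hχ, hχe⟩ := exists_contMDiff_eventuallyEq (hpr.continuous.continuousAt hWp)
    (χ := fun q : M => φ q - Real.log (f (Φ q).1) - Real.log (w (Φ q).2))
    ((hφ.contMDiffOn.sub (hlog hf.contMDiffOn fun q _ => hfpos q)).sub
      (hlog hwW fun q hq => (hgS _ hq).1))
  have hu := contMDiffOn_toLp hθ
  -- Passing `hχe` as the neighbourhood keeps the chart inside the set where the global `χ` agrees
  -- with the formula.
  obtain ⟨x, hx, hpx, hxN, hxW, hxq⟩ := exists_chart_snoc hpr ht (p := p)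
    (fun v hv hv' => SymTwoTensor.IsTransverseWarpedProduct.eq_zero_of_mfderiv Φ hv hv') hχe hWp hu
    (by
      -- A vector killed by all `dθ_a` has length zero for `g_S = w² ∑ (dθ_a)²`, hence is zero.
      refine (injective_iff_map_eq_zero (mfderiv (𝓡 n) (𝓡 n) _ (Φ p).2)).2 fun v hv => ?_
      have h1 := differentialAt_apply_eq_zero
        ((hu.contMDiffAt hWp).mdifferentiableAt (by simp)) hv
      by_contra hv0
      have h2 := gS.pos _ v hv0
      rw [(hgS _ (mem_of_mem_nhds hWp)).2 v v] at h2
      refine h2.ne' ?_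
      rw [Finset.sum_eq_zero fun a _ => mul_eq_zero_of_left (h1 a) _, mul_zero])
  -- `τ = t β`, where `-β` is the ratio of the new metric to `g`, so the term `-t dt²` of `g`
  -- becomes `τ dt²`.
  let β : M → ℝ := fun q => -(f (Φ q).1 ^ 2 * w (Φ q).2 ^ 2)⁻¹
  have hwpos : ∀ q ∈ x.source, 0 < w (Φ q).2 := fun q hq => (hgS _ (hxW q hq)).1
  have hfw : ∀ q ∈ x.source, f (Φ q).1 ^ 2 * w (Φ q).2 ^ 2 ≠ 0 := fun q hq =>
    (mul_pos (pow_pos (hfpos q) 2) (pow_pos (hwpos q hq) 2)).ne'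
  have hβ0 : ∀ q ∈ x.source, β q ≠ 0 := fun q hq => neg_ne_zero.2 (inv_ne_zero (hfw q hq))
  have hβ : ContMDiffOn (𝓡 (n + 1)) 𝓘(ℝ, ℝ) ∞ β x.source := by
    have h1 : ContMDiffOn (𝓡 (n + 1)) 𝓘(ℝ, ℝ) ∞
        (fun q => f (Φ q).1 ^ 2 * w (Φ q).2 ^ 2) x.source :=
      (hf.contMDiffOn.pow 2).mul ((hwW.mono hxW).pow 2)
    intro q hq
    have h2 : ContDiffAt ℝ ∞ (fun r : ℝ => -r⁻¹) (f (Φ q).1 ^ 2 * w (Φ q).2 ^ 2) :=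
      (contDiffAt_inv ℝ (hfw q hq)).neg
    exact h2.contMDiffAt.comp_contMDiffWithinAt (g := fun r : ℝ => -r⁻¹)
      (f := fun q => f (Φ q).1 ^ 2 * w (Φ q).2 ^ 2) q (h1 q hq)
  have hsing' : ∀ q, q ∈ (g₀.conformalChange hχ).singularSet ↔ ((Φ q).1 : ℝ) = 0 := fun q => by
    rw [SymTwoTensor.singularSet_eq_of_mem_conformalClass (g₀.conformalChange_mem hχ), hsing]
  refine ⟨x, hx, hpx, g₀.conformalChange hχ, g₀.conformalChange_mem hχ,
    fun q => ((Φ q).1 : ℝ) * β q, ⟨?_, fun q hq => ?_, fun q hq hqs => ?_⟩, fun q hq v v' => ?_⟩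
  · exact ht.contMDiffOn.mul hβ
  · rw [hsing', mul_eq_zero, or_iff_left (hβ0 q hq)]
  -- On `t = 0` the product rule leaves `dτ = β dt`, which is nonzero on a vector with `dt = 1`.
  · obtain ⟨v, -, hv⟩ := SymTwoTensor.IsTransverseWarpedProduct.exists_mfderiv_eq Φ q 0 1
    exact mfderiv_mul_ne_zero (ht.contMDiffAt.mdifferentiableAt (by simp))
      ((hβ.contMDiffAt (x.open_source.mem_nhds hq)).mdifferentiableAt (by simp))
      ((hsing' q).1 hqs) (hβ0 q hq) (v := v) (by rw [hv]; exact one_ne_zero)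
  · have hlast : ∀ v : TangentSpace (𝓡 (n + 1)) q, SymTwoTensor.coordDiff x (Fin.last n) q v =
        SymTwoTensor.differentialAt (fun q : M => ((Φ q).1 : ℝ)) q v := fun v =>
      differentialAt_congr (Filter.eventuallyEq_of_mem (x.open_source.mem_nhds hq) fun q' hq' => by
        simp only [hxq q' hq', snocCLM_last]) v
    have hfirst : ∀ (i : Fin n) (v : TangentSpace (𝓡 (n + 1)) q),
        SymTwoTensor.coordDiff x i.castSucc q v = SymTwoTensor.differentialAt (θ i) (Φ q).2
          (mfderiv (𝓡 (n + 1)) (𝓡 n) (fun q : M => (Φ q).2) q v) := fun i v => by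
      have h1 := differentialAt_congr (u := fun q => x q i.castSucc)
        (u' := θ i ∘ fun q : M => (Φ q).2)
        (Filter.eventuallyEq_of_mem (x.open_source.mem_nhds hq) fun q' hq' => by
          simp only [hxq q' hq', snocCLM_castSucc]; rfl) v
      refine h1.trans ?_
      exact congrArg (fun L => L v) (mfderiv_comp q
        (((hθ i).contMDiffAt (hWo.mem_nhds (hxW q hq))).mdifferentiableAt (by simp))
        (hpr.contMDiffAt.mdifferentiableAt (by simp)))
    have hform : (g₀.conformalChange hχ).form q v v' = -β q * g.form q v v' := by
      change Real.exp (2 * χ q) * g₀.form q v v' = _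
      have h1 : χ q = φ q - Real.log (f (Φ q).1) - Real.log (w (Φ q).2) := hxN hq
      have h2 : Real.exp (2 * χ q) = -β q * Real.exp (2 * φ q) := by
        have h3 : 2 * χ q = 2 * φ q - (2 * Real.log (f (Φ q).1) + 2 * Real.log (w (Φ q).2)) := by
          rw [h1]; ring
        rw [h3, Real.exp_sub, Real.exp_add, ← Nat.cast_ofNat, Real.exp_nat_mul,
          Real.exp_nat_mul, Real.exp_nat_mul, Real.exp_log (hfpos q), Real.exp_log (hwpos q hq)]
        simp only [β, neg_neg]
        rw [div_eq_mul_inv, mul_comm]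
      rw [hgφ, h2, mul_assoc]
    rw [hform, hwp.form_eq, (hgS _ (hxW q hq)).2]
    simp only [hlast, hfirst]
    -- The same factor normalizes the coefficient of the flat part to `1`.
    have h4 : -β q * (f (Φ q).1 ^ 2 * w (Φ q).2 ^ 2) = 1 := by
      simp only [β, neg_neg]
      exact inv_mul_cancel₀ (hfw q hq)
    linear_combination (∑ a, SymTwoTensor.differentialAt (θ a) (Φ q).2
        (mfderiv (𝓡 (n + 1)) (𝓡 n) (fun q : M => (Φ q).2) q v) *
      SymTwoTensor.differentialAt (θ a) (Φ q).2
        (mfderiv (𝓡 (n + 1)) (𝓡 n) (fun q : M => (Φ q).2) q v')) * h4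

end
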